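/- \textbf{Setting.} Let $(W,S)$ be a Coxeter system, $\Bbbk$ a field, and $V$ a finite-dimensional realization of $(W,S)$ over $\Bbbk$ with roots $\alpha_s\in V$ and coroots $\alpha_s^\vee\in V^*$. Assume that it is faithful, balanced and reflection faithful and that generalized Demazure surjectivity holds, i.e. $\partial_{w_I}\colon R\to R^I$ is surjective for every finitary $I\subset S$. Here $R=\operatorname{Sym}(V)$ with $\deg V=2$, a subset $I\subset S$ is finitary if the parabolic subgroup $W_I$ is finite, $w_I$ is then its longest element, $\ell(I)=\ell(w_I)$, $R^I=R^{W_I}$, and for $I\subset J$ finitary $\partial^I_J=\partial_{w_Jw_I^{-1}}\colon R^I\to R^J$ is the Frobenius trace. Let $\Delta^I_J=\sum_i c_i\otimes d_i$ for dual bases $\{c_i\},\{d_i\}$ of $R^I$ over $R^J$ with respect to $\partial^I_J$, and let $\Phi^+_I$ be the set of positive roots $w(\alpha_s)$, $w\in W_I$, $s\in I$. \textbf{The 2-category $\mathbf{Frob}$.} Its objects are the finitary subsets of $S$ and its 1-morphisms are the singlestep expressions $[I\pm s_1\pm s_2\cdots]$, in which $+s$ adds an element and $-s$ removes one and all subsets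 are finitary; they are drawn as oriented coloured strands with regions labelled by the subsets. Its 2-morphisms are $\Bbbk$-linear combinations of diagrams generated by oriented cups and caps, up-facing crossings $[I+t+s]\to[I+s+t]$ ($s\neq t$) and polynomials $f\in R^I$ in the regions labelled $I$, modulo the relations of a cyclic 2-category (so that isotopic diagrams agree; sideways crossings are rotations of the up-facing one) and the following local relations. Polynomials add and multiply as in $R^I$, and $f\in R^{Is}$ slides across an $s$-strand. A clockwise $s$-circle in the region $I$ equals $\mu^I_{Is}=\sum_i c_id_i$ (dual bases for $R^{Is}\subset R^I$), and a counterclockwise $s$-circle containing $f\in R^I$ equals $\partial^I_{Is}(f)$. The identity of $[Is-s+s]$ is the sum over $i$ of the cap $[Is-s+s]\to[Is]$ with $c_i$ in its inner region followed by the cup $[Is]\to[Is-s+s]$ with $d_i$ in its inner region. Two parallel strands that cross twice can be separated (easy Reidemeister II). The two hard Reidemeister II relations are $$[It-t+s]\to[It+s-t]\to[It-t+s]\;=\;\mu^I_{Ist}\ \text{ in the region } I,\qquad \mu^I_{Ist}=\prod_{\alpha\in\Phi^+_{Ist}\setminus(\Phi^+_{Is}\cup\Phi^+_{It})}\alpha,$$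 $$[Is+t-s]\to[Is-s+t]\xrightarrow{\,g\,}[Is-s+t]\to[Is+t-s]\;=\;\sum_i c_i\otimes\partial^I_{It}(g\,d_i)\quad(g\in R^I),$$ where $\sum_i c_i\otimes d_i=\Delta^{Is}_{Ist}$, the first tensor factor is placed in the region $Is$ and the second in the region $It$. The easy Reidemeister III relation holds for three strands facing up. In the hard Reidemeister III relation, the triangle with inner region $Istu$ equals the triangle with inner region $I$ containing the polynomial $\mu^I_{Istu}$, the product of the roots in $\Phi^+_{Istu}\setminus(\Phi^+_{Ist}\cup\Phi^+_{Isu}\cup\Phi^+_{Itu})$. \textbf{Switchback relations.} Let $L\subset S$ be finitary and $u_0,\dots,u_d\in L$ with $d\ge1$ and $u_i\ne u_{i+1}$ for $0\le i<d$; put $I=L\setminus u_0$ and $J=L\setminus u_d$. Suppose that $$K_\bullet=[I+u_0-u_d]\ \leftrightharpoons\ L_\bullet=[I-u_1+u_0-u_2+u_1\cdots-u_d+u_{d-1}]$$ is a switchback relation, i.e. both $(I,J)$-expressions are reduced expressions for the same double coset in $W_I\backslash W/W_J$ (the one containing $w_L$). The elementary rex move $K_\bullet\to L_\bullet$ is the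 diagram in which the strands $+u_0$ and $-u_d$ run from bottom to top, the remaining letters $-u_i,+u_i$ ($0<i<d$) of $L_\bullet$ are paired by counterclockwise cups, and consecutive strands $u_{i-1},u_i$ cross once, in a right-facing crossing. The elementary rex move $L_\bullet\to K_\bullet$ is the upside-down flip, with left-facing crossings and counterclockwise caps. \begin{theorem}\label{thm:braidpiisone} For every switchback relation $K_\bullet\leftrightharpoons L_\bullet$, the composition $K_\bullet\to L_\bullet\to K_\bullet$ of the two elementary rex moves is the identity 2-morphism of $K_\bullet$ in $\mathbf{Frob}$. Consequently the graded $(R^I,R^J)$-bimodule $\operatorname{BS}(K_\bullet)=R^I\otimes_{R^L}R^J\,(\ell(L)-\ell(J))$ is a direct summand, by bimodule maps of degree zero, of the singular Bott--Samelson bimodule $\operatorname{BS}(L_\bullet)$. Here $\operatorname{BS}$ of an expression is the tensor product over the intermediate rings of the bimodules ${}_{R^M}(R^M)_{R^{Ms}}$ for its steps $[M,Ms]$ and ${}_{R^{Ms}}(R^M)_{R^M}(\ell(Ms)-\ell(M))$ for its steps $[Ms,M]$. \end{theorem} -/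

import Mathlib

open CategoryTheory

noncomputable section

namespace SingularSoergel

universe uB uW uk uV

/-! ## Parabolic subgroups of a Coxeter system -/

section Parabolic

variable {B : Type uB} {W : Type uW} [Group W] {M : CoxeterMatrix B} (cs : CoxeterSystem M W)

/-- The standard parabolic subgroup `W_I`. -/
def parabolic (I : Set B) : Subgroup W := Subgroup.closure (cs.simple '' I)

/-- `I` is finitary when `W_I` is finite. -/
def Finitary (I : Set B) : Prop := Finite (parabolic cs I)

/-- The longest element `w_I` of `W_I` (only meaningful when `I` is finitary). -/
def longest (I : Set B) : W :=
  Classical.epsilon fun w => w ∈ parabolic cs I ∧ ∀ x ∈ parabolic cs I, cs.length x ≤ cs.length w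

/-- `ℓ(I)`, the length of the longest element of `W_I`. -/
def parLength (I : Set B) : ℕ := cs.length (longest cs I)

end Parabolic

/-! ## Realizations -/

/-- The two-coloured quantum number `[n]_x`, with
`[0] = 0`, `[1] = 1`, `[2]_x = x` and `[n+2]_x = [2]_x [n+1]_y - [n]_x`. -/
def quantumNumber {k : Type*} [CommRing k] : ℕ → k → k → k
  | 0, _, _ => 0
  | 1, _, _ => 1
  | n + 2, x, y => x * quantumNumber (n + 1) y x - quantumNumber n x y

/-- A realization of `(W,S)` over the field `k`, written on the space `V` containing the roots
(so the coroots lie in the dual of `V`). -/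
structure Realization {B : Type uB} {W : Type uW} [Group W] {M : CoxeterMatrix B}
    (cs : CoxeterSystem M W) (k : Type uk) [Field k] (V : Type uV) [AddCommGroup V]
    [Module k V] where
  root : B → V
  coroot : B → Module.Dual k V
  pairing_self : ∀ s, coroot s (root s) = 2
  /-- the reflections `v ↦ v - ⟨α_s^∨, v⟩ α_s` define a representation of `W` -/
  rep : W →* (V →ₗ[k] V)
  rep_simple : ∀ s v, rep (cs.simple s) v = v - coroot s v • root s
  quantum_eq_zero : ∀ s t, s ≠ t → M.M s t ≠ 0 →
    quantumNumber (M.M s t) (-coroot s (root t)) (-coroot t (root s)) = 0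

namespace Realization

variable {B : Type uB} {W : Type uW} [Group W] {M : CoxeterMatrix B} {cs : CoxeterSystem M W}
  {k : Type uk} [Field k] {V : Type uV} [AddCommGroup V] [Module k V]
  (ρ : Realization cs k V)

def IsFaithful : Prop := Function.Injective ρ.rep

/-- `[m_{st} - 1]_x = [m_{st} - 1]_y = 1` whenever `m_{st} < ∞` (the pair `(t,s)` gives the second
equation). -/
def IsBalanced : Prop := ∀ s t, s ≠ t → M.M s t ≠ 0 →
  quantumNumber (M.M s t - 1) (-ρ.coroot s (ρ.root t)) (-ρ.coroot t (ρ.root s)) = 1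

/-- Faithful, and the elements whose fixed space is a hyperplane are exactly the reflections. -/
def IsReflectionFaithful : Prop := ρ.IsFaithful ∧ ∀ w : W,
  Module.finrank k (LinearMap.ker (ρ.rep w - LinearMap.id)) + 1 = Module.finrank k V ↔
    cs.IsReflection w

/-- The polynomial ring `R = Sym(V)`. -/
abbrev Poly (_ρ : Realization cs k V) : Type (max uk uV) := SymmetricAlgebra k V

/-- The action of `w ∈ W` on `R`. -/
def act (w : W) : ρ.Poly →ₐ[k] ρ.Poly :=
  SymmetricAlgebra.lift (SymmetricAlgebra.ι k V ∘ₗ ρ.rep w)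

/-- The homogeneous part of `R` of degree `m`, where `V` sits in degree `2`. -/
def degreePart (m : ℤ) : Submodule k ρ.Poly :=
  ⨆ n : {n : ℕ // 2 * (n : ℤ) = m}, (LinearMap.range (SymmetricAlgebra.ι k V)) ^ (n : ℕ)

/-- The ring `R^I` of `W_I`-invariants. -/
def inv (I : Set B) : Subalgebra k ρ.Poly where
  carrier := {f | ∀ w ∈ parabolic cs I, ρ.act w f = f}
  mul_mem' := fun ha hb w hw => by rw [map_mul, ha w hw, hb w hw]
  add_mem' := fun ha hb w hw => by rw [map_add, ha w hw, hb w hw]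
  algebraMap_mem' := fun r w _ => (ρ.act w).commutes r

theorem inv_anti {I J : Set B} (h : I ⊆ J) : ρ.inv J ≤ ρ.inv I :=
  fun _ hf w hw => hf w (Subgroup.closure_mono (Set.image_mono h) hw)

open Classical in
/-- The simple Demazure operator `∂_s f = (f - s f) / α_s`. -/
def demazureSimple (s : B) (f : ρ.Poly) : ρ.Poly :=
  if h : ∃ g : ρ.Poly, f - ρ.act (cs.simple s) f = SymmetricAlgebra.ι k V (ρ.root s) * g
  then h.choose else 0

/-- The Demazure operator `∂_w = ∂_{s_1} ∘ ⋯ ∘ ∂_{s_l}`, for a reduced expression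
`w = s_1 ⋯ s_l`. -/
def demazure (w : W) (f : ρ.Poly) : ρ.Poly :=
  (cs.exists_isReduced w).choose.foldr (fun s g => ρ.demazureSimple s g) f

/-- The trace map `∂^I_J = ∂_{w_J w_I⁻¹}`, for `I ⊆ J`. -/
def trace (I J : Set B) (f : ρ.Poly) : ρ.Poly :=
  ρ.demazure (longest cs J * (longest cs I)⁻¹) f

/-- Generalized Demazure surjectivity: `∂_{w_I} : R → R^I` is surjective for `I` finitary. -/
def GenDemazureSurjective : Prop := ∀ I : Set B, Finitary cs I →
  ∀ f ∈ ρ.inv I, ∃ g : ρ.Poly, ρ.demazure (longest cs I) g = f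

/-- The standing assumptions on the realization. -/
structure IsAdmissible : Prop where
  faithful : ρ.IsFaithful
  balanced : ρ.IsBalanced
  demazureSurjective : ρ.GenDemazureSurjective
  reflectionFaithful : ρ.IsReflectionFaithful

/-- `Φ⁺_I`: the positive roots `w(α_s)` with `w ∈ W_I`, `s ∈ I` and `ws > w`. -/
def posRoots (I : Set B) : Set V :=
  {α | ∃ w ∈ parabolic cs I, ∃ s ∈ I, cs.length w < cs.length (w * cs.simple s) ∧
    α = ρ.rep w (ρ.root s)}

/-- The product in `R` of a (finite) set of vectors. -/
def vecProd (A : Set V) : ρ.Poly := ∏ᶠ α ∈ A, SymmetricAlgebra.ι k V α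

/-- `μ^I_{Ist}`, the product of the positive roots of `Ist` that are roots of neither `Is`
nor `It`. -/
def mu₂ (I : Set B) (s t : B) : ρ.Poly :=
  ρ.vecProd (ρ.posRoots (insert s (insert t I)) \
    (ρ.posRoots (insert s I) ∪ ρ.posRoots (insert t I)))

/-- `μ^I_{Istu}`, the product of the positive roots of `Istu` that are roots of none of
`Ist`, `Isu`, `Itu`. -/
def mu₃ (I : Set B) (s t u : B) : ρ.Poly :=
  ρ.vecProd (ρ.posRoots (insert s (insert t (insert u I))) \
    (ρ.posRoots (insert s (insert t I)) ∪ ρ.posRoots (insert s (insert u I)) ∪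
      ρ.posRoots (insert t (insert u I))))

/-- `c` is a basis of `R^I` as a module over the subring `R^J`. -/
def IsBasisOver (I J : Set B) {n : ℕ} (c : Fin n → ρ.inv I) : Prop :=
  ∀ f : ρ.inv I, ∃! a : Fin n → ρ.inv J, (f : ρ.Poly) = ∑ i, (a i : ρ.Poly) * (c i : ρ.Poly)

/-- `c`, `d` are dual bases of the Frobenius extension `R^J ⊆ R^I` (with `I ⊆ J`) with respect to
the trace `∂^I_J`; the coproduct element is then `Δ^I_J = ∑ c_i ⊗ d_i`. -/
def IsDualBases (I J : Set B) {n : ℕ} (c d : Fin n → ρ.inv I) : Prop :=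
  ρ.IsBasisOver I J c ∧ ρ.IsBasisOver I J d ∧
    ∀ i j, ρ.trace I J ((c i : ρ.Poly) * (d j : ρ.Poly)) = if i = j then 1 else 0

end Realization

/-! ## Singlestep expressions -/

/-- A step of a singlestep expression: `up s` is `+s`, `dn s` is `-s`. -/
inductive Letter (B : Type uB) : Type uB
  | up (s : B) : Letter B
  | dn (s : B) : Letter B

abbrev Word (B : Type uB) : Type uB := List (Letter B)

section Expressions

variable {B : Type uB} {W : Type uW} [Group W] {M : CoxeterMatrix B} (cs : CoxeterSystem M W)

/-- The finitary subset reached from `I` by one step. -/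
def stepRegion (I : Set B) : Letter B → Set B
  | .up s => insert s I
  | .dn s => I \ {s}

/-- The region to the right of all the strands in the word, when the leftmost region is `I`. -/
def region (I : Set B) (w : Word B) : Set B := w.foldl stepRegion I

/-- `[I ± s_1 ± s_2 ⋯]` is a singlestep expression: each `+s` adds a new element, each `-s`
removes a present one, and all the subsets are finitary. -/
def IsExpr : Set B → Word B → Prop
  | I, [] => Finitary cs I
  | I, .up s :: w => Finitary cs I ∧ s ∉ I ∧ IsExpr (insert s I) w
  | I, .dn s :: w => Finitary cs I ∧ s ∈ I ∧ IsExpr (I \ {s}) w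

/-- Singlestep `(I,J)`-expressions. -/
structure Expr (I J : Set B) where
  word : Word B
  isExpr : IsExpr cs I word
  region_eq : region I word = J

/-- The element `w_{K_1} w_{I_1}⁻¹ w_{K_2} w_{I_2}⁻¹ ⋯ w_{K_m}` attached to an expression with
associated multistep expression `[[⋯ K_1 ⊃ I_1 ⊂ K_2 ⊃ ⋯ ⊂ K_m ⋯]]`, computed with one factor
`w_J⁻¹ w_{Js}` for each step from `J` up to `Js`. -/
def wordElt (I : Set B) : Word B → W
  | [] => 1
  | .up s :: w => (longest cs I)⁻¹ * longest cs (insert s I) * wordElt (insert s I) w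
  | .dn s :: w => wordElt (I \ {s}) w

/-- The length increments `∑ ℓ(Js) - ℓ(J)` over the steps up. -/
def wordLength (I : Set B) : Word B → ℤ
  | [] => 0
  | .up s :: w => (parLength cs (insert s I) - parLength cs I) + wordLength (insert s I) w
  | .dn s :: w => wordLength (I \ {s}) w

variable {cs}

def Expr.elt {I J : Set B} (e : Expr cs I J) : W := longest cs I * wordElt cs I e.word

/-- The expression is reduced: the lengths add up in the product defining `e.elt`, that is,
`ℓ(w_{K_1} w_{I_1}⁻¹ ⋯ w_{K_m}) = ℓ(K_1) - ℓ(I_1) + ⋯ + ℓ(K_m)`. -/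
def Expr.IsReduced {I J : Set B} (e : Expr cs I J) : Prop :=
  (cs.length e.elt : ℤ) = parLength cs I + wordLength cs I e.word

/-- The double coset in `W_I \ W / W_J` expressed by `e`. -/
def Expr.coset {I J : Set B} (e : Expr cs I J) : Set W :=
  DoubleCoset.doubleCoset e.elt (parabolic cs I : Set W) (parabolic cs J : Set W)

/-- `e ⇌ e'`: both are reduced expressions of the same double coset. -/
def BraidRelated {I J : Set B} (e e' : Expr cs I J) : Prop :=
  e.IsReduced ∧ e'.IsReduced ∧ e.coset = e'.coset

theorem region_append (I : Set B) (a b : Word B) :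
    region I (a ++ b) = region (region I a) b := by
  simp [region, List.foldl_append]

theorem region_nil (I : Set B) : region I [] = I := rfl

theorem region_cons (I : Set B) (l : Letter B) (w : Word B) :
    region I (l :: w) = region (stepRegion I l) w := rfl

theorem Finitary.mono {I J : Set B} (hJ : Finitary cs J) (h : I ⊆ J) : Finitary cs I := by
  have hle : parabolic cs I ≤ parabolic cs J := Subgroup.closure_mono (Set.image_mono h)
  have : Finite (parabolic cs J) := hJ
  exact Finite.of_injective (Subgroup.inclusion hle) (Subgroup.inclusion_injective hle)

theorem insert_diff_self_eq {I : Set B} {s : B} (h : s ∉ I) : insert s I \ {s} = I := by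
  ext x; by_cases hx : x = s <;> simp [hx, h]

end Expressions

/-! ## The diagrammatic 2-category -/

section Diagrams

variable {B : Type uB} {W : Type uW} [Group W] {M : CoxeterMatrix B} {cs : CoxeterSystem M W}
  {k : Type uk} [Field k] {V : Type uV} [AddCommGroup V] [Module k V]

open Letter

/-- The generating 2-morphisms, `Gen ρ J x y` being those from the word `x` to the word `y`
whose leftmost region is `J`: the oriented caps and cups, the up-facing crossing and the
polynomials. -/
inductive Gen (ρ : Realization cs k V) : Set B → Word B → Word B → Type (max uB uk uV)
  /-- clockwise cap `m : [I + s - s] → [I]` -/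
  | cwCap {I : Set B} {s : B} (hs : s ∉ I) (hf : Finitary cs (insert s I)) :
      Gen ρ I [up s, dn s] []
  /-- clockwise cup `Δ : [I] → [I + s - s]` -/
  | cwCup {I : Set B} {s : B} (hs : s ∉ I) (hf : Finitary cs (insert s I)) :
      Gen ρ I [] [up s, dn s]
  /-- counterclockwise cap `∂ : [Is - s + s] → [Is]` -/
  | ccwCap {I : Set B} {s : B} (hs : s ∉ I) (hf : Finitary cs (insert s I)) :
      Gen ρ (insert s I) [dn s, up s] []
  /-- counterclockwise cup `ι : [Is] → [Is - s + s]` -/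
  | ccwCup {I : Set B} {s : B} (hs : s ∉ I) (hf : Finitary cs (insert s I)) :
      Gen ρ (insert s I) [] [dn s, up s]
  /-- up-facing crossing `[I + t + s] → [I + s + t]` -/
  | cross {I : Set B} {s t : B} (hs : s ∉ I) (ht : t ∉ I) (hst : s ≠ t)
      (hf : Finitary cs (insert s (insert t I))) : Gen ρ I [up t, up s] [up s, up t]
  /-- a polynomial in the region `I` -/
  | poly {I : Set B} (hf : Finitary cs I) (f : ρ.inv I) : Gen ρ I [] []

/-- Formal linear combinations of diagrams with leftmost region `I₀`, bottom boundary the word `w`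
and top boundary the word `w'`. A `layer` is a generator placed between vertical strands
`a` (to its left) and `b` (to its right), and `comp φ ψ` is the vertical composition with `φ` at
the bottom. -/
inductive Term (ρ : Realization cs k V) (I₀ : Set B) : Word B → Word B → Type (max uB uk uV)
  | id (w : Word B) : Term ρ I₀ w w
  | layer {w w' : Word B} (a b : Word B) {J : Set B} {x y : Word B} (g : Gen ρ J x y)
      (hJ : region I₀ a = J) (hw : w = a ++ x ++ b) (hw' : w' = a ++ y ++ b) : Term ρ I₀ w w'
  | comp {w w' w'' : Word B} (φ : Term ρ I₀ w w') (ψ : Term ρ I₀ w' w'') : Term ρ I₀ w w''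
  | zero (w w' : Word B) : Term ρ I₀ w w'
  | add {w w' : Word B} (φ ψ : Term ρ I₀ w w') : Term ρ I₀ w w'
  | smul {w w' : Word B} (r : k) (φ : Term ρ I₀ w w') : Term ρ I₀ w w'

namespace Term

variable {ρ : Realization cs k V} {I₀ : Set B}

/-- The formal sum of a finite family. -/
def sum {w w' : Word B} {n : ℕ} (φ : Fin n → Term ρ I₀ w w') : Term ρ I₀ w w' :=
  (List.ofFn φ).foldr add (zero w w')

/-- The polynomial `f` in the region `I` of the word `w = a ++ b` between `a` and `b`. -/
def box (a b : Word B) {w : Word B} {I : Set B} (hf : Finitary cs I) (f : ρ.inv I)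
    (ha : region I₀ a = I) (hw : w = a ++ b) : Term ρ I₀ w w :=
  layer a b (.poly hf f) ha (by simp [hw]) (by simp [hw])

/-- The left-facing crossing `[Is - s + t] → [Is + t - s]`: create a clockwise cup on `s` to the
right, use the up-facing crossing, and close up with a counterclockwise cap on the left. -/
def leftCross (a b : Word B) {w w' : Word B} {I : Set B} {s t : B} (hs : s ∉ I) (ht : t ∉ I)
    (hst : s ≠ t) (hf : Finitary cs (insert s (insert t I)))
    (ha : region I₀ a = insert s I) (hw : w = a ++ [dn s, up t] ++ b)
    (hw' : w' = a ++ [up t, dn s] ++ b) : Term ρ I₀ w w' :=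
  comp
    (layer (w' := a ++ [dn s, up t, up s, dn s] ++ b) (a ++ [dn s, up t]) b
      (.cwCup (I := insert t I) (s := s) (by simp [hs, hst]) hf)
      (by simp [region_append, ha, region_cons, region_nil, stepRegion, insert_diff_self_eq hs])
      (by simp [hw]) (by simp))
  (comp
    (layer (w' := a ++ [dn s, up s, up t, dn s] ++ b) (a ++ [dn s]) ([dn s] ++ b)
      (.cross hs ht hst hf)
      (by simp [region_append, ha, region_cons, region_nil, stepRegion, insert_diff_self_eq hs])
      (by simp) (by simp))
    (layer a ([up t, dn s] ++ b)
      (.ccwCap hs (hf.mono (Set.insert_subset_insert (Set.subset_insert t I))))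
      ha (by simp) (by simp [hw'])))

/-- The right-facing crossing `[Is + t - s] → [Is - s + t]`: create a counterclockwise cup on `s`
to the left, use the up-facing crossing, and close up with a clockwise cap on the right. -/
def rightCross (a b : Word B) {w w' : Word B} {I : Set B} {s t : B} (hs : s ∉ I) (ht : t ∉ I)
    (hst : s ≠ t) (hf : Finitary cs (insert s (insert t I)))
    (ha : region I₀ a = insert s I) (hw : w = a ++ [up t, dn s] ++ b)
    (hw' : w' = a ++ [dn s, up t] ++ b) : Term ρ I₀ w w' :=
  comp
    (layer (w' := a ++ [dn s, up s, up t, dn s] ++ b) a ([up t, dn s] ++ b)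
      (.ccwCup hs (hf.mono (Set.insert_subset_insert (Set.subset_insert t I))))
      ha (by simp [hw]) (by simp))
  (comp
    (layer (w' := a ++ [dn s, up t, up s, dn s] ++ b) (a ++ [dn s]) ([dn s] ++ b)
      (.cross ht hs hst.symm (by rwa [Set.insert_comm]))
      (by simp [region_append, ha, region_cons, region_nil, stepRegion, insert_diff_self_eq hs])
      (by simp) (by simp))
    (layer (a ++ [dn s, up t]) b
      (.cwCap (I := insert t I) (s := s) (by simp [hs, hst]) hf)
      (by simp [region_append, ha, region_cons, region_nil, stepRegion, insert_diff_self_eq hs])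
      (by simp) (by simp [hw'])))

end Term

open Term in
/-- The relations between 2-morphisms: the smallest congruence containing the relations listed
below, each in an arbitrary horizontal context. (The boundary equations `h₁ h₂ …` demanded by
the layers are left implicit; any two proofs of such an equation agree.) -/
inductive Rel (ρ : Realization cs k V) (I₀ : Set B) :
    ∀ {w w' : Word B}, Term ρ I₀ w w' → Term ρ I₀ w w' → Prop
  -- congruence
  | refl {w w'} (φ : Term ρ I₀ w w') : Rel ρ I₀ φ φ
  | symm {w w'} {φ ψ : Term ρ I₀ w w'} : Rel ρ I₀ φ ψ → Rel ρ I₀ ψ φ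
  | trans {w w'} {φ ψ χ : Term ρ I₀ w w'} : Rel ρ I₀ φ ψ → Rel ρ I₀ ψ χ → Rel ρ I₀ φ χ
  | comp_congr {w w' w''} {φ φ' : Term ρ I₀ w w'} {ψ ψ' : Term ρ I₀ w' w''} :
      Rel ρ I₀ φ φ' → Rel ρ I₀ ψ ψ' → Rel ρ I₀ (comp φ ψ) (comp φ' ψ')
  | add_congr {w w'} {φ φ' ψ ψ' : Term ρ I₀ w w'} :
      Rel ρ I₀ φ φ' → Rel ρ I₀ ψ ψ' → Rel ρ I₀ (add φ ψ) (add φ' ψ')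
  | smul_congr {w w'} (r : k) {φ φ' : Term ρ I₀ w w'} :
      Rel ρ I₀ φ φ' → Rel ρ I₀ (smul r φ) (smul r φ')
  -- vertical composition is associative and unital
  | id_comp {w w'} (φ : Term ρ I₀ w w') : Rel ρ I₀ (comp (id w) φ) φ
  | comp_id {w w'} (φ : Term ρ I₀ w w') : Rel ρ I₀ (comp φ (id w')) φ
  | comp_assoc {w₁ w₂ w₃ w₄} (φ : Term ρ I₀ w₁ w₂) (ψ : Term ρ I₀ w₂ w₃) (χ : Term ρ I₀ w₃ w₄) :
      Rel ρ I₀ (comp (comp φ ψ) χ) (comp φ (comp ψ χ))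
  -- the 2-morphisms between two given words form a vector space over the ground field
  | add_assoc {w w'} (φ ψ χ : Term ρ I₀ w w') :
      Rel ρ I₀ (add (add φ ψ) χ) (add φ (add ψ χ))
  | add_comm {w w'} (φ ψ : Term ρ I₀ w w') : Rel ρ I₀ (add φ ψ) (add ψ φ)
  | zero_add {w w'} (φ : Term ρ I₀ w w') : Rel ρ I₀ (add (zero w w') φ) φ
  | zero_smul {w w'} (φ : Term ρ I₀ w w') : Rel ρ I₀ (smul 0 φ) (zero w w')
  | one_smul {w w'} (φ : Term ρ I₀ w w') : Rel ρ I₀ (smul 1 φ) φ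
  | mul_smul {w w'} (r r' : k) (φ : Term ρ I₀ w w') :
      Rel ρ I₀ (smul (r * r') φ) (smul r (smul r' φ))
  | add_smul {w w'} (r r' : k) (φ : Term ρ I₀ w w') :
      Rel ρ I₀ (smul (r + r') φ) (add (smul r φ) (smul r' φ))
  | smul_add {w w'} (r : k) (φ ψ : Term ρ I₀ w w') :
      Rel ρ I₀ (smul r (add φ ψ)) (add (smul r φ) (smul r ψ))
  -- vertical composition is bilinear
  | add_comp {w w' w''} (φ φ' : Term ρ I₀ w w') (ψ : Term ρ I₀ w' w'') :
      Rel ρ I₀ (comp (add φ φ') ψ) (add (comp φ ψ) (comp φ' ψ))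
  | comp_add {w w' w''} (φ : Term ρ I₀ w w') (ψ ψ' : Term ρ I₀ w' w'') :
      Rel ρ I₀ (comp φ (add ψ ψ')) (add (comp φ ψ) (comp φ ψ'))
  | smul_comp {w w' w''} (r : k) (φ : Term ρ I₀ w w') (ψ : Term ρ I₀ w' w'') :
      Rel ρ I₀ (comp (smul r φ) ψ) (smul r (comp φ ψ))
  | comp_smul {w w' w''} (r : k) (φ : Term ρ I₀ w w') (ψ : Term ρ I₀ w' w'') :
      Rel ρ I₀ (comp φ (smul r ψ)) (smul r (comp φ ψ))
  -- interchange law: generators side by side may be slid past each other vertically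
  | interchange (a m b : Word B) {J K x x' y y'} (g : Gen ρ J x x') (g' : Gen ρ K y y')
      {w w₁ w₂ w'} {h₁ h₂ h₃ h₄ h₅ h₆ h₇ h₈ h₉ h₁₀ h₁₁ h₁₂} :
      Rel ρ I₀ (w := w) (w' := w')
        (comp (w' := w₁) (layer a (m ++ y ++ b) g h₁ h₂ h₃) (layer (a ++ x' ++ m) b g' h₄ h₅ h₆))
        (comp (w' := w₂) (layer (a ++ x ++ m) b g' h₇ h₈ h₉)
          (layer a (m ++ y' ++ b) g h₁₀ h₁₁ h₁₂))
  -- biadjunction: the four zigzags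
  | zigzag_up_left (a b : Word B) {I : Set B} {s : B} (hs : s ∉ I)
      (hf : Finitary cs (insert s I)) {w w₁} {h₁ h₂ h₃ h₄ h₅ h₆} :
      Rel ρ I₀ (w := w) (w' := w)
        (comp (w' := w₁) (layer (a ++ [up s]) b (.ccwCup hs hf) h₁ h₂ h₃)
          (layer a ([up s] ++ b) (.cwCap hs hf) h₄ h₅ h₆))
        (id w)
  | zigzag_dn_right (a b : Word B) {I : Set B} {s : B} (hs : s ∉ I)
      (hf : Finitary cs (insert s I)) {w w₁} {h₁ h₂ h₃ h₄ h₅ h₆} :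
      Rel ρ I₀ (w := w) (w' := w)
        (comp (w' := w₁) (layer a ([dn s] ++ b) (.ccwCup hs hf) h₁ h₂ h₃)
          (layer (a ++ [dn s]) b (.cwCap hs hf) h₄ h₅ h₆))
        (id w)
  | zigzag_up_right (a b : Word B) {I : Set B} {s : B} (hs : s ∉ I)
      (hf : Finitary cs (insert s I)) {w w₁} {h₁ h₂ h₃ h₄ h₅ h₆} :
      Rel ρ I₀ (w := w) (w' := w)
        (comp (w' := w₁) (layer a ([up s] ++ b) (.cwCup hs hf) h₁ h₂ h₃)
          (layer (a ++ [up s]) b (.ccwCap hs hf) h₄ h₅ h₆))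
        (id w)
  | zigzag_dn_left (a b : Word B) {I : Set B} {s : B} (hs : s ∉ I)
      (hf : Finitary cs (insert s I)) {w w₁} {h₁ h₂ h₃ h₄ h₅ h₆} :
      Rel ρ I₀ (w := w) (w' := w)
        (comp (w' := w₁) (layer (a ++ [dn s]) b (.cwCup hs hf) h₁ h₂ h₃)
          (layer a ([dn s] ++ b) (.ccwCap hs hf) h₄ h₅ h₆))
        (id w)
  -- cyclicity of the crossing: its two rotations by 180 degrees, which go
  -- from `[Ist - t - s]` to `[Ist - s - t]`, agree
  | cross_cyclic (a b : Word B) {I : Set B} {s t : B} (hs : s ∉ I) (ht : t ∉ I) (hst : s ≠ t)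
      (hst' : s ∉ insert t I) (hts' : t ∉ insert s I)
      (hf : Finitary cs (insert s (insert t I))) (hf' : Finitary cs (insert t (insert s I)))
      (hfs : Finitary cs (insert s I)) (hft : Finitary cs (insert t I))
      {w w₁ w₂ w₃ w₄ v₁ v₂ v₃ v₄ w'}
      {h₁ h₂ h₃ h₄ h₅ h₆ h₇ h₈ h₉ h₁₀ h₁₁ h₁₂ h₁₃ h₁₄ h₁₅}
      {j₁ j₂ j₃ j₄ j₅ j₆ j₇ j₈ j₉ j₁₀ j₁₁ j₁₂ j₁₃ j₁₄ j₁₅} :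
      Rel ρ I₀ (w := w) (w' := w')
        (comp (w' := w₁) (layer a ([dn t, dn s] ++ b) (.ccwCup hst' hf) h₁ h₂ h₃)
        (comp (w' := w₂) (layer (a ++ [dn s]) ([up s, dn t, dn s] ++ b) (.ccwCup ht hft) h₄ h₅ h₆)
        (comp (w' := w₃) (layer (a ++ [dn s, dn t]) ([dn t, dn s] ++ b)
          (.cross hs ht hst hf) h₇ h₈ h₉)
        (comp (w' := w₄) (layer (a ++ [dn s, dn t, up s]) ([dn s] ++ b)
          (.cwCap hts' hf') h₁₀ h₁₁ h₁₂)
          (layer (a ++ [dn s, dn t]) b (.cwCap hs hfs) h₁₃ h₁₄ h₁₅)))))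
        (comp (w' := v₁) (layer (a ++ [dn t, dn s]) b (.cwCup ht hft) j₁ j₂ j₃)
        (comp (w' := v₂) (layer (a ++ [dn t, dn s, up t]) ([dn t] ++ b)
          (.cwCup hst' hf) j₄ j₅ j₆)
        (comp (w' := v₃) (layer (a ++ [dn t, dn s]) ([dn s, dn t] ++ b)
          (.cross hs ht hst hf) j₇ j₈ j₉)
        (comp (w' := v₄) (layer (a ++ [dn t]) ([up t, dn s, dn t] ++ b)
          (.ccwCap hs hfs) j₁₀ j₁₁ j₁₂)
          (layer a ([dn s, dn t] ++ b) (.ccwCap hts' hf') j₁₃ j₁₄ j₁₅)))))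
  -- polynomials add and multiply as expected, and scalars act as scalars
  | poly_add (a b : Word B) {I : Set B} (hf : Finitary cs I) (f g : ρ.inv I) {w} {ha hw} :
      Rel ρ I₀ (w := w) (w' := w) (box a b hf (f + g) ha hw)
        (add (box a b hf f ha hw) (box a b hf g ha hw))
  | poly_mul (a b : Word B) {I : Set B} (hf : Finitary cs I) (f g : ρ.inv I) {w} {ha hw} :
      Rel ρ I₀ (w := w) (w' := w) (box a b hf (f * g) ha hw)
        (comp (box a b hf f ha hw) (box a b hf g ha hw))
  | poly_scalar (a b : Word B) {I : Set B} (hf : Finitary cs I) (r : k) {w} {ha hw} :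
      Rel ρ I₀ (w := w) (w' := w) (box a b hf (algebraMap k (ρ.inv I) r) ha hw)
        (smul r (id w))
  -- polynomial sliding across an up strand, for `f ∈ R^{Is} ⊆ R^I`
  | poly_slide (a b : Word B) {I : Set B} {s : B} (hs : s ∉ I) (hI : Finitary cs I)
      (hf : Finitary cs (insert s I)) (f : ρ.inv I) (f' : ρ.inv (insert s I))
      (hff' : (f : ρ.Poly) = f') {w} {h₁ h₂ h₃ h₄} :
      Rel ρ I₀ (w := w) (w' := w) (box a ([up s] ++ b) hI f h₁ h₂)
        (box (a ++ [up s]) b hf f' h₃ h₄)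
  -- clockwise circle: evaluates to `μ^I_{Is} = ∑ c_i d_i`
  | cw_circle (a b : Word B) {I : Set B} {s : B} (hs : s ∉ I) (hI : Finitary cs I)
      (hf : Finitary cs (insert s I)) {n : ℕ} (c d : Fin n → ρ.inv I)
      (hcd : ρ.IsDualBases I (insert s I) c d)
      {w w₁} {h₁ h₂ h₃ h₄ h₅ h₆ h₇ h₈} :
      Rel ρ I₀ (w := w) (w' := w)
        (comp (w' := w₁) (layer a b (.cwCup hs hf) h₁ h₂ h₃) (layer a b (.cwCap hs hf) h₄ h₅ h₆))
        (box a b hI (∑ i, c i * d i) h₇ h₈)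
  -- counterclockwise circle around `f ∈ R^I`: evaluates to `∂^I_{Is}(f) ∈ R^{Is}`
  | ccw_circle (a b : Word B) {I : Set B} {s : B} (hs : s ∉ I) (hI : Finitary cs I)
      (hf : Finitary cs (insert s I)) (f : ρ.inv I) (f' : ρ.inv (insert s I))
      (hff' : (f' : ρ.Poly) = ρ.trace I (insert s I) f)
      {w w₁} {h₁ h₂ h₃ h₄ h₅ h₆ h₇ h₈ h₉ h₁₀} :
      Rel ρ I₀ (w := w) (w' := w)
        (comp (w' := w₁) (layer a b (.ccwCup hs hf) h₁ h₂ h₃)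
        (comp (box (a ++ [dn s]) ([up s] ++ b) hI f h₄ h₅)
          (layer a b (.ccwCap hs hf) h₆ h₇ h₈)))
        (box a b hf f' h₉ h₁₀)
  -- idempotent decomposition of the identity of `[Is - s + s]`
  | idempotent_decomp (a b : Word B) {I : Set B} {s : B} (hs : s ∉ I) (hI : Finitary cs I)
      (hf : Finitary cs (insert s I)) {n : ℕ} (c d : Fin n → ρ.inv I)
      (hcd : ρ.IsDualBases I (insert s I) c d)
      {w w₁} {h₁ h₂ h₃ h₄ h₅ h₆ h₇ h₈ h₉ h₁₀} :
      Rel ρ I₀ (w := w) (w' := w) (id w)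
        (sum fun i =>
          comp (box (a ++ [dn s]) ([up s] ++ b) hI (c i) h₁ h₂)
          (comp (w' := w₁) (layer a b (.ccwCap hs hf) h₃ h₄ h₅)
          (comp (layer a b (.ccwCup hs hf) h₆ h₇ h₈)
            (box (a ++ [dn s]) ([up s] ++ b) hI (d i) h₉ h₁₀))))
  -- easy Reidemeister II
  | R2_easy (a b : Word B) {I : Set B} {s t : B} (hs : s ∉ I) (ht : t ∉ I) (hst : s ≠ t)
      (hf : Finitary cs (insert s (insert t I))) (hf' : Finitary cs (insert t (insert s I)))
      {w w₁} {h₁ h₂ h₃ h₄ h₅ h₆} :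
      Rel ρ I₀ (w := w) (w' := w)
        (comp (w' := w₁) (layer a b (.cross hs ht hst hf) h₁ h₂ h₃)
          (layer a b (.cross ht hs hst.symm hf') h₄ h₅ h₆))
        (id w)
  -- hard Reidemeister II on `[It - t + s]`: evaluates to `μ^I_{Ist}` in the middle region `I`
  | R2_hard_mu (a b : Word B) {I : Set B} {s t : B} (hs : s ∉ I) (ht : t ∉ I) (hst : t ≠ s)
      (hI : Finitary cs I) (hf : Finitary cs (insert t (insert s I)))
      (f : ρ.inv I) (hμ : (f : ρ.Poly) = ρ.mu₂ I s t)
      {w w₁} {h₁ h₂ h₃ h₄ h₅ h₆ h₇ h₈} :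
      Rel ρ I₀ (w := w) (w' := w)
        (comp (w' := w₁) (leftCross a b ht hs hst hf h₁ h₂ h₃)
          (rightCross a b ht hs hst hf h₄ h₅ h₆))
        (box (a ++ [dn t]) ([up s] ++ b) hI f h₇ h₈)
  -- hard Reidemeister II on `[Is + t - s]` with `g ∈ R^I` in the middle: evaluates to
  -- `∑ c_i ⊗ ∂^I_{It}(g d_i)` in the regions `Is` (left) and `It` (right), where
  -- `∑ c_i ⊗ d_i` is the coproduct element of `R^{Ist} ⊆ R^{Is}`
  | R2_hard_coproduct (a b : Word B) {I : Set B} {s t : B} (hs : s ∉ I) (ht : t ∉ I)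
      (hst : s ≠ t) (hI : Finitary cs I) (hfs : Finitary cs (insert s I))
      (hft : Finitary cs (insert t I)) (hf : Finitary cs (insert s (insert t I)))
      (g : ρ.inv I) {n : ℕ} (c d : Fin n → ρ.inv (insert s I))
      (hcd : ρ.IsDualBases (insert s I) (insert s (insert t I)) c d)
      (e : Fin n → ρ.inv (insert t I))
      (he : ∀ i, (e i : ρ.Poly) = ρ.trace I (insert t I) ((g : ρ.Poly) * (d i : ρ.Poly)))
      {w w₁} {h₁ h₂ h₃ h₄ h₅ h₆ h₇ h₈ h₉ h₁₀ h₁₁ h₁₂} :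
      Rel ρ I₀ (w := w) (w' := w)
        (comp (w' := w₁) (rightCross a b hs ht hst hf h₁ h₂ h₃)
        (comp (box (a ++ [dn s]) ([up t] ++ b) hI g h₄ h₅)
          (leftCross a b hs ht hst hf h₆ h₇ h₈)))
        (sum fun i => comp (box a ([up t, dn s] ++ b) hfs (c i) h₉ h₁₀)
          (box (a ++ [up t, dn s]) b hft (e i) h₁₁ h₁₂))
  -- easy Reidemeister III, from `[I + s + t + u]` to `[I + u + t + s]`
  | R3_easy (a b : Word B) {I : Set B} {s t u : B} (hs : s ∉ I) (ht : t ∉ I) (hu : u ∉ I)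
      (hst : s ≠ t) (hsu : s ≠ u) (htu : t ≠ u)
      (hs₁ : s ∉ insert t I) (hu₁ : u ∉ insert t I) (ht₂ : t ∉ insert s I) (hu₂ : u ∉ insert s I)
      (hs₃ : s ∉ insert u I) (ht₃ : t ∉ insert u I)
      (f₁ : Finitary cs (insert t (insert s I))) (f₂ : Finitary cs (insert u (insert s I)))
      (f₃ : Finitary cs (insert u (insert t I)))
      (f₄ : Finitary cs (insert u (insert s (insert t I))))
      (f₅ : Finitary cs (insert u (insert t (insert s I))))
      (f₆ : Finitary cs (insert t (insert s (insert u I))))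
      {w w₁ w₂ v₁ v₂ w'} {h₁ h₂ h₃ h₄ h₅ h₆ h₇ h₈ h₉ j₁ j₂ j₃ j₄ j₅ j₆ j₇ j₈ j₉} :
      Rel ρ I₀ (w := w) (w' := w')
        (comp (w' := w₁) (layer a ([up u] ++ b) (.cross ht hs hst.symm f₁) h₁ h₂ h₃)
        (comp (w' := w₂) (layer (a ++ [up t]) b (.cross hu₁ hs₁ hsu.symm f₄) h₄ h₅ h₆)
          (layer a ([up s] ++ b) (.cross hu ht htu.symm f₃) h₇ h₈ h₉)))
        (comp (w' := v₁) (layer (a ++ [up s]) b (.cross hu₂ ht₂ htu.symm f₅) j₁ j₂ j₃)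
        (comp (w' := v₂) (layer a ([up t] ++ b) (.cross hu hs hsu.symm f₂) j₄ j₅ j₆)
          (layer (a ++ [up u]) b (.cross ht₃ hs₃ hst.symm f₆) j₇ j₈ j₉)))
  -- hard Reidemeister III, from `[Is + t - s + u]` to `[Is + u - s + t]`: the triangle with inner
  -- region `Istu` equals the triangle with inner region `I` and `μ^I_{Istu}` inside it
  | R3_hard (a b : Word B) {I : Set B} {s t u : B} (hs : s ∉ I) (ht : t ∉ I) (hu : u ∉ I)
      (hst : s ≠ t) (hsu : s ≠ u) (htu : t ≠ u) (hs₁ : s ∉ insert t I) (hu₁ : u ∉ insert t I)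
      (ht₂ : t ∉ insert s I) (hu₂ : u ∉ insert s I) (hs₃ : s ∉ insert u I) (ht₃ : t ∉ insert u I)
      (hI : Finitary cs I)
      (f₁ : Finitary cs (insert s (insert t I))) (f₂ : Finitary cs (insert s (insert u I)))
      (f₃ : Finitary cs (insert u (insert t I)))
      (f₄ : Finitary cs (insert s (insert u (insert t I))))
      (f₅ : Finitary cs (insert u (insert t (insert s I))))
      (f₆ : Finitary cs (insert s (insert t (insert u I))))
      (f : ρ.inv I) (hμ : (f : ρ.Poly) = ρ.mu₃ I s t u)
      {w w₁ w₂ v₁ v₂ w'} {h₁ h₂ h₃ h₄ h₅ h₆ h₇ h₈ h₉ j₁ j₂ j₃ j₄ j₅ j₆ j₇ j₈ j₉ j₁₀ j₁₁} :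
      Rel ρ I₀ (w := w) (w' := w')
        (comp (w' := w₁) (leftCross (a ++ [up t]) b hs₁ hu₁ hsu f₄ h₁ h₂ h₃)
        (comp (w' := w₂) (layer a ([dn s] ++ b) (.cross hu₂ ht₂ htu.symm f₅) h₄ h₅ h₆)
          (rightCross (a ++ [up u]) b hs₃ ht₃ hst f₆ h₇ h₈ h₉)))
        (comp (w' := v₁) (rightCross a ([up u] ++ b) hs ht hst f₁ j₁ j₂ j₃)
        (comp (box (a ++ [dn s]) ([up t, up u] ++ b) hI f j₄ j₅)
        (comp (w' := v₂) (layer (a ++ [dn s]) b (.cross hu ht htu.symm f₃) j₆ j₇ j₈)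
          (leftCross a ([up t] ++ b) hs hu hsu f₂ j₉ j₁₀ j₁₁))))

/-- The setoid on formal linear combinations of diagrams generated by the relations. -/
def termSetoid (ρ : Realization cs k V) (I₀ : Set B) (w w' : Word B) :
    Setoid (Term ρ I₀ w w') where
  r := Rel ρ I₀
  iseqv := ⟨Rel.refl, Rel.symm, Rel.trans⟩

/-- The space of 2-morphisms from `w` to `w'`, all with leftmost region `I₀`. -/
def TwoHom (ρ : Realization cs k V) (I₀ : Set B) (w w' : Word B) : Type (max uB uk uV) :=
  Quotient (termSetoid ρ I₀ w w')

namespace TwoHom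

variable {ρ : Realization cs k V} {I₀ : Set B}

/-- The 2-morphism represented by a formal combination of diagrams. -/
def mk {w w' : Word B} (φ : Term ρ I₀ w w') : TwoHom ρ I₀ w w' :=
  Quotient.mk (termSetoid ρ I₀ w w') φ

theorem sound {w w' : Word B} {φ ψ : Term ρ I₀ w w'} (h : Rel ρ I₀ φ ψ) : mk φ = mk ψ :=
  Quotient.sound (s := termSetoid ρ I₀ w w') h

/-- Vertical composition, `φ` at the bottom. -/
def comp {w w' w'' : Word B} (φ : TwoHom ρ I₀ w w') (ψ : TwoHom ρ I₀ w' w'') :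
    TwoHom ρ I₀ w w'' :=
  Quotient.map₂ (sa := termSetoid ρ I₀ w w') (sb := termSetoid ρ I₀ w' w'')
    (sc := termSetoid ρ I₀ w w'') Term.comp (fun _ _ h _ _ h' => Rel.comp_congr h h') φ ψ

instance {w w' : Word B} : Add (TwoHom ρ I₀ w w') :=
  ⟨Quotient.map₂ (sa := termSetoid ρ I₀ w w') (sb := termSetoid ρ I₀ w w')
    (sc := termSetoid ρ I₀ w w') Term.add (fun _ _ h _ _ h' => Rel.add_congr h h')⟩

instance {w w' : Word B} : Zero (TwoHom ρ I₀ w w') := ⟨mk (.zero w w')⟩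

instance {w w' : Word B} : SMul k (TwoHom ρ I₀ w w') :=
  ⟨fun r => Quotient.map (sa := termSetoid ρ I₀ w w') (sb := termSetoid ρ I₀ w w')
    (Term.smul r) (fun _ _ h => Rel.smul_congr _ h)⟩

instance {w w' : Word B} : Neg (TwoHom ρ I₀ w w') := ⟨fun φ => (-1 : k) • φ⟩

instance {w w' : Word B} : AddCommGroup (TwoHom ρ I₀ w w') where
  add_assoc := by rintro ⟨φ⟩ ⟨ψ⟩ ⟨χ⟩; exact sound (Rel.add_assoc φ ψ χ)
  zero_add := by rintro ⟨φ⟩; exact sound (Rel.zero_add φ)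
  add_zero := by rintro ⟨φ⟩; exact sound ((Rel.add_comm _ _).trans (Rel.zero_add φ))
  add_comm := by rintro ⟨φ⟩ ⟨ψ⟩; exact sound (Rel.add_comm φ ψ)
  neg_add_cancel := by
    rintro ⟨φ⟩
    refine sound (((Rel.add_congr (Rel.refl _) (Rel.one_smul φ).symm).trans
      (Rel.add_smul (-1) 1 φ).symm).trans ?_)
    rw [neg_add_cancel]; exact Rel.zero_smul φ
  nsmul := nsmulRec
  zsmul := zsmulRec

instance {w w' : Word B} : Module k (TwoHom ρ I₀ w w') where
  one_smul := by rintro ⟨φ⟩; exact sound (Rel.one_smul φ)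
  mul_smul := by rintro r r' ⟨φ⟩; exact sound (Rel.mul_smul r r' φ)
  smul_add := by rintro r ⟨φ⟩ ⟨ψ⟩; exact sound (Rel.smul_add r φ ψ)
  add_smul := by rintro r r' ⟨φ⟩; exact sound (Rel.add_smul r r' φ)
  zero_smul := by rintro ⟨φ⟩; exact sound (Rel.zero_smul φ)
  smul_zero := by
    intro r
    refine sound ((Rel.smul_congr r (Rel.zero_smul (.zero w w')).symm).trans ?_)
    refine (Rel.mul_smul r 0 _).symm.trans ?_
    rw [mul_zero]; exact Rel.zero_smul _

end TwoHom

/-- The category `Frob(I,J)` of 1-morphisms (singlestep `(I,J)`-expressions) and 2-morphisms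
of the diagrammatic 2-category. -/
structure Frob (ρ : Realization cs k V) (I J : Set B) where
  expr : Expr cs I J

instance (ρ : Realization cs k V) (I J : Set B) : Category (Frob ρ I J) where
  Hom X Y := TwoHom ρ I X.expr.word Y.expr.word
  id X := TwoHom.mk (.id X.expr.word)
  comp φ ψ := TwoHom.comp φ ψ
  id_comp := by rintro X Y ⟨φ⟩; exact TwoHom.sound (Rel.id_comp φ)
  comp_id := by rintro X Y ⟨φ⟩; exact TwoHom.sound (Rel.comp_id φ)
  assoc := by
    rintro X Y Z T ⟨φ⟩ ⟨ψ⟩ ⟨χ⟩; exact TwoHom.sound (Rel.comp_assoc φ ψ χ)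

instance (ρ : Realization cs k V) (I J : Set B) : Preadditive (Frob ρ I J) where
  homGroup X Y := inferInstanceAs (AddCommGroup (TwoHom ρ I X.expr.word Y.expr.word))
  add_comp := by rintro X Y Z ⟨φ⟩ ⟨φ'⟩ ⟨ψ⟩; exact TwoHom.sound (Rel.add_comp φ φ' ψ)
  comp_add := by rintro X Y Z ⟨φ⟩ ⟨ψ⟩ ⟨ψ'⟩; exact TwoHom.sound (Rel.comp_add φ ψ ψ')

instance (ρ : Realization cs k V) (I J : Set B) : Linear k (Frob ρ I J) where
  homModule X Y := inferInstanceAs (Module k (TwoHom ρ I X.expr.word Y.expr.word))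
  smul_comp := by rintro X Y Z r ⟨φ⟩ ⟨ψ⟩; exact TwoHom.sound (Rel.smul_comp r φ ψ)
  comp_smul := by rintro X Y Z ⟨φ⟩ r ⟨ψ⟩; exact TwoHom.sound (Rel.comp_smul r φ ψ)

end Diagrams

/-! ## Switchback relations and their rex moves -/

section Switchback

variable {B : Type uB} {W : Type uW} [Group W] {M : CoxeterMatrix B} {cs : CoxeterSystem M W}

open Letter

/-- The word `- u_1 + u_0 - u_2 + u_1 ⋯ - u_n + u_{n-1}`. -/
def longWord (u : ℕ → B) : ℕ → Word B
  | 0 => []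
  | n + 1 => longWord u n ++ [dn (u (n + 1)), up (u n)]

/-- Consecutively distinct elements `u_0, …, u_d` of a finitary subset `L`, with `d ≥ 1`. The
values of `u` beyond `d` play no role. -/
structure IsAdmissibleSeq (cs : CoxeterSystem M W) (L : Set B) (d : ℕ) (u : ℕ → B) : Prop where
  finitary : Finitary cs L
  pos : 1 ≤ d
  mem : ∀ i ≤ d, u i ∈ L
  ne_succ : ∀ i < d, u i ≠ u (i + 1)

theorem isExpr_append {I : Set B} {a b : Word B} (ha : IsExpr cs I a)
    (hb : IsExpr cs (region I a) b) : IsExpr cs I (a ++ b) := by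
  induction a generalizing I with
  | nil => exact hb
  | cons l a ih =>
    cases l with
    | up s => exact ⟨ha.1, ha.2.1, ih ha.2.2 hb⟩
    | dn s => exact ⟨ha.1, ha.2.1, ih ha.2.2 hb⟩

namespace IsAdmissibleSeq

variable {L : Set B} {d : ℕ} {u : ℕ → B}

theorem insert_diff (h : IsAdmissibleSeq cs L d u) {i : ℕ} (hi : i ≤ d) :
    insert (u i) (L \ {u i}) = L := by
  have := h.mem i hi
  ext x; by_cases hx : x = u i <;> simp [hx, this]

theorem insert_pair_left (h : IsAdmissibleSeq cs L d u) {i : ℕ} (hi : i < d) :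
    insert (u i) ((L \ {u i}) \ {u (i + 1)}) = L \ {u (i + 1)} := by
  have h₁ := h.mem i hi.le
  have h₂ := h.ne_succ i hi
  ext x; by_cases hx : x = u i <;> simp [hx, h₁, h₂]

theorem insert_pair_right (h : IsAdmissibleSeq cs L d u) {i : ℕ} (hi : i < d) :
    insert (u (i + 1)) ((L \ {u i}) \ {u (i + 1)}) = L \ {u i} := by
  have h₁ := h.mem (i + 1) hi
  have h₂ := (h.ne_succ i hi).symm
  ext x; by_cases hx : x = u (i + 1) <;> simp [hx, h₁, h₂]

theorem region_longWord (h : IsAdmissibleSeq cs L d u) {i : ℕ} (hi : i ≤ d) :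
    region (L \ {u 0}) (longWord u i) = L \ {u i} := by
  induction i with
  | zero => rfl
  | succ i ih =>
    rw [longWord, region_append, ih (by omega)]
    exact h.insert_pair_left (by omega)

theorem isExpr_longWord (h : IsAdmissibleSeq cs L d u) {i : ℕ} (hi : i ≤ d) :
    IsExpr cs (L \ {u 0}) (longWord u i) := by
  induction i with
  | zero => exact h.finitary.mono Set.sdiff_subset
  | succ i ih =>
    refine isExpr_append (ih (by omega)) ?_
    rw [h.region_longWord (by omega)]
    refine ⟨h.finitary.mono Set.sdiff_subset,
      ⟨h.mem (i + 1) hi, by simpa using (h.ne_succ i (by omega)).symm⟩,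
      h.finitary.mono (Set.sdiff_subset.trans Set.sdiff_subset), by simp, ?_⟩
    exact h.finitary.mono (by
      rw [h.insert_pair_left (by omega)]; exact Set.sdiff_subset)

/-- The expression `[I + u_0 - u_d]`, where `I = L \ u_0`. -/
def shortExpr (h : IsAdmissibleSeq cs L d u) : Expr cs (L \ {u 0}) (L \ {u d}) where
  word := [up (u 0), dn (u d)]
  isExpr := ⟨h.finitary.mono Set.sdiff_subset, by simp,
    by rw [h.insert_diff (Nat.zero_le d)]; exact h.finitary,
    by rw [h.insert_diff (Nat.zero_le d)]; exact h.mem d le_rfl,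
    h.finitary.mono (by rw [h.insert_diff (Nat.zero_le d)]; exact Set.sdiff_subset)⟩
  region_eq := by
    rw [region_cons, region_cons, region_nil, stepRegion, stepRegion, h.insert_diff (Nat.zero_le d)]

/-- The expression `[I - u_1 + u_0 - u_2 + u_1 ⋯ - u_d + u_{d-1}]`, where `I = L \ u_0`. -/
def longExpr (h : IsAdmissibleSeq cs L d u) : Expr cs (L \ {u 0}) (L \ {u d}) where
  word := longWord u d
  isExpr := h.isExpr_longWord le_rfl
  region_eq := h.region_longWord le_rfl

variable {k : Type uk} [Field k] {V : Type uV} [AddCommGroup V] [Module k V]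

/-- The right-facing crossing `+ u_n - u_{n+1} ↦ - u_{n+1} + u_n` of the strands following
`longWord u n`. -/
def crossRight (h : IsAdmissibleSeq cs L d u) (ρ : Realization cs k V) {n : ℕ} (hn : n < d)
    (b : Word B) {w w' : Word B} (hw : w = longWord u n ++ [up (u n), dn (u (n + 1))] ++ b)
    (hw' : w' = longWord u n ++ [dn (u (n + 1)), up (u n)] ++ b) : Term ρ (L \ {u 0}) w w' :=
  Term.rightCross (longWord u n) b (I := (L \ {u n}) \ {u (n + 1)}) (by simp) (by simp)
    (h.ne_succ n hn).symm
    (by rw [h.insert_pair_left hn, h.insert_diff hn]; exact h.finitary)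
    (by rw [h.insert_pair_right hn, h.region_longWord hn.le]) hw hw'

/-- The left-facing crossing `- u_{n+1} + u_n ↦ + u_n - u_{n+1}` of the strands following
`longWord u n`. -/
def crossLeft (h : IsAdmissibleSeq cs L d u) (ρ : Realization cs k V) {n : ℕ} (hn : n < d)
    (b : Word B) {w w' : Word B} (hw : w = longWord u n ++ [dn (u (n + 1)), up (u n)] ++ b)
    (hw' : w' = longWord u n ++ [up (u n), dn (u (n + 1))] ++ b) : Term ρ (L \ {u 0}) w w' :=
  Term.leftCross (longWord u n) b (I := (L \ {u n}) \ {u (n + 1)}) (by simp) (by simp)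
    (h.ne_succ n hn).symm
    (by rw [h.insert_pair_left hn, h.insert_diff hn]; exact h.finitary)
    (by rw [h.insert_pair_right hn, h.region_longWord hn.le]) hw hw'

/-- The counterclockwise cup creating `- u_{n+1} + u_{n+1}` in the region `L` to the right of
the strands `longWord u n` and `+ u_n`. -/
def cup (h : IsAdmissibleSeq cs L d u) (ρ : Realization cs k V) {n : ℕ} (hn : n < d)
    (b : Word B) {w w' : Word B} (hw : w = longWord u n ++ [up (u n)] ++ b)
    (hw' : w' = longWord u n ++ [up (u n), dn (u (n + 1)), up (u (n + 1))] ++ b) :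
    Term ρ (L \ {u 0}) w w' :=
  Term.layer (longWord u n ++ [up (u n)]) b
    (Gen.ccwCup (I := L \ {u (n + 1)}) (s := u (n + 1)) (by simp)
      (by rw [h.insert_diff hn]; exact h.finitary))
    (by rw [h.insert_diff hn, region_append, h.region_longWord hn.le]
        exact h.insert_diff hn.le)
    (by simp [hw]) (by simp [hw'])

/-- The counterclockwise cap joining `- u_{n+1} + u_{n+1}` in the region `L` to the right of
the strands `longWord u n` and `+ u_n`. -/
def cap (h : IsAdmissibleSeq cs L d u) (ρ : Realization cs k V) {n : ℕ} (hn : n < d)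
    (b : Word B) {w w' : Word B}
    (hw : w = longWord u n ++ [up (u n), dn (u (n + 1)), up (u (n + 1))] ++ b)
    (hw' : w' = longWord u n ++ [up (u n)] ++ b) : Term ρ (L \ {u 0}) w w' :=
  Term.layer (longWord u n ++ [up (u n)]) b
    (Gen.ccwCap (I := L \ {u (n + 1)}) (s := u (n + 1)) (by simp)
      (by rw [h.insert_diff hn]; exact h.finitary))
    (by rw [h.insert_diff hn, region_append, h.region_longWord hn.le]
        exact h.insert_diff hn.le)
    (by simp [hw]) (by simp [hw'])

/-- The diagram from `+ u_0` to `- u_1 + u_0 ⋯ - u_n + u_{n-1} + u_n` (followed by vertical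
strands `b`) built from one counterclockwise cup coloured `u_i` and one right-facing crossing of
`u_{i-1}` with `u_i`, for each `i = 1, …, n`. -/
def expand (h : IsAdmissibleSeq cs L d u) (ρ : Realization cs k V) (b : Word B) :
    (n : ℕ) → n ≤ d → Term ρ (L \ {u 0}) ([up (u 0)] ++ b) (longWord u n ++ [up (u n)] ++ b)
  | 0, _ => .id _
  | n + 1, hn => .comp (expand h ρ b n (Nat.le_of_succ_le hn))
      (.comp (h.cup ρ hn b rfl rfl)
        (h.crossRight ρ hn ([up (u (n + 1))] ++ b) (by simp) (by simp [longWord])))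

/-- The upside-down flip of `expand`: left-facing crossings and counterclockwise caps. -/
def contract (h : IsAdmissibleSeq cs L d u) (ρ : Realization cs k V) (b : Word B) :
    (n : ℕ) → n ≤ d → Term ρ (L \ {u 0}) (longWord u n ++ [up (u n)] ++ b) ([up (u 0)] ++ b)
  | 0, _ => .id _
  | n + 1, hn => .comp
      (.comp (h.crossLeft ρ hn ([up (u (n + 1))] ++ b) (by simp [longWord]) (by simp))
        (h.cap ρ hn b rfl rfl))
      (contract h ρ b n (Nat.le_of_succ_le hn))

/-- The elementary rex move `[I + u_0 - u_d] → [I - u_1 + u_0 ⋯ - u_d + u_{d-1}]`: the strands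
`u_1, …, u_{d-1}` are created by cups and moved into place, and then `+ u_{d-1}` and `- u_d` cross.
In the resulting diagram `+ u_0` and `- u_d` run from bottom to top, the other strands of the target
are paired up by counterclockwise cups, and the strands `i - 1` and `i` cross once. -/
def rexTerm (ρ : Realization cs k V) : {d : ℕ} → (h : IsAdmissibleSeq cs L d u) →
    Term ρ (L \ {u 0}) [up (u 0), dn (u d)] (longWord u d)
  | 0, h => absurd h.pos (by simp)
  | n + 1, h => .comp (h.expand ρ [dn (u (n + 1))] n n.le_succ)
      (h.crossRight ρ n.lt_succ_self [] (by simp) (by simp [longWord]))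

/-- The elementary rex move back, `[I - u_1 + u_0 ⋯ - u_d + u_{d-1}] → [I + u_0 - u_d]`. -/
def rexBackTerm (ρ : Realization cs k V) : {d : ℕ} → (h : IsAdmissibleSeq cs L d u) →
    Term ρ (L \ {u 0}) (longWord u d) [up (u 0), dn (u d)]
  | 0, h => absurd h.pos (by simp)
  | n + 1, h => .comp
      (h.crossLeft ρ n.lt_succ_self [] (by simp [longWord]) (by simp))
      (h.contract ρ [dn (u (n + 1))] n n.le_succ)

/-- `[I + u_0 - u_d]` as an object of the hom category `Frob(I, J)`. -/
def shortObj (h : IsAdmissibleSeq cs L d u) (ρ : Realization cs k V) :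
    Frob ρ (L \ {u 0}) (L \ {u d}) := ⟨h.shortExpr⟩

/-- `[I - u_1 + u_0 ⋯ - u_d + u_{d-1}]` as an object of the hom category `Frob(I, J)`. -/
def longObj (h : IsAdmissibleSeq cs L d u) (ρ : Realization cs k V) :
    Frob ρ (L \ {u 0}) (L \ {u d}) := ⟨h.longExpr⟩

/-- The elementary rex move from left to right, as a 2-morphism. -/
def rexMove (h : IsAdmissibleSeq cs L d u) (ρ : Realization cs k V) :
    h.shortObj ρ ⟶ h.longObj ρ := TwoHom.mk (rexTerm ρ h)

/-- The elementary rex move from right to left, as a 2-morphism. -/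
def rexMoveBack (h : IsAdmissibleSeq cs L d u) (ρ : Realization cs k V) :
    h.longObj ρ ⟶ h.shortObj ρ := TwoHom.mk (rexBackTerm ρ h)

end IsAdmissibleSeq

/-- The switchback relation
`[I + u_0 - u_d] ⇌ [I - u_1 + u_0 - u_2 + u_1 ⋯ - u_d + u_{d-1}]` with `I = L \ u_0`: both sides are
reduced expressions of the same double coset. -/
structure IsSwitchback (cs : CoxeterSystem M W) (L : Set B) (d : ℕ) (u : ℕ → B) : Prop where
  seq : IsAdmissibleSeq cs L d u
  braidRelated : BraidRelated seq.shortExpr seq.longExpr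

end Switchback

/-! ## Singular Bott--Samelson bimodules -/

section BottSamelson

variable {B : Type uB} {W : Type uW} [Group W] {M : CoxeterMatrix B} {cs : CoxeterSystem M W}
  {k : Type uk} [Field k] {V : Type uV} [AddCommGroup V] [Module k V]

open scoped TensorProduct

/-- A graded `(R^I, R^J)`-bimodule whose underlying group is a commutative ring, on which `R^I` and
`R^J` act through ring homomorphisms. All singular Bott--Samelson bimodules are of this kind. -/
structure GradedBimodule (ρ : Realization cs k V) (I J : Set B) where
  carrier : Type (max uk uV)
  [commRing : CommRing carrier]
  left : ρ.inv I →+* carrier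
  right : ρ.inv J →+* carrier
  degreePart : ℤ → AddSubgroup carrier

attribute [instance] GradedBimodule.commRing

namespace GradedBimodule

variable {ρ : Realization cs k V} {I J K : Set B}

/-- Homomorphisms of graded bimodules, of degree zero. -/
structure Hom (P Q : GradedBimodule ρ I J) where
  toFun : P.carrier →+ Q.carrier
  map_left : ∀ (f : ρ.inv I) (x : P.carrier), toFun (P.left f * x) = Q.left f * toFun x
  map_right : ∀ (x : P.carrier) (f : ρ.inv J), toFun (x * P.right f) = toFun x * Q.right f
  map_degree : ∀ (n : ℤ), ∀ x ∈ P.degreePart n, toFun x ∈ Q.degreePart n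

/-- `P` is a direct summand of `Q` as a graded bimodule: there are an inclusion and a projection, both
of degree zero, whose composition is the identity of `P`. -/
def IsDirectSummand (P Q : GradedBimodule ρ I J) : Prop :=
  ∃ (i : Hom P Q) (p : Hom Q P), ∀ x, p.toFun (i.toFun x) = x

/-- The identity bimodule `R^I`. -/
def unit (ρ : Realization cs k V) (I : Set B) : GradedBimodule ρ I I where
  carrier := ρ.inv I
  left := RingHom.id _
  right := RingHom.id _
  degreePart n := (ρ.degreePart n).toAddSubgroup.comap (ρ.inv I).val.toRingHom.toAddMonoidHom

/-- Restriction of the right action to `R^K ⊆ R^J`. -/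
def restrictRight (P : GradedBimodule ρ I J) (h : J ⊆ K) : GradedBimodule ρ I K where
  carrier := P.carrier
  left := P.left
  right := P.right.comp (Subalgebra.inclusion (ρ.inv_anti h)).toRingHom
  degreePart := P.degreePart

/-- The tensor product `P ⊗_{R^J} R^K (σ)` for `K ⊆ J`, with the grading shifted by `σ`. -/
def induceRight (P : GradedBimodule ρ I J) (h : K ⊆ J) (σ : ℤ) : GradedBimodule ρ I K :=
  letI : Algebra (ρ.inv J) P.carrier := P.right.toAlgebra
  letI : Algebra (ρ.inv J) (ρ.inv K) := (Subalgebra.inclusion (ρ.inv_anti h)).toRingHom.toAlgebra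
  { carrier := P.carrier ⊗[ρ.inv J] ρ.inv K
    left := Algebra.TensorProduct.includeLeftRingHom.comp P.left
    right := (Algebra.TensorProduct.includeRight
      (R := ρ.inv J) (A := P.carrier) (B := ρ.inv K)).toRingHom
    degreePart := fun n => AddSubgroup.closure
      {z | ∃ (a b : ℤ) (x : P.carrier) (f : ρ.inv K), a + b = n + σ ∧ x ∈ P.degreePart a ∧
        (f : ρ.Poly) ∈ ρ.degreePart b ∧ z = x ⊗ₜ[ρ.inv J] f} }

/-- Tensor `P` on the right with the Bott--Samelson bimodule of an expression: the bimodule `R^J` over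
`(R^J, R^{Js})` for a step up, and `R^{J \ s}(ℓ(J) - ℓ(J \ s))` over `(R^J, R^{J \ s})` for a step
down. -/
def extend {J : Set B} (P : GradedBimodule ρ I J) :
    (w : Word B) → GradedBimodule ρ I (region J w)
  | [] => P
  | .up s :: w => extend (P.restrictRight (Set.subset_insert s J)) w
  | .dn s :: w => extend (P.induceRight (K := J \ {s}) Set.sdiff_subset
      ((parLength cs J : ℤ) - parLength cs (J \ {s}))) w

/-- The Bott--Samelson bimodule `BS(I_•)` of a singlestep expression. -/
def bottSamelson (ρ : Realization cs k V) (e : Expr cs I J) : GradedBimodule ρ I J :=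
  ((unit ρ I).extend e.word).restrictRight e.region_eq.subset

end GradedBimodule

end BottSamelson

end SingularSoergel

end

/-! Write `I = L \ u_0` and `J = L \ u_d`. The composite of the two rex moves is evaluated from the
top crossing inwards. The crossing of `u_{d-1}` with `u_d` followed by its flip is a hard
Reidemeister II configuration: it opens into `∑ c_i ⊗ ∂(c'_i)`, where `c`, `c'` are dual bases of
`R^{L \ u_{d-1}}` over `R^L`, with `c_i` to the left of both strands and the trace of `c'_i` in
`R^J` to their right. The right factor moves freely out of the diagram.

The left factor is surrounded by nested bubbles, each made of a cup, two crossings and a cap. A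
bubble with `g` inside evaluates to the trace of `g` from `R^{L \ {u_n, u_{n+1}}}` to `R^{L \ u_n}`
(`cup_cross_box_cross_cap`), because the hard Reidemeister II relation produces a coproduct, one
factor of which the remaining circle contracts. Peeling off all bubbles turns `c_i` into an iterated
trace (`expand_box_contract`), so the composite is multiplication by `∑ iterTrace(c_i) ⊗ ∂(c'_i)` in
the outer regions.

It remains to see that this element acts as `1 ⊗ 1`. Polynomials in `R^L` slide across both strands,
so it suffices to contract the right factor against every `f` in `R^J` by the trace to `R^L`. Since
traces are transitive, the result is one longer iterated trace of `f`. This is where the switchback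
hypothesis enters: the long expression expresses `w_L` and its lengths add up, so the iterated trace
is a composite of Demazure operators whose lengths add up to that of `w_L w_J⁻¹`, hence is the trace
of `R^L ⊆ R^J` itself (`IsSwitchback.iterTrace_eq`). This is also the contraction of `1 ⊗ 1`, and
dual bases of `R^J` over `R^L` conclude.

The statement on bimodules is proved directly in algebra from the same identity. Composing the
traces of the downward steps gives a left-linear map `τ` from `BS(L_•)` to `R^I`, which on the image
of `R^J` is the iterated trace, hence the trace to `R^L`. Then `x ⊗ f ↦ x f` is split by `z ↦ ∑ τ(z
c_j) ⊗ c'_j`, with `c`, `c'` now dual bases of `R^J` over `R^L`.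

The algebra rests on two facts. The operator `∂_w` does not depend on the reduced word, by
Matsumoto's theorem and the braid relations for Demazure operators in a balanced realization; and
the extensions `R^J ⊆ R^I` have homogeneous dual bases, by generalized Demazure surjectivity. -/

noncomputable section
namespace SingularSoergel
universe uB uW uk uV

section Coxeter

variable {B : Type uB} {W : Type uW} [Group W] {M : CoxeterMatrix B} (cs : CoxeterSystem M W)

open CoxeterSystem

/-! ### The exchange condition -/

open Classical in
/-- The action of a simple reflection on pairs (element, sign). -/
def signedConj (i : B) : Function.End (W × ZMod 2) := fun p =>
  (cs.simple i * p.1 * (cs.simple i)⁻¹, p.2 + if p.1 = cs.simple i then 1 else 0)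

-- The letter `i` changes the sign exactly when the conjugate of `t` reached so far is the simple
-- reflection `i`, that is, when `t` is the entry of the right inversion sequence belonging to that
-- letter. Once the braid relations hold for this action, the parity of the count becomes a function
-- of the group element.
open Classical in
theorem prod_signedConj (ω : List B) (p : W × ZMod 2) :
    (ω.map (signedConj cs)).prod p =
      (cs.wordProd ω * p.1 * (cs.wordProd ω)⁻¹, p.2 + (cs.rightInvSeq ω).count p.1) := by
  induction ω with
  | nil => simp; rfl
  | cons i ω ih =>
    have e : (cs.wordProd ω * p.1 * (cs.wordProd ω)⁻¹ = cs.simple i) ↔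
        (cs.wordProd ω)⁻¹ * cs.simple i * cs.wordProd ω = p.1 := by
      constructor
      · intro h; rw [← h]; group
      · intro h; rw [← h]; group
    rw [List.map_cons, List.prod_cons]
    change signedConj cs i ((ω.map (signedConj cs)).prod p) = _
    rw [ih, signedConj, rightInvSeq, List.count_cons, wordProd_cons]
    refine Prod.ext ?_ ?_
    · simp [mul_assoc]
    · simp only [e, beq_iff_eq]
      push_cast
      ring

theorem alternatingWord_two_mul_succ (i j : B) (m : ℕ) :
    alternatingWord i j (2 * (m + 1)) = alternatingWord i j (2 * m) ++ [i, j] := by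
  rw [show 2 * (m + 1) = 2 * m + 1 + 1 by ring, alternatingWord_succ, alternatingWord_succ]
  simp

theorem alternatingWord_two_mul_succ' (i j : B) (m : ℕ) :
    alternatingWord i j (2 * (m + 1)) = [i, j] ++ alternatingWord i j (2 * m) := by
  rw [show 2 * (m + 1) = 2 * m + 1 + 1 by ring, alternatingWord_succ', alternatingWord_succ']
  simp

theorem reverse_alternatingWord_two_mul (i j : B) (m : ℕ) :
    (alternatingWord i j (2 * m)).reverse = alternatingWord j i (2 * m) := by
  induction m with
  | zero => rfl
  | succ m ih =>
    rw [alternatingWord_two_mul_succ, List.reverse_append, ih, alternatingWord_two_mul_succ']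
    rfl

theorem prod_map_alternatingWord_two_mul {G : Type*} [Monoid G] (f : B → G) (i j : B) (m : ℕ) :
    ((alternatingWord i j (2 * m)).map f).prod = (f i * f j) ^ m := by
  induction m with
  | zero => simp [alternatingWord]
  | succ m ih => rw [alternatingWord_two_mul_succ, List.map_append, List.prod_append, ih, pow_succ]; simp

-- The inversion sequence of `(ij)^m` is periodic of period `m`, because `(s_i s_j)^m = 1`; its two
-- halves coincide and every entry is counted twice. Reversing the word gives access to the closed
-- form of the left inversion sequence.
open Classical in
theorem even_count_rightInvSeq_alternatingWord (i j : B) (t : W) :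
    ((((cs.rightInvSeq (alternatingWord i j (2 * M.M i j))).count t : ℕ)) : ZMod 2) = 0 := by
  have h1 : cs.rightInvSeq (alternatingWord i j (2 * M.M i j)) =
      (cs.leftInvSeq (alternatingWord j i (2 * M.M i j))).reverse := by
    rw [← rightInvSeq_reverse, reverse_alternatingWord_two_mul]
  set l := cs.leftInvSeq (alternatingWord j i (2 * M.M i j)) with hl
  have hlen : l.length = 2 * M.M i j := by simp [hl]
  have h2 : l.drop (M.M i j) = l.take (M.M i j) := by
    apply List.ext_getElem
    · simp [hlen]; omega
    · intro n h₁ h₂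
      have h₂' : n < M.M i j := by simp [hlen] at h₂; omega
      rw [List.getElem_drop, List.getElem_take]
      simp only [hl]
      rw [getElem_leftInvSeq_alternatingWord cs j i _ _ (by omega),
        getElem_leftInvSeq_alternatingWord cs j i _ _ (by omega),
        prod_alternatingWord_eq_mul_pow, prod_alternatingWord_eq_mul_pow]
      have e1 : (2 * (M.M i j + n) + 1) / 2 = M.M i j + n := by omega
      have e2 : (2 * n + 1) / 2 = n := by omega
      have e3 : ¬ Even (2 * (M.M i j + n) + 1) := by simp [parity_simps]
      have e4 : ¬ Even (2 * n + 1) := by simp [parity_simps]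
      rw [e1, e2, if_neg e3, if_neg e4, pow_add, simple_mul_simple_pow, one_mul]
  rw [h1, List.count_reverse, ← List.take_append_drop (M.M i j) l, h2, List.count_append]
  push_cast
  exact CharTwo.add_self_eq_zero _

theorem isLiftable_signedConj : M.IsLiftable (signedConj cs) := by
  intro i j
  rw [← prod_map_alternatingWord_two_mul]
  funext p
  rw [prod_signedConj, even_count_rightInvSeq_alternatingWord]
  have : cs.wordProd (alternatingWord i j (2 * M.M i j)) = 1 := by
    have := prod_map_alternatingWord_two_mul cs.simple i j (M.M i j)
    rw [simple_mul_simple_pow] at this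
    exact this
  rw [this]
  simp; rfl

open Classical in
/-- The parity of the number of occurrences of `t` in the inversion sequence of a word depends only
on the product of the word. -/
theorem count_rightInvSeq_congr {ω ω' : List B} (h : cs.wordProd ω = cs.wordProd ω') (t : W) :
    ((cs.rightInvSeq ω).count t : ZMod 2) = (cs.rightInvSeq ω').count t := by
  have key : ∀ ω : List B, (ω.map (signedConj cs)).prod =
      cs.lift ⟨signedConj cs, isLiftable_signedConj cs⟩ (cs.wordProd ω) := by
    intro ω
    induction ω with
    | nil => simp
    | cons i ω ih =>
      rw [List.map_cons, List.prod_cons, ih, wordProd_cons, map_mul, lift_apply_simple]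
  have h1 := prod_signedConj cs ω (t, 0)
  have h2 := prod_signedConj cs ω' (t, 0)
  rw [key, h, ← key, h2] at h1
  simpa using congrArg Prod.snd h1.symm

-- The sign is a cocycle: `ω'` acts first and conjugates `t`, and `ω` then sees the conjugate.
open Classical in
theorem count_rightInvSeq_append (ω ω' : List B) (t : W) :
    ((cs.rightInvSeq (ω ++ ω')).count t : ZMod 2) =
      (cs.rightInvSeq ω').count t +
        (cs.rightInvSeq ω).count (cs.wordProd ω' * t * (cs.wordProd ω')⁻¹) := by
  have h1 := prod_signedConj cs (ω ++ ω') (t, 0)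
  rw [List.map_append, List.prod_append] at h1
  change (ω.map (signedConj cs)).prod ((ω'.map (signedConj cs)).prod (t, 0)) = _ at h1
  rw [prod_signedConj cs ω', prod_signedConj] at h1
  simpa using (congrArg Prod.snd h1).symm

open Classical in
/-- A right inversion occurs in the inversion sequence of every word. -/
theorem mem_rightInvSeq_of_isRightInversion {ω : List B} {t : W}
    (h : cs.IsRightInversion (cs.wordProd ω) t) : t ∈ cs.rightInvSeq ω := by
  obtain ⟨⟨v, i, rfl⟩, hlt⟩ := h
  obtain ⟨ν, -, rfl⟩ := cs.exists_isReduced v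
  set t := cs.wordProd ν * cs.simple i * (cs.wordProd ν)⁻¹ with ht
  set τ : List B := ν ++ ([i] ++ ν.reverse) with hτ
  have hτt : cs.wordProd τ = t := by simp [hτ, ht, wordProd_append, wordProd_cons, mul_assoc]
  have htt : t * t = 1 := by simp [ht, mul_assoc]
  -- In the palindromic word for `t` the middle letter contributes one occurrence; the two outer
  -- halves contribute as in `ν ν⁻¹`, whose product is 1, hence evenly.
  have hodd : ((cs.rightInvSeq τ).count t : ZMod 2) = 1 := by
    have e1 : cs.wordProd ν.reverse * t * (cs.wordProd ν.reverse)⁻¹ = cs.simple i := by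
      simp [ht]; group
    have e2 : cs.wordProd ([i] ++ ν.reverse) * t * (cs.wordProd ([i] ++ ν.reverse))⁻¹ =
        cs.simple i := by
      rw [wordProd_append, mul_inv_rev]
      rw [show cs.wordProd [i] * cs.wordProd ν.reverse * t * ((cs.wordProd ν.reverse)⁻¹ *
        (cs.wordProd [i])⁻¹) = cs.wordProd [i] * (cs.wordProd ν.reverse * t *
          (cs.wordProd ν.reverse)⁻¹) * (cs.wordProd [i])⁻¹ by group, e1]
      simp
    have e3 := count_rightInvSeq_append cs ν ν.reverse t
    have e4 : ((cs.rightInvSeq (ν ++ ν.reverse)).count t : ZMod 2) = 0 := by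
      rw [count_rightInvSeq_congr cs (ω' := []) (by simp [wordProd_append])]
      simp
    rw [hτ, count_rightInvSeq_append, count_rightInvSeq_append, e1, e2]
    rw [e1, e4] at e3
    rw [add_right_comm, ← e3]
    simp
  -- If `t` did not occur for `ω`, it would occur an odd number of times for `ω τ`, hence for a
  -- reduced word of `w t`. Then `t` would be an inversion of `w t`, that is `ℓ(w) < ℓ(w t)`,
  -- against the hypothesis.
  by_contra hn
  have h0 : ((cs.rightInvSeq ω).count t : ZMod 2) = 0 := by
    rw [List.count_eq_zero_of_not_mem hn]; simp
  obtain ⟨σ, hσ, hσt⟩ := cs.exists_isReduced (cs.wordProd ω * t)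
  have h1 : ((cs.rightInvSeq σ).count t : ZMod 2) = 1 := by
    rw [count_rightInvSeq_congr cs (ω' := ω ++ τ) (by rw [← hσt, wordProd_append, hτt]),
      count_rightInvSeq_append, hodd, hτt]
    rw [show t * t * t⁻¹ = t by simp, h0, add_zero]
  have h2 : t ∈ cs.rightInvSeq σ := by
    by_contra h3
    rw [List.count_eq_zero_of_not_mem h3] at h1
    simp at h1
  have h3 := (cs.isRightInversion_of_mem_rightInvSeq hσ h2).2
  rw [← hσt, mul_assoc, htt, mul_one] at h3
  omega

/-- The strong exchange condition. -/
theorem strong_exchange {ω : List B} {t : W} (h : cs.IsRightInversion (cs.wordProd ω) t) :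
    ∃ j < ω.length, cs.wordProd ω * t = cs.wordProd (ω.eraseIdx j) ∧
      t = (cs.rightInvSeq ω).getD j 1 := by
  obtain ⟨j, hj, hjt⟩ := List.mem_iff_getElem.mp (mem_rightInvSeq_of_isRightInversion cs h)
  have e : (cs.rightInvSeq ω).getD j 1 = t := by rw [List.getD_eq_getElem _ _ hj, hjt]
  refine ⟨j, by simpa using hj, ?_, e.symm⟩
  rw [← wordProd_mul_getD_rightInvSeq, e]

theorem exchange_right {ω : List B} {i : B} (h : cs.IsRightDescent (cs.wordProd ω) i) :
    ∃ j < ω.length, cs.wordProd ω * cs.simple i = cs.wordProd (ω.eraseIdx j) := by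
  obtain ⟨j, hj, e, -⟩ :=
    strong_exchange cs ((cs.isRightInversion_simple_iff_isRightDescent _ _).2 h)
  exact ⟨j, hj, e⟩

/-! ### Parabolic subgroups -/

theorem simple_mem_parabolic {I : Set B} {i : B} (hi : i ∈ I) : cs.simple i ∈ parabolic cs I :=
  Subgroup.subset_closure ⟨i, hi, rfl⟩

theorem parabolic_mono {I J : Set B} (h : I ⊆ J) : parabolic cs I ≤ parabolic cs J :=
  Subgroup.closure_mono (Set.image_mono h)

theorem wordProd_mem_parabolic {I : Set B} {ω : List B} (h : ∀ i ∈ ω, i ∈ I) :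
    cs.wordProd ω ∈ parabolic cs I := by
  induction ω with
  | nil => simp [one_mem]
  | cons i ω ih =>
    rw [wordProd_cons]
    exact mul_mem (simple_mem_parabolic cs (h i (by simp))) (ih fun j hj => h j (by simp [hj]))

/-- Multiply by one generator at a time: if the length goes up, append the letter; if it goes down,
the exchange condition deletes a letter. No letter outside `I` ever appears. -/
theorem exists_isReduced_of_mem_parabolic {I : Set B} {w : W} (hw : w ∈ parabolic cs I) :
    ∃ ω : List B, cs.IsReduced ω ∧ w = cs.wordProd ω ∧ ∀ i ∈ ω, i ∈ I := by
  have step : ∀ (i : B) (y : W), i ∈ I →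
      (∃ ω : List B, cs.IsReduced ω ∧ y = cs.wordProd ω ∧ ∀ i ∈ ω, i ∈ I) →
      ∃ ω : List B, cs.IsReduced ω ∧ y * cs.simple i = cs.wordProd ω ∧ ∀ i ∈ ω, i ∈ I := by
    rintro i y hi ⟨ω, hω, rfl, hI⟩
    rcases cs.length_mul_simple (cs.wordProd ω) i with h | h
    · refine ⟨ω.concat i, ?_, by rw [wordProd_concat], by simp; rintro j (hj | rfl); exacts [hI j hj, hi]⟩
      rw [CoxeterSystem.IsReduced, wordProd_concat, h, hω.eq]; simp
    · obtain ⟨j, hj, e⟩ := exchange_right cs (ω := ω) (i := i) (by unfold IsRightDescent; omega)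
      refine ⟨ω.eraseIdx j, ?_, e, fun k hk => hI k (List.mem_of_mem_eraseIdx hk)⟩
      rw [CoxeterSystem.IsReduced, ← e, List.length_eraseIdx_of_lt hj]
      have := hω.eq
      omega
  induction hw using Subgroup.closure_induction_right with
  | one => exact ⟨[], by simp [CoxeterSystem.IsReduced], by simp, by simp⟩
  | mul_right y hy x hx ih => obtain ⟨i, hi, rfl⟩ := hx; exact step i y hi ih
  | mul_inv_cancel y hy x hx ih =>
    obtain ⟨i, hi, rfl⟩ := hx; rw [inv_simple]; exact step i y hi ih

/-- `v` has minimal length in `v W_I`. -/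
def IsMinRep (I : Set B) (v : W) : Prop := ∀ u ∈ parabolic cs I, cs.length v ≤ cs.length (v * u)

variable {cs}

/-- If a letter of `u` lowered the length, the exchange condition would delete a letter either from
`v`, producing a shorter element of `v W_I`, or from `u`, whose word is reduced. -/
theorem IsMinRep.length_mul {I : Set B} {v : W} (hv : IsMinRep cs I v) {u : W}
    (hu : u ∈ parabolic cs I) : cs.length (v * u) = cs.length v + cs.length u := by
  obtain ⟨ω, hω, rfl, hI⟩ := exists_isReduced_of_mem_parabolic cs hu
  clear hu
  induction ω using List.reverseRecOn with
  | nil => simp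
  | append_singleton ω i ih =>
    have hω' : cs.IsReduced ω := by simpa using hω.take ω.length
    have hi : i ∈ I := hI i (by simp)
    have hI' : ∀ j ∈ ω, j ∈ I := fun j hj => hI j (by simp [hj])
    have ih := ih hω' hI'
    have e : cs.wordProd (ω ++ [i]) = cs.wordProd ω * cs.simple i := by
      simp [wordProd_append]
    have hl : cs.length (cs.wordProd ω * cs.simple i) = ω.length + 1 := by
      rw [← e, hω.eq]; simp
    rw [e, hl, ← mul_assoc]
    rcases cs.length_mul_simple (v * cs.wordProd ω) i with h | h
    · rw [h, ih, hω'.eq, add_assoc]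
    exfalso
    obtain ⟨ν, hν, rfl⟩ := cs.exists_isReduced v
    obtain ⟨j, hj, e2⟩ := exchange_right cs (ω := ν ++ ω) (i := i)
      (by unfold IsRightDescent; rw [wordProd_append]; omega)
    rw [wordProd_append] at e2
    by_cases hjν : j < ν.length
    · rw [List.eraseIdx_append_of_lt_length hjν, wordProd_append] at e2
      have e3 : cs.wordProd ν * (cs.wordProd ω * cs.simple i * (cs.wordProd ω)⁻¹) =
          cs.wordProd (ν.eraseIdx j) := by
        rw [← mul_assoc, ← mul_assoc, e2]; simp
      have h1 := hv (cs.wordProd ω * cs.simple i * (cs.wordProd ω)⁻¹)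
        (mul_mem (mul_mem (wordProd_mem_parabolic cs hI') (simple_mem_parabolic cs hi))
          (inv_mem (wordProd_mem_parabolic cs hI')))
      rw [e3, hν.eq] at h1
      have h2 := cs.length_wordProd_le (ν.eraseIdx j)
      rw [List.length_eraseIdx_of_lt hjν] at h2
      omega
    · rw [List.eraseIdx_append_of_length_le (by omega), wordProd_append, mul_assoc] at e2
      have e3 := mul_left_cancel e2
      rw [e3] at hl
      have h2 := cs.length_wordProd_le (ω.eraseIdx (j - ν.length))
      have h3 := List.length_eraseIdx_le ω (j - ν.length)
      omega

variable (cs)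

theorem exists_isMinRep (I : Set B) (w : W) :
    ∃ v, IsMinRep cs I v ∧ ∃ u ∈ parabolic cs I, w = v * u := by
  have hne : {n | ∃ u ∈ parabolic cs I, cs.length (w * u) = n}.Nonempty :=
    ⟨_, 1, one_mem _, rfl⟩
  obtain ⟨u, hu, hn⟩ := Nat.sInf_mem hne
  refine ⟨w * u, fun u' hu' => ?_, u⁻¹, inv_mem hu, by simp⟩
  rw [hn]
  exact Nat.sInf_le ⟨u * u', mul_mem hu hu', by rw [mul_assoc]⟩

/-! ### Longest elements -/

variable {cs}

theorem longest_spec {I : Set B} (h : Finitary cs I) : longest cs I ∈ parabolic cs I ∧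
    ∀ x ∈ parabolic cs I, cs.length x ≤ cs.length (longest cs I) := by
  have : ∃ w, w ∈ parabolic cs I ∧ ∀ x ∈ parabolic cs I, cs.length x ≤ cs.length w := by
    have hf : Finite (parabolic cs I) := h
    obtain ⟨w, hw⟩ := Finite.exists_max fun x : parabolic cs I => cs.length (x : W)
    exact ⟨w, w.2, fun x hx => hw ⟨x, hx⟩⟩
  exact Classical.epsilon_spec this

theorem longest_mem {I : Set B} (h : Finitary cs I) : longest cs I ∈ parabolic cs I :=
  (longest_spec h).1

theorem length_le_parLength {I : Set B} (h : Finitary cs I) {x : W} (hx : x ∈ parabolic cs I) :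
    cs.length x ≤ parLength cs I := (longest_spec h).2 x hx

/-- Every reflection of `W_I` is an inversion of `w_I`, by maximality. Writing `w_I` as `ξ ω⁻¹` and
exchanging with `t = ω i ω⁻¹`, the deleted letter must lie in `ξ`, since deleting one from `ω⁻¹`
would shorten the reduced word `ω i`. So each further letter lowers the length of `w_I ω` by one. -/
theorem length_longest_mul {I : Set B} (h : Finitary cs I) {u : W} (hu : u ∈ parabolic cs I) :
    cs.length (longest cs I * u) + cs.length u = parLength cs I := by
  obtain ⟨ω, hω, rfl, hI⟩ := exists_isReduced_of_mem_parabolic cs hu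
  clear hu
  induction ω using List.reverseRecOn with
  | nil => simp [parLength]
  | append_singleton ω i ih =>
    have hω' : cs.IsReduced ω := by simpa using hω.take ω.length
    have hi : i ∈ I := hI i (by simp)
    have hI' : ∀ j ∈ ω, j ∈ I := fun j hj => hI j (by simp [hj])
    have ih := ih hω' hI'
    have e : cs.wordProd (ω ++ [i]) = cs.wordProd ω * cs.simple i := by
      simp [wordProd_append]
    have hl : cs.length (cs.wordProd ω * cs.simple i) = ω.length + 1 := by
      rw [← e, hω.eq]; simp
    rw [hω'.eq] at ih
    rw [e, hl, ← mul_assoc]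
    obtain ⟨ξ, hξ, hξx⟩ := cs.exists_isReduced (longest cs I * cs.wordProd ω)
    set t := cs.wordProd ω * cs.simple i * (cs.wordProd ω)⁻¹ with ht
    have htr : cs.IsReflection t := ⟨_, _, rfl⟩
    have htI : t ∈ parabolic cs I := mul_mem (mul_mem (wordProd_mem_parabolic cs hI')
      (simple_mem_parabolic cs hi)) (inv_mem (wordProd_mem_parabolic cs hI'))
    have hw : cs.wordProd (ξ ++ ω.reverse) = longest cs I := by
      rw [wordProd_append, ← hξx]; simp
    have hinv : cs.IsRightInversion (cs.wordProd (ξ ++ ω.reverse)) t := by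
      refine ⟨htr, ?_⟩
      rw [hw]
      exact lt_of_le_of_ne (length_le_parLength h (mul_mem (longest_mem h) htI))
        (htr.length_mul_left_ne _)
    obtain ⟨j, hj, e2, -⟩ := strong_exchange cs hinv
    by_cases hjξ : j < ξ.length
    · rw [List.eraseIdx_append_of_lt_length hjξ, wordProd_append, wordProd_append, ← hξx] at e2
      have e3 : longest cs I * cs.wordProd ω * cs.simple i = cs.wordProd (ξ.eraseIdx j) := by
        have := congrArg (· * cs.wordProd ω) e2
        simpa [ht, mul_assoc] using this
      have h2 := cs.length_wordProd_le (ξ.eraseIdx j)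
      rw [List.length_eraseIdx_of_lt hjξ, ← e3, ← hξ.eq, ← hξx] at h2
      rcases cs.length_mul_simple (longest cs I * cs.wordProd ω) i with h' | h' <;> omega
    · exfalso
      rw [List.eraseIdx_append_of_length_le (by omega), wordProd_append, wordProd_append,
        mul_assoc] at e2
      have e3 := mul_left_cancel e2
      have e4 : cs.simple i * cs.wordProd ω.reverse =
          cs.wordProd (ω.reverse.eraseIdx (j - ξ.length)) := by
        rw [← e3, ht, wordProd_reverse]; group
      have h2 := cs.length_wordProd_le (ω.reverse.eraseIdx (j - ξ.length))
      have h3 := List.length_eraseIdx_le ω.reverse (j - ξ.length)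
      rw [← e4, ← cs.length_inv, mul_inv_rev, wordProd_reverse, inv_inv, inv_simple, hl] at h2
      simp at h3
      omega

theorem eq_longest {I : Set B} (h : Finitary cs I) {x : W} (hx : x ∈ parabolic cs I)
    (hl : cs.length x = parLength cs I) : x = longest cs I := by
  have h1 := length_longest_mul h (mul_mem (inv_mem (longest_mem h)) hx)
  rw [mul_inv_cancel_left, hl] at h1
  have h2 : cs.length ((longest cs I)⁻¹ * x) = 0 := by omega
  rw [length_eq_zero_iff, inv_mul_eq_one] at h2
  exact h2.symm

theorem longest_inv {I : Set B} (h : Finitary cs I) : (longest cs I)⁻¹ = longest cs I :=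
  eq_longest h (inv_mem (longest_mem h)) (by rw [length_inv, parLength])

theorem length_mul_longest {I : Set B} (h : Finitary cs I) {u : W} (hu : u ∈ parabolic cs I) :
    cs.length (u * longest cs I) + cs.length u = parLength cs I := by
  rw [← length_longest_mul h (inv_mem hu), ← cs.length_inv, mul_inv_rev, longest_inv h, length_inv cs u]

/-- The length of the element that defines the trace from `R^I` to `R^J`; the transitivity of traces
and their degrees come from it. -/
theorem length_longest_mul_longest_inv {I J : Set B} (hJ : Finitary cs J) (h : I ⊆ J) :
    cs.length (longest cs J * (longest cs I)⁻¹) + parLength cs I = parLength cs J := by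
  have := length_longest_mul hJ (inv_mem (parabolic_mono cs h (longest_mem (hJ.mono h))))
  rwa [length_inv] at this

theorem length_longest_inv_mul_longest {I J : Set B} (hJ : Finitary cs J) (h : I ⊆ J) :
    cs.length ((longest cs I)⁻¹ * longest cs J) + parLength cs I = parLength cs J := by
  have := length_mul_longest hJ (inv_mem (parabolic_mono cs h (longest_mem (hJ.mono h))))
  rwa [length_inv] at this

end Coxeter

section GeometricRepresentation

variable {B : Type uB} {W : Type uW} [Group W] {M : CoxeterMatrix B} (cs : CoxeterSystem M W)

/-! ### The geometric representation and the order of a product of two simple reflections -/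

/-- The square of `ζ` is to have exact order `m`, with infinite order when `m = 0`: take `2` in that
case and a primitive `2m`-th root of unity otherwise. The assumption `m ≠ 1` keeps `ζ²` away from 1.
-/
theorem exists_rotation (m : ℕ) (hm : m ≠ 1) :
    ∃ ζ : ℂ, ζ ≠ 0 ∧ ζ ^ 2 ≠ 1 ∧ ∀ n, ζ ^ (2 * n) = 1 ↔ m ∣ n := by
  rcases Nat.eq_zero_or_pos m with rfl | hpos
  · refine ⟨2, by norm_num, by norm_num, fun n => ?_⟩
    rw [zero_dvd_iff]
    constructor
    · intro h
      have h' : ((2 ^ (2 * n) : ℕ) : ℂ) = ((1 : ℕ) : ℂ) := by push_cast; exact h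
      have h2 := Nat.cast_injective h'
      by_contra hn
      have : 1 < 2 ^ (2 * n) := Nat.one_lt_two_pow (by omega)
      omega
    · rintro rfl; simp
  · have hp := Complex.isPrimitiveRoot_exp (2 * m) (by omega)
    refine ⟨_, hp.ne_zero (by omega), fun h => ?_, fun n => ?_⟩
    · have := Nat.le_of_dvd (by omega) ((hp.pow_eq_one_iff_dvd 2).1 h)
      omega
    · rw [hp.pow_eq_one_iff_dvd]
      exact mul_dvd_mul_iff_left (by omega)

open Classical in
/-- A rotation parameter of the exact order `m`. -/
def rotation (m : ℕ) : ℂ := if h : m = 1 then 0 else (exists_rotation m h).choose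

theorem rotation_spec {m : ℕ} (hm : m ≠ 1) : rotation m ≠ 0 ∧ rotation m ^ 2 ≠ 1 ∧
    ∀ n, rotation m ^ (2 * n) = 1 ↔ m ∣ n := by
  rw [rotation, dif_neg hm]
  exact (exists_rotation m hm).choose_spec

open Classical in
/-- The simple coroots of the geometric representation. -/
def geomCoroot (M : CoxeterMatrix B) (i : B) : (B →₀ ℂ) →ₗ[ℂ] ℂ :=
  Finsupp.linearCombination ℂ fun j =>
    if i = j then 2 else -(rotation (M.M i j) + (rotation (M.M i j))⁻¹)

/-- The simple reflections of the geometric representation. -/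
def geomReflection (M : CoxeterMatrix B) (i : B) : Module.End ℂ (B →₀ ℂ) :=
  LinearMap.id - (geomCoroot M i).smulRight (Finsupp.single i 1)

theorem geomReflection_apply (i : B) (v : B →₀ ℂ) :
    geomReflection M i v = v - geomCoroot M i v • Finsupp.single i 1 := rfl

theorem geomCoroot_self (i : B) : geomCoroot M i (Finsupp.single i 1) = 2 := by
  simp [geomCoroot]

theorem geomCoroot_of_ne {i j : B} (h : i ≠ j) : geomCoroot M i (Finsupp.single j 1) =
    -(rotation (M.M i j) + (rotation (M.M i j))⁻¹) := by
  simp [geomCoroot, h]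

theorem geomReflection_mul_self (i : B) : geomReflection M i * geomReflection M i = 1 := by
  refine LinearMap.ext fun v => ?_
  simp only [Module.End.mul_apply, Module.End.one_apply, geomReflection_apply, map_sub, map_smul,
    geomCoroot_self]
  module

/-- With Cartan entry `-(ζ + ζ⁻¹)`, the functionals `α_i^∨ + ζ^{±1} α_j^∨` are eigenvectors of the
transpose of `s_i s_j`, with eigenvalues `ζ^{±2}`. Both the relation `(s_i s_j)^m = 1` and the
exactness of the order `m` are read off from them. -/
theorem geom_eigen {i j : B} (h : i ≠ j) (ζ : ℂ) (hζ : ζ = rotation (M.M i j)) (v : B →₀ ℂ) (n : ℕ) :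
    geomCoroot M i (((geomReflection M i * geomReflection M j) ^ n) v) +
        ζ * geomCoroot M j (((geomReflection M i * geomReflection M j) ^ n) v) =
      ζ ^ (2 * n) * (geomCoroot M i v + ζ * geomCoroot M j v) ∧
    geomCoroot M i (((geomReflection M i * geomReflection M j) ^ n) v) +
        ζ⁻¹ * geomCoroot M j (((geomReflection M i * geomReflection M j) ^ n) v) =
      ζ⁻¹ ^ (2 * n) * (geomCoroot M i v + ζ⁻¹ * geomCoroot M j v) := by
  have hm : M.M i j ≠ 1 := M.off_diagonal i j h
  have h0 : ζ ≠ 0 := hζ ▸ (rotation_spec hm).1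
  induction n with
  | zero => simp
  | succ n ih =>
    rw [pow_succ']
    generalize (geomReflection M i * geomReflection M j) ^ n = g at ih
    have hji : geomCoroot M j (Finsupp.single i 1) = -(ζ + ζ⁻¹) := by
      rw [geomCoroot_of_ne h.symm, M.symmetric j i, hζ]
    have hij : geomCoroot M i (Finsupp.single j 1) = -(ζ + ζ⁻¹) := by
      rw [geomCoroot_of_ne h, hζ]
    simp only [Module.End.mul_apply, geomReflection_apply, map_sub, map_smul, smul_eq_mul,
      geomCoroot_self, hij, hji]
    obtain ⟨ih1, ih2⟩ := ih
    rw [mul_add 2 n 1, pow_add, pow_add, mul_comm (ζ ^ (2 * n)), mul_comm (ζ⁻¹ ^ (2 * n)), mul_assoc,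
      mul_assoc, ← ih1, ← ih2]
    constructor
    · field_simp; ring
    · simp only [inv_pow]; field_simp; ring

/-- The map `(s_i s_j)^m` displaces `v` by a combination of `α_i` and `α_j`. Both eigenfunctionals
kill the displacement because `ζ^{2m} = 1`, and they are independent on the plane of `α_i`, `α_j`
because `ζ² ≠ 1`. -/
theorem isLiftable_geomReflection : M.IsLiftable (geomReflection M) := by
  intro i j
  by_cases h : i = j
  · subst h
    rw [M.diagonal, pow_one, geomReflection_mul_self]
  set ζ := rotation (M.M i j) with hζ
  have hm : M.M i j ≠ 1 := M.off_diagonal i j h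
  obtain ⟨h0, h1, h2⟩ := rotation_spec hm
  rw [← hζ] at h0 h1 h2
  have hmem : ∀ n v, ∃ a b : ℂ, ((geomReflection M i * geomReflection M j) ^ n) v =
      v + a • Finsupp.single i 1 + b • Finsupp.single j 1 := by
    intro n v
    induction n with
    | zero => exact ⟨0, 0, by simp⟩
    | succ n ih =>
      obtain ⟨a, b, e⟩ := ih
      rw [pow_succ', Module.End.mul_apply, e, Module.End.mul_apply, geomReflection_apply,
        geomReflection_apply]
      generalize geomCoroot M j (v + a • Finsupp.single i 1 + b • Finsupp.single j 1) = y
      generalize geomCoroot M i (_ - _) = x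
      exact ⟨a - x, b - y, by module⟩
  refine LinearMap.ext fun v => ?_
  obtain ⟨a, b, e⟩ := hmem (M.M i j) v
  obtain ⟨e1, e2⟩ := geom_eigen h ζ hζ v (M.M i j)
  have hz : ζ ^ (2 * M.M i j) = 1 := (h2 _).2 dvd_rfl
  rw [inv_pow, hz, inv_one, one_mul] at e2
  rw [hz, one_mul] at e1
  have hji : geomCoroot M j (Finsupp.single i 1) = -(ζ + ζ⁻¹) := by
    rw [geomCoroot_of_ne (Ne.symm h), M.symmetric j i, hζ]
  have hij : geomCoroot M i (Finsupp.single j 1) = -(ζ + ζ⁻¹) := by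
    rw [geomCoroot_of_ne h, hζ]
  rw [e] at e1 e2 ⊢
  simp only [map_add, map_smul, smul_eq_mul, geomCoroot_self, hij, hji] at e1 e2
  have h1' : ζ ^ 2 - 1 ≠ 0 := sub_ne_zero.2 h1
  field_simp at e1 e2
  have f2 : a * (ζ ^ 2 - 1) ^ 2 = 0 := by linear_combination -ζ * e1 - e2
  have ha : a = 0 := (mul_eq_zero.1 f2).resolve_right (pow_ne_zero _ h1')
  subst ha
  have f1 : b * (ζ ^ 2 - 1) = 0 := by linear_combination e1
  simp [(mul_eq_zero.1 f1).resolve_right h1']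

/-- The product of two distinct simple reflections has order `M i j`. -/
theorem dvd_of_simple_mul_simple_pow_eq_one {i j : B} (h : i ≠ j) {n : ℕ}
    (hn : (cs.simple i * cs.simple j) ^ n = 1) : M.M i j ∣ n := by
  have hm : M.M i j ≠ 1 := M.off_diagonal i j h
  obtain ⟨h0, h1, h2⟩ := rotation_spec hm
  set ζ := rotation (M.M i j) with hζ
  have hg : (geomReflection M i * geomReflection M j) ^ n = 1 := by
    have := congrArg (cs.lift ⟨geomReflection M, isLiftable_geomReflection⟩) hn
    simpa [CoxeterSystem.lift_apply_simple] using this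
  -- On `α_i` the first eigenfunctional takes the nonzero value `1 - ζ²`, so triviality of `(s_i
  -- s_j)^n` forces `ζ^{2n} = 1`.
  have e := (geom_eigen h ζ hζ (Finsupp.single i 1) n).1
  have hji : geomCoroot M j (Finsupp.single i 1) = -(ζ + ζ⁻¹) := by
    rw [geomCoroot_of_ne (Ne.symm h), M.symmetric j i, hζ]
  rw [hg, Module.End.one_apply, geomCoroot_self, hji] at e
  have h1' : 1 - ζ ^ 2 ≠ 0 := sub_ne_zero.2 (Ne.symm h1)
  rw [← h2]
  have : (2 + ζ * -(ζ + ζ⁻¹)) = 1 - ζ ^ 2 := by field_simp; ring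
  rw [this] at e
  exact (mul_right_cancel₀ h1' (by rw [one_mul]; exact e)).symm

end GeometricRepresentation

section Matsumoto

variable {B : Type uB} {W : Type uW} [Group W] {M : CoxeterMatrix B} {cs : CoxeterSystem M W}

open CoxeterSystem

/-! ### Matsumoto's theorem -/

theorem exists_alternatingWord_of_isReduced {s t : B} {ω : List B} (hω : cs.IsReduced ω)
    (h : ∀ i ∈ ω, i = s ∨ i = t) :
    ω = alternatingWord s t ω.length ∨ ω = alternatingWord t s ω.length := by
  induction ω using List.reverseRecOn generalizing s t with
  | nil => left; rfl
  | append_singleton ω i ih =>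
    wlog hi : i = t generalizing s t
    · have hi' : i = s := by
        rcases h i (by simp) with h' | h'
        · exact h'
        · exact absurd h' hi
      exact (this (s := t) (t := s) (fun j hj => (h j hj).symm) hi').symm
    subst hi
    left
    have hω' : cs.IsReduced ω := by simpa using hω.take ω.length
    rw [List.length_append, List.length_singleton, alternatingWord_succ, List.concat_eq_append]
    congr 1
    rcases ih (s := s) (t := i) hω' (fun j hj => h j (by simp [hj])) with h' | h'
    · cases hn : ω.length with
      | zero => rw [List.eq_nil_of_length_eq_zero hn]; rfl
      | succ n =>
        exfalso
        rw [hn, alternatingWord_succ, List.concat_eq_append] at h'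
        have h1 := hω.eq
        rw [h', wordProd_append, wordProd_append] at h1
        simp only [wordProd_singleton, simple_mul_simple_cancel_right, List.length_append,
          List.length_singleton] at h1
        have h2 := cs.length_wordProd_le (alternatingWord i s n)
        simp at h1 h2
        omega
    · exact h'

theorem wordProd_cons_alternatingWord_or (s t : B) (m : ℕ) :
    ∃ a b, ((alternatingWord s t (m + 1) = s :: a ∧ alternatingWord t s (m + 1) = t :: b) ∨
      (alternatingWord s t (m + 1) = t :: a ∧ alternatingWord t s (m + 1) = s :: b)) := by
  by_cases hm : Even m
  · exact ⟨_, _, Or.inr ⟨by rw [alternatingWord_succ', if_pos hm],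
      by rw [alternatingWord_succ', if_pos hm]⟩⟩
  · exact ⟨_, _, Or.inl ⟨by rw [alternatingWord_succ', if_neg hm],
      by rw [alternatingWord_succ', if_neg hm]⟩⟩

/-- In a rank two parabolic subgroup only the element given by the two braid words has both
simple reflections as right descents. -/
theorem eq_braidWord_of_isRightDescent {s t : B} (hst : s ≠ t) {u : W}
    (hu : u ∈ parabolic cs {s, t}) (hs : cs.IsRightDescent u s) (ht : cs.IsRightDescent u t) :
    M.M s t ≠ 0 ∧ u = cs.wordProd (braidWord M s t) ∧ cs.length u = M.M s t := by
  -- A right descent `j` gives a reduced word in two letters ending in `j`, and such a word has to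
  -- alternate.
  have red : ∀ i j : B, cs.IsRightDescent u j → i ∈ ({s, t} : Set B) → j ∈ ({s, t} : Set B) →
      i ≠ j → u = cs.wordProd (alternatingWord i j (cs.length u)) := by
    intro i j hj hi' hj' hij
    have hm : u * cs.simple j ∈ parabolic cs {s, t} := mul_mem hu (simple_mem_parabolic cs hj')
    obtain ⟨ω, hω, he, hI⟩ := exists_isReduced_of_mem_parabolic cs hm
    have hu' : u = cs.wordProd (ω ++ [j]) := by rw [wordProd_append, ← he]; simp
    have hl : cs.length u = ω.length + 1 := by
      rw [isRightDescent_iff] at hj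
      rw [← hj, he, hω.eq]
    have hred : cs.IsReduced (ω ++ [j]) := by
      rw [CoxeterSystem.IsReduced, ← hu', hl]; simp
    have hmem : ∀ k ∈ ω ++ [j], k = i ∨ k = j := by
      intro k hk
      have : k ∈ ({s, t} : Set B) := by
        rcases List.mem_append.1 hk with h | h
        · exact hI k h
        · simp at h; rwa [h]
      simp only [Set.mem_insert_iff, Set.mem_singleton_iff] at this hi' hj'
      rcases this with rfl | rfl <;> rcases hi' with rfl | rfl <;> rcases hj' with rfl | rfl <;>
        simp_all
    rcases exists_alternatingWord_of_isReduced hred hmem with h | h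
    · have hlen : (ω ++ [j]).length = cs.length u := by rw [hl]; simp
      rw [hlen] at h
      rw [← h]; exact hu'
    · exfalso
      rw [List.length_append, List.length_singleton, alternatingWord_succ,
        List.concat_eq_append] at h
      have := (List.append_inj' h rfl).2
      simp at this
      exact hij this.symm
  have e1 := red s t ht (by simp) (by simp) hst
  have e2 := red t s hs (by simp) (by simp) hst.symm
  set q := cs.length u with hq
  have hq0 : q ≠ 0 := by
    intro h0
    rw [length_eq_zero_iff] at h0
    rw [h0] at hs
    exact cs.not_isRightDescent_one s hs
  -- Both alternating words of length `q` represent `u`; equating them gives this power, separately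
  -- for `q` even and odd.
  have hpow : (cs.simple s * cs.simple t) ^ q = 1 := by
    have e3 := e1.symm.trans e2
    have hinv : cs.simple t * cs.simple s = (cs.simple s * cs.simple t)⁻¹ := by simp
    rw [prod_alternatingWord_eq_mul_pow, prod_alternatingWord_eq_mul_pow, hinv, inv_pow] at e3
    rcases Nat.even_or_odd' q with ⟨k, hk | hk⟩
    · have hk' : Even q := ⟨k, by omega⟩
      have hd : q / 2 = k := by omega
      rw [if_pos hk', if_pos hk', hd, one_mul, one_mul, eq_inv_iff_mul_eq_one, ← pow_add] at e3
      rwa [hk, two_mul]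
    · have hk' : ¬ Even q := by rw [Nat.not_even_iff_odd]; exact ⟨k, hk⟩
      have hd : q / 2 = k := by omega
      rw [if_neg hk', if_neg hk', hd] at e3
      have e4 := congrArg (cs.simple s * ·) e3
      simp only [← mul_assoc] at e4
      rw [← pow_succ', simple_mul_simple_self, one_mul, eq_inv_iff_mul_eq_one, ← pow_add] at e4
      rwa [hk, show 2 * k + 1 = k + 1 + k by ring]
  -- Exactness of the order gives `m ≤ q` and excludes `m = 0`; an alternating word longer than `m`
  -- is not reduced, so `q = m`.
  have hdvd := dvd_of_simple_mul_simple_pow_eq_one cs hst hpow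
  have hM : M.M s t ≠ 0 := fun h0 => hq0 (by rw [h0] at hdvd; exact zero_dvd_iff.1 hdvd)
  have hle : M.M s t ≤ q := Nat.le_of_dvd (Nat.pos_of_ne_zero hq0) hdvd
  have hred : cs.IsReduced (alternatingWord s t q) := by
    rw [CoxeterSystem.IsReduced, ← e1]; simp [hq]
  have hqM : q = M.M s t := by
    by_contra hne
    exact cs.not_isReduced_alternatingWord s t hM (by omega) hred
  exact ⟨hM, by rw [hqM] at e1; exact e1, hqM⟩

theorem reverse_alternatingWord (i j : B) (m : ℕ) :
    (alternatingWord i j m).reverse = alternatingWord i j m ∨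
      (alternatingWord i j m).reverse = alternatingWord j i m := by
  rcases Nat.even_or_odd' m with ⟨k, rfl | rfl⟩
  · exact Or.inr (reverse_alternatingWord_two_mul i j k)
  · left
    rw [alternatingWord_succ, List.concat_eq_append, List.reverse_append,
      reverse_alternatingWord_two_mul, ← List.concat_eq_append, ← alternatingWord_succ,
      alternatingWord_succ', if_pos (by simp)]
    rfl

variable (cs) in
/-- If `s` and `t` are left descents of `w`, then `w` has a reduced word beginning with a braid word
in `s` and `t`. -/
theorem exists_braidWord_append {s t : B} (hst : s ≠ t) {w : W} (hs : cs.IsLeftDescent w s)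
    (ht : cs.IsLeftDescent w t) :
    M.M s t ≠ 0 ∧ ∃ ν : List B, cs.IsReduced (braidWord M s t ++ ν) ∧
      cs.IsReduced (braidWord M t s ++ ν) ∧ w = cs.wordProd (braidWord M s t ++ ν) ∧
      w = cs.wordProd (braidWord M t s ++ ν) := by
  -- Lengths add in `w⁻¹ = v u`, so `s` and `t` are right descents of the rank two part `u`, which
  -- is therefore the braid element.
  obtain ⟨v, hv, u, hu, e⟩ := exists_isMinRep cs {s, t} w⁻¹
  have hdes : ∀ i ∈ ({s, t} : Set B), cs.IsLeftDescent w i → cs.IsRightDescent u i := by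
    intro i hi h
    rw [← isRightDescent_inv_iff, e, IsRightDescent, mul_assoc, hv.length_mul hu,
      hv.length_mul (mul_mem hu (simple_mem_parabolic cs hi))] at h
    rw [IsRightDescent]
    omega
  obtain ⟨hM, hu', hl⟩ := eq_braidWord_of_isRightDescent hst hu (hdes s (by simp) hs)
    (hdes t (by simp) ht)
  obtain ⟨ν, hν, hνv⟩ := cs.exists_isReduced v⁻¹
  have huinv : u⁻¹ = u := by
    rw [hu', ← wordProd_reverse]
    rcases reverse_alternatingWord s t (M.M s t) with h | h
    · rw [h]
    · rw [h, wordProd_braidWord_eq, braidWord, M.symmetric t s]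
  have hw1 : w = cs.wordProd (braidWord M s t ++ ν) := by
    rw [wordProd_append, ← hνv, ← hu', ← huinv, ← mul_inv_rev, ← e, inv_inv]
  have hw2 : w = cs.wordProd (braidWord M t s ++ ν) := by
    rw [wordProd_append, ← wordProd_braidWord_eq, ← wordProd_append]; exact hw1
  have hlw : cs.length w = M.M s t + ν.length := by
    rw [← length_inv, e, hv.length_mul hu, hl, ← hν.eq, ← hνv, length_inv, add_comm]
  refine ⟨hM, ν, ?_, ?_, hw1, hw2⟩
  · rw [CoxeterSystem.IsReduced, ← hw1, hlw]; simp
  · rw [CoxeterSystem.IsReduced, ← hw2, hlw]; simp [M.symmetric t s]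

variable (cs) in
/-- Matsumoto's theorem: a map to a monoid satisfying the braid relations takes the same value on
all reduced words of an element. -/
theorem matsumoto {G : Type*} [Monoid G] (f : B → G)
    (hf : ∀ s t, s ≠ t → M.M s t ≠ 0 →
      ((braidWord M s t).map f).prod = ((braidWord M t s).map f).prod)
    {ω ω' : List B} (hω : cs.IsReduced ω) (hω' : cs.IsReduced ω')
    (h : cs.wordProd ω = cs.wordProd ω') : (ω.map f).prod = (ω'.map f).prod := by
  obtain ⟨n, hn⟩ : ∃ n, ω.length = n := ⟨_, rfl⟩
  induction n generalizing ω ω' with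
  | zero =>
    have h1 : ω'.length = 0 := by rw [← hω'.eq, ← h, hω.eq, hn]
    rw [List.eq_nil_of_length_eq_zero hn, List.eq_nil_of_length_eq_zero h1]
  | succ n ih =>
    have hn' : ω'.length = n + 1 := by rw [← hω'.eq, ← h, hω.eq, hn]
    have same : ∀ {i : B} {a b : List B}, cs.IsReduced (i :: a) → cs.IsReduced (i :: b) →
        cs.wordProd (i :: a) = cs.wordProd (i :: b) → a.length = n →
        ((i :: a).map f).prod = ((i :: b).map f).prod := by
      intro i a b ha hb hab hla
      rw [wordProd_cons, wordProd_cons] at hab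
      rw [List.map_cons, List.map_cons, List.prod_cons, List.prod_cons,
        ih (by simpa using ha.drop 1) (by simpa using hb.drop 1) (mul_left_cancel hab) hla]
    have desc : ∀ {i : B} {a : List B}, cs.IsReduced (i :: a) →
        cs.IsLeftDescent (cs.wordProd (i :: a)) i := by
      intro i a ha
      have h1 := ha.eq
      have h2 := cs.length_wordProd_le a
      rw [IsLeftDescent, wordProd_cons, simple_mul_simple_cancel_left, ← wordProd_cons, h1]
      simp; omega
    match ω, ω', hω, hω', h, hn, hn' with
    | i :: a, j :: b, hω, hω', h, hn, hn' =>
      by_cases hij : i = j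
      · subst hij
        exact same hω hω' h (by simpa using hn)
      have hi := desc hω
      have hj := desc hω'
      rw [← h] at hj
      -- When the first letters differ, both are left descents. The two words are then joined
      -- through the two braid words followed by `ν`: at either end the first letters agree and
      -- induction applies, and in the middle there is one braid relation.
      obtain ⟨hM, ν, r1, r2, e1, e2⟩ := exists_braidWord_append cs hij hi hj
      have hb : ((braidWord M i j ++ ν).map f).prod = ((braidWord M j i ++ ν).map f).prod := by
        rw [List.map_append, List.prod_append, hf i j hij hM, ← List.prod_append, ← List.map_append]
      -- The parity of `M i j` decides which of the two braid words starts with `i`.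
      obtain ⟨m, hm⟩ := Nat.exists_eq_succ_of_ne_zero hM
      obtain ⟨x, y, hxy | hxy⟩ := wordProd_cons_alternatingWord_or i j m
      all_goals
        have b1 : braidWord M i j = _ := (congrArg (alternatingWord i j) hm).trans hxy.1
        have b2 : braidWord M j i = _ :=
          (congrArg (alternatingWord j i) ((M.symmetric j i).trans hm)).trans hxy.2
        rw [b1, List.cons_append] at r1 e1 hb
        rw [b2, List.cons_append] at r2 e2 hb
      · exact (same hω r1 e1 (by simpa using hn)).trans (hb.trans
          (same hω' r2 (h.symm.trans e2) (by simpa using hn')).symm)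
      · exact (same hω r2 e2 (by simpa using hn)).trans (hb.symm.trans
          (same hω' r1 (h.symm.trans e1) (by simpa using hn')).symm)

end Matsumoto

namespace Realization

variable {B : Type uB} {W : Type uW} [Group W] {M : CoxeterMatrix B} {cs : CoxeterSystem M W}
  {k : Type uk} [Field k] {V : Type uV} [AddCommGroup V] [Module k V]
  (ρ : Realization cs k V)

open CoxeterSystem

/-! ### The symmetric algebra -/

instance isDomain_symmetricAlgebra : IsDomain (SymmetricAlgebra k V) :=
  (SymmetricAlgebra.equivMvPolynomial (Module.Basis.ofVectorSpace k V)).toMulEquiv.isDomain _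

theorem ι_injective : Function.Injective (SymmetricAlgebra.ι k V) := by
  rw [injective_iff_map_eq_zero]
  intro v hv
  by_contra h
  apply h
  rw [← Module.forall_dual_apply_eq_zero_iff k]
  intro φ
  rw [← SymmetricAlgebra.lift_ι_apply φ v, hv, map_zero]

/-! ### The action of the Coxeter group -/

theorem act_ι (w : W) (v : V) :
    ρ.act w (SymmetricAlgebra.ι k V v) = SymmetricAlgebra.ι k V (ρ.rep w v) := by
  simp [act]

theorem act_mul (w w' : W) (f : ρ.Poly) : ρ.act (w * w') f = ρ.act w (ρ.act w' f) := by
  have : ρ.act (w * w') = (ρ.act w).comp (ρ.act w') := by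
    apply SymmetricAlgebra.algHom_ext
    ext v
    simp [act_ι]
  rw [this]; rfl

theorem act_one (f : ρ.Poly) : ρ.act 1 f = f := by
  have : ρ.act 1 = AlgHom.id k _ := by
    apply SymmetricAlgebra.algHom_ext
    ext v
    simp [act_ι]
  rw [this]; rfl

/-- The root `α_s` as an element of `R`. -/
def alpha (s : B) : ρ.Poly := SymmetricAlgebra.ι k V (ρ.root s)

theorem act_simple_ι (s : B) (v : V) : ρ.act (cs.simple s) (SymmetricAlgebra.ι k V v) =
    SymmetricAlgebra.ι k V v - ρ.coroot s v • ρ.alpha s := by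
  rw [act_ι, rep_simple, map_sub, map_smul, alpha]

theorem act_simple_alpha (s : B) : ρ.act (cs.simple s) (ρ.alpha s) = -ρ.alpha s := by
  rw [alpha, act_simple_ι, pairing_self, alpha, two_smul]; abel

/-- A zero root would make `s` act trivially. As `R` is a domain, `α_s` can then be cancelled, which
makes Demazure operators unique and linear. -/
theorem alpha_ne_zero (hf : ρ.IsFaithful) (s : B) : ρ.alpha s ≠ 0 := by
  intro h
  have h0 : ρ.root s = 0 := ι_injective (h.trans (map_zero _).symm)
  have h1 : ρ.rep (cs.simple s) = ρ.rep 1 := by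
    ext v; simp [rep_simple, h0]
  have h2 := congrArg cs.length (hf h1)
  simp at h2

/-! ### Simple Demazure operators -/

/-- Divisibility by `α_s` holds on generators and passes to products by the twisted Leibniz rule.
Hence the default value in `demazureSimple` never occurs. -/
theorem exists_sub_act_eq (s : B) (f : ρ.Poly) :
    ∃ g : ρ.Poly, f - ρ.act (cs.simple s) f = ρ.alpha s * g := by
  induction f using SymmetricAlgebra.induction with
  | algebraMap r => exact ⟨0, by rw [AlgHom.commutes]; simp⟩
  | ι v => exact ⟨algebraMap k _ (ρ.coroot s v), by
      rw [act_simple_ι, Algebra.smul_def]; ring⟩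
  | mul f f' h h' =>
    obtain ⟨g, hg⟩ := h
    obtain ⟨g', hg'⟩ := h'
    refine ⟨g * f' + ρ.act (cs.simple s) f * g', ?_⟩
    rw [map_mul]
    linear_combination f' * hg + ρ.act (cs.simple s) f * hg'
  | add f f' h h' =>
    obtain ⟨g, hg⟩ := h
    obtain ⟨g', hg'⟩ := h'
    exact ⟨g + g', by rw [map_add]; linear_combination hg + hg'⟩

theorem alpha_mul_demazureSimple (s : B) (f : ρ.Poly) :
    ρ.alpha s * ρ.demazureSimple s f = f - ρ.act (cs.simple s) f := by
  have h : ∃ g : ρ.Poly, f - ρ.act (cs.simple s) f = SymmetricAlgebra.ι k V (ρ.root s) * g :=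
    ρ.exists_sub_act_eq s f
  rw [demazureSimple, dif_pos h]
  exact h.choose_spec.symm

variable {ρ}

/-- The simple Demazure operator as a linear map. -/
def dem (hf : ρ.IsFaithful) (s : B) : Module.End k ρ.Poly where
  toFun := ρ.demazureSimple s
  map_add' f g := by
    apply mul_left_cancel₀ (ρ.alpha_ne_zero hf s)
    rw [mul_add]
    simp only [alpha_mul_demazureSimple, map_add]
    ring
  map_smul' r f := by
    apply mul_left_cancel₀ (ρ.alpha_ne_zero hf s)
    rw [RingHom.id_apply, mul_smul_comm]
    simp only [alpha_mul_demazureSimple, map_smul, smul_sub]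

variable (hf : ρ.IsFaithful)

theorem alpha_mul_dem (s : B) (f : ρ.Poly) :
    ρ.alpha s * dem hf s f = f - ρ.act (cs.simple s) f := ρ.alpha_mul_demazureSimple s f

theorem eq_dem_of_alpha_mul {s : B} {f g : ρ.Poly}
    (h : ρ.alpha s * g = f - ρ.act (cs.simple s) f) : dem hf s f = g :=
  mul_left_cancel₀ (ρ.alpha_ne_zero hf s) (by rw [alpha_mul_dem, h])

theorem dem_ι (s : B) (v : V) :
    dem hf s (SymmetricAlgebra.ι k V v) = algebraMap k _ (ρ.coroot s v) := by
  apply eq_dem_of_alpha_mul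
  rw [act_simple_ι, Algebra.smul_def]; ring

theorem dem_mul (s : B) (f g : ρ.Poly) :
    dem hf s (f * g) = dem hf s f * g + ρ.act (cs.simple s) f * dem hf s g := by
  apply eq_dem_of_alpha_mul
  rw [map_mul]
  linear_combination g * alpha_mul_dem hf s f +
    ρ.act (cs.simple s) f * alpha_mul_dem hf s g

theorem dem_eq_zero_iff {s : B} {f : ρ.Poly} :
    dem hf s f = 0 ↔ ρ.act (cs.simple s) f = f := by
  rw [← mul_eq_zero_iff_left (ρ.alpha_ne_zero hf s), alpha_mul_dem, sub_eq_zero, eq_comm]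

theorem act_simple_dem (s : B) (f : ρ.Poly) :
    ρ.act (cs.simple s) (dem hf s f) = dem hf s f := by
  have h := congrArg (ρ.act (cs.simple s)) (alpha_mul_dem hf s f)
  rw [map_mul, map_sub, act_simple_alpha, ← act_mul, simple_mul_simple_self, act_one] at h
  apply mul_left_cancel₀ (ρ.alpha_ne_zero hf s)
  linear_combination -h - alpha_mul_dem hf s f

theorem dem_dem (s : B) (f : ρ.Poly) : dem hf s (dem hf s f) = 0 :=
  (dem_eq_zero_iff hf).2 (act_simple_dem hf s f)

theorem dem_mul_of_act_eq {s : B} {f : ρ.Poly} (h : ρ.act (cs.simple s) f = f) (g : ρ.Poly) :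
    dem hf s (f * g) = f * dem hf s g := by
  rw [dem_mul, (dem_eq_zero_iff hf).2 h, h, zero_mul, zero_add]

/-- Both sides equal `∂_s f · ∂_s g`; this is the rank one case of `demElt_longest_adjoint`. -/
theorem dem_mul_dem_comm (s : B) (f g : ρ.Poly) :
    dem hf s (f * dem hf s g) = dem hf s (dem hf s f * g) := by
  rw [mul_comm f, dem_mul_of_act_eq hf (act_simple_dem hf s g),
    dem_mul_of_act_eq hf (act_simple_dem hf s f), mul_comm]

/-! ### The braid relations -/

/-- The composition of the simple Demazure operators along a word. -/
def demWord (ω : List B) : Module.End k ρ.Poly := (ω.map (dem hf)).prod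

theorem demWord_cons (s : B) (ω : List B) (f : ρ.Poly) :
    demWord hf (s :: ω) f = dem hf s (demWord hf ω f) := by
  simp [demWord]

theorem demWord_append (ω ω' : List B) (f : ρ.Poly) :
    demWord hf (ω ++ ω') f = demWord hf ω (demWord hf ω' f) := by
  simp [demWord]

/-- The simple root of the first letter of an alternating word of length `q + 1` ending in `t`. -/
def altLetter (s t : B) (q : ℕ) : B := if Even q then t else s

theorem altLetter_add_two (s t : B) (q : ℕ) : altLetter s t (q + 2) = altLetter s t q := by
  simp [altLetter, parity_simps]

theorem alternatingWord_cons (s t : B) (q : ℕ) :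
    alternatingWord s t (q + 1) = altLetter s t q :: alternatingWord s t q :=
  alternatingWord_succ' s t q

theorem altLetter_succ_swap (s t : B) (q : ℕ) : altLetter t s (q + 1) = altLetter s t q := by
  by_cases h : Even q <;> simp [altLetter, h, parity_simps]

theorem quantumNumber_add_two (n : ℕ) (x y : k) :
    quantumNumber (n + 2) x y = x * quantumNumber (n + 1) y x - quantumNumber n x y := rfl

/-- The coroots attached to alternating words. -/
def altCoroot (ρ : Realization cs k V) (s t : B) (q : ℕ) : Module.Dual k V :=
  ρ.coroot (altLetter s t q) ∘ₗ ρ.rep (cs.wordProd (alternatingWord s t q))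

/-- Minus the Cartan entries, alternating. -/
def altCartan (ρ : Realization cs k V) (s t : B) (q : ℕ) : k :=
  -ρ.coroot (altLetter s t (q + 1)) (ρ.root (altLetter s t q))

theorem altCartan_add_two (s t : B) (q : ℕ) : altCartan ρ s t (q + 2) = altCartan ρ s t q := by
  simp only [altCartan, show q + 2 + 1 = q + 1 + 2 by ring, altLetter_add_two]

/-- The same recursion as for two-coloured quantum numbers, so these become the coefficients of the
transported coroots. -/
theorem altCoroot_add_two (s t : B) (q : ℕ) : altCoroot ρ s t (q + 2) =
    altCartan ρ s t (q + 1) • altCoroot ρ s t (q + 1) - altCoroot ρ s t q := by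
  ext v
  simp only [altCoroot, LinearMap.comp_apply, LinearMap.sub_apply, LinearMap.smul_apply,
    alternatingWord_cons s t (q + 1), alternatingWord_cons s t q, wordProd_cons, map_mul,
    Module.End.mul_apply, rep_simple, map_sub, map_smul, altCartan, altLetter_add_two,
    pairing_self, smul_eq_mul]
  ring

theorem altCoroot_eq (s t : B) (q : ℕ) : altCoroot ρ s t (q + 1) =
    quantumNumber (q + 2) (altCartan ρ s t q) (altCartan ρ s t (q + 1)) • ρ.coroot t +
    quantumNumber (q + 1) (altCartan ρ s t q) (altCartan ρ s t (q + 1)) • ρ.coroot s := by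
  have h0 : altCoroot ρ s t 0 = ρ.coroot t := by
    ext v; simp [altCoroot, altLetter, alternatingWord]
  have h1 : altCoroot ρ s t 1 = altCartan ρ s t 0 • ρ.coroot t + ρ.coroot s := by
    ext v; simp [altCoroot, altLetter, alternatingWord, altCartan, rep_simple]; ring
  have key : ∀ q, altCoroot ρ s t (q + 1) =
      quantumNumber (q + 2) (altCartan ρ s t q) (altCartan ρ s t (q + 1)) • ρ.coroot t +
      quantumNumber (q + 1) (altCartan ρ s t q) (altCartan ρ s t (q + 1)) • ρ.coroot s ∧
      altCoroot ρ s t (q + 2) =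
      quantumNumber (q + 3) (altCartan ρ s t (q + 1)) (altCartan ρ s t (q + 2)) • ρ.coroot t +
      quantumNumber (q + 2) (altCartan ρ s t (q + 1)) (altCartan ρ s t (q + 2)) • ρ.coroot s := by
    intro q
    induction q with
    | zero =>
      refine ⟨?_, ?_⟩
      · rw [h1]; simp [quantumNumber]
      · rw [altCoroot_add_two, h1, h0, altCartan_add_two]
        simp only [quantumNumber]
        module
    | succ q ih =>
      refine ⟨ih.2, ?_⟩
      rw [altCoroot_add_two, ih.2, ih.1, altCartan_add_two, altCartan_add_two,
        quantumNumber_add_two (q + 2) (altCartan ρ s t q),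
        quantumNumber_add_two (q + 1) (altCartan ρ s t q) (altCartan ρ s t (q + 1))]
      module
  exact (key q).1

/-- At length `m - 1` the coefficients are `[m] = 0` and `[m - 1] = 1`. The second equation is the
balancedness of the realization. -/
theorem altCoroot_eq_coroot (hb : ρ.IsBalanced) {s t : B} (hst : s ≠ t) {q : ℕ}
    (hq : M.M s t = q + 2) : altCoroot ρ s t (q + 1) = ρ.coroot s := by
  have hq' : M.M t s = q + 2 := (M.symmetric t s).trans hq
  rw [altCoroot_eq]
  by_cases h : Even q
  · have e1 : altCartan ρ s t q = -ρ.coroot s (ρ.root t) := by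
      simp [altCartan, altLetter, h, parity_simps]
    have e2 : altCartan ρ s t (q + 1) = -ρ.coroot t (ρ.root s) := by
      simp [altCartan, altLetter, h, parity_simps]
    have h1 := ρ.quantum_eq_zero s t hst (by omega)
    have h2 := hb s t hst (by omega)
    rw [hq] at h1 h2
    rw [e1, e2, h1, show q + 1 = q + 2 - 1 by omega, h2]
    simp
  · have e1 : altCartan ρ s t q = -ρ.coroot t (ρ.root s) := by
      simp [altCartan, altLetter, h, parity_simps]
    have e2 : altCartan ρ s t (q + 1) = -ρ.coroot s (ρ.root t) := by
      simp [altCartan, altLetter, h, parity_simps]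
    have h1 := ρ.quantum_eq_zero t s hst.symm (by omega)
    have h2 := hb t s hst.symm (by omega)
    rw [hq'] at h1 h2
    rw [e1, e2, h1, show q + 1 = q + 2 - 1 by omega, h2]
    simp

/-- Moving a linear form through the operators produces, by the Leibniz rule, one term for each
omitted letter. Omitting an inner letter leaves some `∂_a ∂_a = 0`, so only the omissions of the
first and of the last letter survive. -/
theorem demWord_alternatingWord_ι_mul (s t : B) (q : ℕ) (v : V) (f : ρ.Poly) :
    demWord hf (alternatingWord s t (q + 2)) (SymmetricAlgebra.ι k V v * f) =
      SymmetricAlgebra.ι k V (ρ.rep (cs.wordProd (alternatingWord s t (q + 2))) v) *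
        demWord hf (alternatingWord s t (q + 2)) f +
      algebraMap k _ (altCoroot ρ s t (q + 1) v) * demWord hf (alternatingWord s t (q + 1)) f +
      algebraMap k _ (ρ.coroot t v) * demWord hf (alternatingWord t s (q + 1)) f := by
  have hk : ∀ (a : B) (r : k) (g : ρ.Poly),
      dem hf a (algebraMap k _ r * g) = algebraMap k _ r * dem hf a g := by
    intro a r g
    rw [← Algebra.smul_def, map_smul, Algebra.smul_def]
  induction q with
  | zero =>
    have e1 : alternatingWord s t 2 = [s, t] := rfl
    have e2 : alternatingWord s t 1 = [t] := rfl
    have e3 : alternatingWord t s 1 = [s] := rfl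
    have e4 : ∀ (a : B) (g : ρ.Poly), demWord hf [a] g = dem hf a g := fun a g => by simp [demWord]
    simp only [zero_add, e1, e2, e3, e4, demWord_cons hf s [t], dem_mul, dem_ι, act_ι, map_add, hk,
      wordProd_cons, wordProd_nil, mul_one, map_mul, Module.End.mul_apply, altCoroot,
      LinearMap.comp_apply, altLetter]
    simp [parity_simps]
    ring
  | succ q ih =>
    rw [alternatingWord_cons s t (q + 2), demWord_cons, ih, map_add, map_add, hk, hk, dem_mul, dem_ι,
      act_ι, demWord_cons]
    have e1 : dem hf (altLetter s t (q + 2)) (demWord hf (alternatingWord s t (q + 1)) f) = 0 := by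
      rw [alternatingWord_cons, demWord_cons, altLetter_add_two, dem_dem]
    have e2 : dem hf (altLetter s t (q + 2)) (demWord hf (alternatingWord t s (q + 1)) f) =
        demWord hf (alternatingWord t s (q + 2)) f := by
      rw [alternatingWord_cons t s (q + 1), demWord_cons, altLetter_add_two, altLetter_succ_swap]
    rw [e1, e2, wordProd_cons, map_mul, Module.End.mul_apply]
    rw [show q + 1 + 1 = q + 2 by ring]
    simp only [altCoroot, LinearMap.comp_apply]
    ring

theorem demWord_one {ω : List B} (h : ω ≠ []) : demWord hf ω 1 = 0 := by
  obtain ⟨ω', a, rfl⟩ := List.eq_nil_or_concat ω |>.resolve_left h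
  have : dem hf a 1 = 0 := by rw [dem_eq_zero_iff, map_one]
  rw [List.concat_eq_append, demWord_append]
  simp [demWord, this]

/-- For the two braid words the two surviving Leibniz terms are the same up to order. Hence the
difference `D` of the two operators satisfies `D(g f) = w(g) D(f)` for all `g`, and it vanishes
because `D(1) = 0`. -/
theorem demWord_braidWord (hb : ρ.IsBalanced) {s t : B} (hst : s ≠ t) (hM : M.M s t ≠ 0) :
    demWord hf (braidWord M s t) = demWord hf (braidWord M t s) := by
  have h1 := M.off_diagonal s t hst
  obtain ⟨q, hq⟩ : ∃ q, M.M s t = q + 2 := ⟨M.M s t - 2, by omega⟩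
  have hq' : M.M t s = q + 2 := (M.symmetric t s).trans hq
  have hw := cs.wordProd_braidWord_eq s t
  rw [braidWord, braidWord, hq, hq'] at hw ⊢
  set D := demWord hf (alternatingWord s t (q + 2)) - demWord hf (alternatingWord t s (q + 2))
    with hD
  have hι : ∀ v f, D (SymmetricAlgebra.ι k V v * f) = ρ.act (cs.wordProd (alternatingWord s t (q + 2)))
      (SymmetricAlgebra.ι k V v) * D f := by
    intro v f
    rw [hD, LinearMap.sub_apply, LinearMap.sub_apply, demWord_alternatingWord_ι_mul,
      demWord_alternatingWord_ι_mul, altCoroot_eq_coroot hb hst hq,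
      altCoroot_eq_coroot hb hst.symm hq', ← hw, act_ι]
    ring
  have hmul : ∀ g f, D (g * f) = ρ.act (cs.wordProd (alternatingWord s t (q + 2))) g * D f := by
    intro g
    induction g using SymmetricAlgebra.induction with
    | algebraMap r =>
      intro f
      rw [AlgHom.commutes, ← Algebra.smul_def, map_smul, Algebra.smul_def]
    | ι v => exact hι v
    | mul a b ha hb => intro f; rw [mul_assoc, ha, hb, map_mul, mul_assoc]
    | add a b ha hb => intro f; rw [add_mul, map_add, ha, hb, map_add, add_mul]
  have h1' : D 1 = 0 := by
    rw [hD, LinearMap.sub_apply, demWord_one, demWord_one, sub_zero] <;>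
      · rw [alternatingWord_cons]; simp
  rw [← sub_eq_zero, ← hD]
  ext f
  have := hmul f 1
  rw [mul_one, h1', mul_zero] at this
  rw [this]; rfl

/-! ### Demazure operators of group elements -/

/-- The Demazure operator `∂_w` as a linear map. -/
def demElt (hf : ρ.IsFaithful) (w : W) : Module.End k ρ.Poly :=
  demWord hf (cs.exists_isReduced w).choose

theorem demazure_eq (w : W) (f : ρ.Poly) : ρ.demazure w f = demElt hf w f := by
  rw [demazure, demElt]
  generalize (cs.exists_isReduced w).choose = ω
  induction ω with
  | nil => simp [demWord]
  | cons s ω ih => rw [List.foldr_cons, ih, demWord_cons]; rfl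

variable (hb : ρ.IsBalanced)
include hb

/-- By Matsumoto's theorem the choice of reduced word hidden in `demElt` is immaterial. -/
theorem demElt_wordProd {ω : List B} (hω : cs.IsReduced ω) :
    demElt hf (cs.wordProd ω) = demWord hf ω := by
  obtain ⟨h1, h2⟩ := (cs.exists_isReduced (cs.wordProd ω)).choose_spec
  exact matsumoto cs (dem hf) (fun s t hst hM => demWord_braidWord hf hb hst hM) h1 hω h2.symm

theorem demElt_one : demElt hf (1 : W) = 1 := by
  have := demElt_wordProd hf hb (ω := []) (cs := cs) (by simp [CoxeterSystem.IsReduced])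
  simpa [demWord] using this

theorem demElt_simple (s : B) : demElt hf (cs.simple s) = dem hf s := by
  have := demElt_wordProd hf hb (ω := [s]) (cs := cs) (by simp [CoxeterSystem.IsReduced])
  simpa [demWord] using this

theorem dem_demElt (s : B) (v : W) (f : ρ.Poly) : dem hf s (demElt hf v f) =
    if cs.length (cs.simple s * v) = cs.length v + 1 then demElt hf (cs.simple s * v) f else 0 := by
  have main : ∀ v, cs.length (cs.simple s * v) = cs.length v + 1 → ∀ f,
      dem hf s (demElt hf v f) = demElt hf (cs.simple s * v) f := by
    intro v h f
    obtain ⟨ω, hω, rfl⟩ := cs.exists_isReduced v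
    rw [← wordProd_cons, demElt_wordProd hf hb hω, demElt_wordProd hf hb, demWord_cons]
    rw [CoxeterSystem.IsReduced, wordProd_cons, h, hω.eq]; simp
  split_ifs with h
  · exact main v h f
  · have h' := (cs.length_simple_mul v s).resolve_left h
    have := main (cs.simple s * v) (by rw [simple_mul_simple_cancel_left]; omega) f
    rw [simple_mul_simple_cancel_left] at this
    rw [← this, dem_dem]

/-- The nil Coxeter relations: as soon as a letter fails to raise the length, a factor `∂_s ∂_s = 0`
appears. -/
theorem demElt_demElt (w v : W) (f : ρ.Poly) : demElt hf w (demElt hf v f) =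
    if cs.length (w * v) = cs.length w + cs.length v then demElt hf (w * v) f else 0 := by
  obtain ⟨ω, hω, rfl⟩ := cs.exists_isReduced w
  induction ω using List.reverseRecOn generalizing v with
  | nil => simp [demElt_one hf hb]
  | append_singleton ω s ih =>
    have hω' : cs.IsReduced ω := by simpa using hω.take ω.length
    have ih := fun v => ih v hω'
    rw [demElt_wordProd hf hb hω'] at ih
    rw [demElt_wordProd hf hb hω, demWord_append, show demWord hf [s] = dem hf s by simp [demWord],
      dem_demElt hf hb, hω.eq]
    have e : cs.wordProd (ω ++ [s]) * v = cs.wordProd ω * (cs.simple s * v) := by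
      simp [wordProd_append, mul_assoc]
    rw [e]
    have hle := cs.length_mul_le (cs.wordProd ω) (cs.simple s * v)
    rw [hω'.eq] at hle
    have hl : (ω ++ [s]).length = ω.length + 1 := by simp
    split_ifs with h h2 h2
    · rw [ih, hω'.eq, if_pos (by omega)]
    · rw [ih, hω'.eq, if_neg (by omega)]
    · have := cs.length_simple_mul v s
      omega
    · rw [map_zero]

theorem demElt_mul_of_length {w v : W} (h : cs.length (w * v) = cs.length w + cs.length v)
    (f : ρ.Poly) : demElt hf w (demElt hf v f) = demElt hf (w * v) f := by
  rw [demElt_demElt hf hb, if_pos h]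

end Realization

namespace Realization

variable {B : Type uB} {W : Type uW} [Group W] {M : CoxeterMatrix B} {cs : CoxeterSystem M W}
  {k : Type uk} [Field k] {V : Type uV} [AddCommGroup V] [Module k V]
  {ρ : Realization cs k V}

open CoxeterSystem

/-! ### Invariants and traces -/

theorem mem_inv_iff (hf : ρ.IsFaithful) {I : Set B} {f : ρ.Poly} :
    f ∈ ρ.inv I ↔ ∀ s ∈ I, dem hf s f = 0 := by
  constructor
  · intro h s hs
    exact (dem_eq_zero_iff hf).2 (h _ (simple_mem_parabolic cs hs))
  · intro h w hw
    obtain ⟨ω, -, rfl, hI⟩ := exists_isReduced_of_mem_parabolic cs hw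
    induction ω with
    | nil => simp [act_one]
    | cons s ω ih =>
      have hI' : ∀ i ∈ ω, i ∈ I := fun i hi => hI i (by simp [hi])
      rw [wordProd_cons, act_mul, ih hI' (wordProd_mem_parabolic cs hI')]
      exact (dem_eq_zero_iff hf).1 (h s (hI s (by simp)))

variable (hf : ρ.IsFaithful) (hb : ρ.IsBalanced)
include hf hb

theorem demElt_mul_left {J : Set B} {w : W} (hw : w ∈ parabolic cs J) {a : ρ.Poly}
    (ha : a ∈ ρ.inv J) (f : ρ.Poly) : demElt hf w (a * f) = a * demElt hf w f := by
  obtain ⟨ω, hω, rfl, hJ⟩ := exists_isReduced_of_mem_parabolic cs hw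
  rw [demElt_wordProd hf hb hω]
  clear hω hw
  induction ω with
  | nil => simp [demWord]
  | cons s ω ih =>
    rw [demWord_cons, demWord_cons, ih fun i hi => hJ i (by simp [hi]),
      dem_mul_of_act_eq hf (ha _ (simple_mem_parabolic cs (hJ s (by simp))))]

/-- The operator applied first is some `∂_s` with `s ∈ I`, which already kills `f`. -/
theorem demElt_mul_of_inv {I : Set B} {v u : W} (hu : u ∈ parabolic cs I) (hu1 : u ≠ 1)
    (hl : cs.length (v * u) = cs.length v + cs.length u) {f : ρ.Poly} (h : f ∈ ρ.inv I) :
    demElt hf (v * u) f = 0 := by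
  rw [← demElt_mul_of_length hf hb hl]
  obtain ⟨ω, hω, rfl, hI⟩ := exists_isReduced_of_mem_parabolic cs hu
  have hne : ω ≠ [] := by rintro rfl; simp at hu1
  obtain ⟨ω', s, rfl⟩ := List.eq_nil_or_concat ω |>.resolve_left hne
  rw [demElt_wordProd hf hb hω, List.concat_eq_append, demWord_append]
  have : demWord hf [s] f = 0 := by
    simpa [demWord] using (mem_inv_iff hf).1 h s (hI s (by simp))
  rw [this, map_zero, map_zero]

theorem demElt_longest_mem {J : Set B} (hJ : Finitary cs J) (f : ρ.Poly) :
    demElt hf (longest cs J) f ∈ ρ.inv J := by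
  rw [mem_inv_iff hf]
  intro s hs
  rw [dem_demElt hf hb, if_neg]
  have := length_le_parLength hJ (mul_mem (simple_mem_parabolic cs hs) (longest_mem hJ))
  rw [parLength] at this
  omega

omit hb in
theorem trace_eq (I J : Set B) (f : ρ.Poly) :
    ρ.trace I J f = demElt hf (longest cs J * (longest cs I)⁻¹) f := demazure_eq hf _ f

theorem trace_demElt_longest {I J : Set B} (hJ : Finitary cs J) (h : I ⊆ J) (f : ρ.Poly) :
    ρ.trace I J (demElt hf (longest cs I) f) = demElt hf (longest cs J) f := by
  rw [trace_eq hf, demElt_mul_of_length hf hb, inv_mul_cancel_right]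
  rw [inv_mul_cancel_right]
  exact (length_longest_mul_longest_inv hJ h).symm

theorem trace_trace {I J K : Set B} (hK : Finitary cs K) (h : I ⊆ J) (h' : J ⊆ K) (f : ρ.Poly) :
    ρ.trace J K (ρ.trace I J f) = ρ.trace I K f := by
  have e : longest cs K * (longest cs J)⁻¹ * (longest cs J * (longest cs I)⁻¹) =
      longest cs K * (longest cs I)⁻¹ := by group
  rw [trace_eq hf, trace_eq hf, trace_eq hf, demElt_mul_of_length hf hb, e]
  rw [e]
  have h1 := length_longest_mul_longest_inv hK (h.trans h')
  have h2 := length_longest_mul_longest_inv hK h'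
  have h3 := length_longest_mul_longest_inv (hK.mono h') h
  omega

theorem trace_mul_left {I J : Set B} (hJ : Finitary cs J) (h : I ⊆ J) {a : ρ.Poly}
    (ha : a ∈ ρ.inv J) (f : ρ.Poly) : ρ.trace I J (a * f) = a * ρ.trace I J f := by
  rw [trace_eq hf, trace_eq hf]
  exact demElt_mul_left hf hb (mul_mem (longest_mem hJ)
    (inv_mem (parabolic_mono cs h (longest_mem (hJ.mono h))))) ha f

omit hb in
theorem exists_demElt_longest (hs : ρ.GenDemazureSurjective) {I : Set B} (hI : Finitary cs I)
    {f : ρ.Poly} (h : f ∈ ρ.inv I) : ∃ g, demElt hf (longest cs I) g = f := by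
  obtain ⟨g, hg⟩ := hs I hI f h
  exact ⟨g, by rw [← demazure_eq, hg]⟩

/-- Surjectivity writes `f` as `∂_{w_I} g`, and its trace is then `∂_{w_J} g`, which every `∂_s`
with `s ∈ J` kills. -/
theorem trace_mem (hs : ρ.GenDemazureSurjective) {I J : Set B} (hJ : Finitary cs J) (h : I ⊆ J)
    {f : ρ.Poly} (hfI : f ∈ ρ.inv I) : ρ.trace I J f ∈ ρ.inv J := by
  obtain ⟨g, rfl⟩ := exists_demElt_longest hf hs (hJ.mono h) hfI
  rw [trace_demElt_longest hf hb hJ h]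
  exact demElt_longest_mem hf hb hJ g

/-- For `s ∈ J` one has `∂_{w_J} = ∂_{w_J s} ∂_s`, and `∂_s (f ∂_s g)` is symmetric in `f` and `g`.
Moving the letters of `u` across one by one reverses their order. -/
theorem demElt_longest_adjoint {J : Set B} (hJ : Finitary cs J) {u : W} (hu : u ∈ parabolic cs J)
    (f g : ρ.Poly) : demElt hf (longest cs J) (f * demElt hf u g) =
      demElt hf (longest cs J) (demElt hf u⁻¹ f * g) := by
  have simp_adj : ∀ s ∈ J, ∀ f g, demElt hf (longest cs J) (f * dem hf s g) =
      demElt hf (longest cs J) (dem hf s f * g) := by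
    intro s hs f g
    have key : ∀ h, demElt hf (longest cs J) h =
        demElt hf (longest cs J * cs.simple s) (dem hf s h) := by
      intro h
      rw [← demElt_simple hf hb, demElt_mul_of_length hf hb, mul_assoc, simple_mul_simple_self, mul_one]
      have := length_longest_mul hJ (simple_mem_parabolic cs hs)
      rw [simple_mul_simple_cancel_right, length_simple]
      rw [length_simple] at this
      exact this.symm
    rw [key, key, dem_mul_dem_comm]
  obtain ⟨ω, hω, rfl, hI⟩ := exists_isReduced_of_mem_parabolic cs hu
  clear hu
  induction ω generalizing f with
  | nil => simp [demElt_one hf hb]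
  | cons s ω ih =>
    have hω' : cs.IsReduced ω := by simpa using hω.drop 1
    rw [demElt_wordProd hf hb hω, demWord_cons, ← demElt_wordProd hf hb hω', simp_adj s (hI s (by simp)),
      ih _ hω' fun i hi => hI i (by simp [hi]), ← demElt_simple hf hb, demElt_mul_of_length hf hb,
      wordProd_cons, mul_inv_rev, inv_simple]
    rw [← inv_simple cs s, ← mul_inv_rev, ← wordProd_cons, length_inv, length_inv, length_inv, hω.eq, hω'.eq,
      length_simple]
    simp

/-! ### Grading -/

omit hf hb

/-- The algebra map that multiplies a homogeneous element of polynomial degree `n` by `X ^ n`. -/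
def gradHom (ρ : Realization cs k V) : ρ.Poly →ₐ[k] Polynomial ρ.Poly :=
  SymmetricAlgebra.lift ((Polynomial.monomial 1).restrictScalars k ∘ₗ SymmetricAlgebra.ι k V)

theorem gradHom_ι (v : V) : gradHom ρ (SymmetricAlgebra.ι k V v) =
    Polynomial.monomial 1 (SymmetricAlgebra.ι k V v) := by
  simp [gradHom]

/-- The homogeneous component of polynomial degree `n`. -/
def hcomp (ρ : Realization cs k V) (n : ℕ) (f : ρ.Poly) : ρ.Poly := (gradHom ρ f).coeff n

theorem hcomp_add (n : ℕ) (f g : ρ.Poly) : hcomp ρ n (f + g) = hcomp ρ n f + hcomp ρ n g := by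
  simp [hcomp]

theorem hcomp_sub (n : ℕ) (f g : ρ.Poly) : hcomp ρ n (f - g) = hcomp ρ n f - hcomp ρ n g := by
  simp [hcomp]

theorem hcomp_zero (n : ℕ) : hcomp ρ n (0 : ρ.Poly) = 0 := by
  simp [hcomp]

theorem hcomp_one : hcomp ρ 0 (1 : ρ.Poly) = 1 := by
  simp [hcomp]

/-- `f` is homogeneous of polynomial degree `n`. -/
def IsHomog (ρ : Realization cs k V) (n : ℕ) (f : ρ.Poly) : Prop :=
  f ∈ (LinearMap.range (SymmetricAlgebra.ι k V)) ^ n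

theorem IsHomog.gradHom_eq {n : ℕ} {f : ρ.Poly} (h : IsHomog ρ n f) :
    gradHom ρ f = Polynomial.monomial n f := by
  let S : ℕ → Submodule k ρ.Poly := fun n =>
    LinearMap.ker ((gradHom ρ).toLinearMap - (Polynomial.monomial n).restrictScalars k)
  have hS : ∀ n (f : ρ.Poly), f ∈ S n ↔ gradHom ρ f = Polynomial.monomial n f := by
    intro n f
    simp [S, sub_eq_zero]
  have key : ∀ n, (LinearMap.range (SymmetricAlgebra.ι k V)) ^ n ≤ S n := by
    intro n
    induction n with
    | zero =>
      rw [pow_zero, Submodule.one_le, hS]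
      simp
    | succ n ih =>
      rw [pow_succ, Submodule.mul_le]
      rintro f hf' _ ⟨v, rfl⟩
      rw [hS, map_mul, (hS n f).1 (ih hf'), gradHom_ι, Polynomial.monomial_mul_monomial]
  exact (hS n f).1 (key n h)

theorem isHomog_hcomp (n : ℕ) (f : ρ.Poly) : IsHomog ρ n (hcomp ρ n f) := by
  induction f using SymmetricAlgebra.induction generalizing n with
  | algebraMap r =>
    rw [hcomp, AlgHom.commutes, Polynomial.algebraMap_apply, Polynomial.coeff_C]
    split_ifs with h
    · rw [IsHomog, h, pow_zero]; exact Submodule.algebraMap_mem r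
    · exact zero_mem _
  | ι v =>
    rw [hcomp, gradHom_ι, Polynomial.coeff_monomial]
    split_ifs with h
    · rw [IsHomog, ← h, pow_one]; exact ⟨v, rfl⟩
    · exact zero_mem _
  | mul f g hf hg =>
    rw [hcomp, map_mul, Polynomial.coeff_mul]
    refine Submodule.sum_mem _ fun p hp => ?_
    rw [← Finset.HasAntidiagonal.mem_antidiagonal.1 hp, pow_add]
    exact Submodule.mul_mem_mul (hf _) (hg _)
  | add f g hf hg => rw [hcomp_add]; exact add_mem (hf n) (hg n)

theorem gradHom_injective : Function.Injective (gradHom ρ) := by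
  have : ∀ f : ρ.Poly, (Polynomial.aeval (1 : ρ.Poly)) (gradHom ρ f) = f := by
    intro f
    induction f using SymmetricAlgebra.induction with
    | algebraMap r => simp
    | ι v => rw [gradHom_ι]; simp
    | mul f g hf hg => rw [map_mul, map_mul, hf, hg]
    | add f g hf hg => rw [map_add, map_add, hf, hg]
  exact Function.LeftInverse.injective this

theorem hcomp_of_isHomog {n : ℕ} {f : ρ.Poly} (h : IsHomog ρ n f) (m : ℕ) :
    hcomp ρ m f = if n = m then f else 0 := by
  rw [hcomp, h.gradHom_eq, Polynomial.coeff_monomial]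

theorem hcomp_mul_of_isHomog {a : ℕ} {c : ρ.Poly} (h : IsHomog ρ a c) (b : ℕ) (f : ρ.Poly) :
    hcomp ρ (b + a) (f * c) = hcomp ρ b f * c := by
  rw [hcomp, map_mul, h.gradHom_eq, Polynomial.coeff_mul_monomial, hcomp]

theorem gradHom_act (w : W) (f : ρ.Poly) :
    gradHom ρ (ρ.act w f) = Polynomial.map (ρ.act w : ρ.Poly →+* ρ.Poly) (gradHom ρ f) := by
  induction f using SymmetricAlgebra.induction with
  | algebraMap r => simp
  | ι v => rw [act_ι, gradHom_ι, gradHom_ι]; simp [act_ι]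
  | mul f g hf hg => rw [map_mul, map_mul, map_mul, hf, hg, Polynomial.map_mul]
  | add f g hf hg => rw [map_add, map_add, map_add, hf, hg, Polynomial.map_add]

theorem hcomp_act (n : ℕ) (w : W) (f : ρ.Poly) : hcomp ρ n (ρ.act w f) = ρ.act w (hcomp ρ n f) := by
  rw [hcomp, gradHom_act, Polynomial.coeff_map]; rfl

theorem hcomp_mem_inv (n : ℕ) {I : Set B} {f : ρ.Poly} (h : f ∈ ρ.inv I) :
    hcomp ρ n f ∈ ρ.inv I := fun w hw => by rw [← hcomp_act, h w hw]

include hf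

theorem hcomp_dem (n : ℕ) (s : B) (f : ρ.Poly) :
    hcomp ρ n (dem hf s f) = dem hf s (hcomp ρ (n + 1) f) := by
  symm
  apply eq_dem_of_alpha_mul
  have h1 : IsHomog ρ 1 (ρ.alpha s) := by rw [IsHomog, pow_one]; exact ⟨_, rfl⟩
  rw [mul_comm, ← hcomp_mul_of_isHomog h1, mul_comm, alpha_mul_dem, hcomp_sub, hcomp_act]

include hb

theorem hcomp_demElt (n : ℕ) (w : W) (f : ρ.Poly) :
    hcomp ρ n (demElt hf w f) = demElt hf w (hcomp ρ (n + cs.length w) f) := by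
  obtain ⟨ω, hω, rfl⟩ := cs.exists_isReduced w
  rw [demElt_wordProd hf hb hω, hω.eq]
  clear hω
  induction ω generalizing n with
  | nil => simp [demWord]
  | cons s ω ih =>
    rw [demWord_cons, demWord_cons, hcomp_dem, ih, List.length_cons]
    congr 3
    omega

theorem isHomog_demElt {n : ℕ} {w : W} {f : ρ.Poly} (h : IsHomog ρ (n + cs.length w) f) :
    IsHomog ρ n (demElt hf w f) := by
  have := isHomog_hcomp n (demElt hf w f)
  rwa [hcomp_demElt hf hb, hcomp_of_isHomog h, if_pos rfl] at this

theorem demElt_eq_zero_of_isHomog {n : ℕ} {w : W} {f : ρ.Poly} (h : IsHomog ρ n f)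
    (hn : n < cs.length w) : demElt hf w f = 0 := by
  apply gradHom_injective
  rw [map_zero]
  ext1 m
  change hcomp ρ m _ = _
  rw [hcomp_demElt hf hb, hcomp_of_isHomog h, if_neg (by omega), map_zero, Polynomial.coeff_zero]

/-! ### Dual bases -/

theorem exists_isHomog_demElt_longest (hs : ρ.GenDemazureSurjective) {J : Set B}
    (hJ : Finitary cs J) :
    ∃ P, IsHomog ρ (parLength cs J) P ∧ demElt hf (longest cs J) P = 1 := by
  obtain ⟨g, hg⟩ := exists_demElt_longest hf hs hJ (one_mem (ρ.inv J))
  refine ⟨hcomp ρ (parLength cs J) g, isHomog_hcomp _ _, ?_⟩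
  have := hcomp_demElt hf hb 0 (longest cs J) g
  rwa [zero_add, hg, hcomp_one, eq_comm] at this

/-- Descending induction on `ℓ(u)` shows `∂_u f = 0`. The longer operators vanish on `f` by
induction, so `∂_u f` is `W_J`-invariant, comes out of `∂_{w_J}(P ∂_u f)`, and is itself the value
of this pairing. -/
theorem eq_zero_of_demElt_pairing {J : Set B} (hJ : Finitary cs J) {P : ρ.Poly}
    (hP : demElt hf (longest cs J) P = 1) {f : ρ.Poly}
    (h : ∀ u ∈ parabolic cs J, demElt hf (longest cs J) (P * demElt hf u f) = 0) : f = 0 := by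
  have key : ∀ n, ∀ u ∈ parabolic cs J, parLength cs J - cs.length u = n → demElt hf u f = 0 := by
    intro n
    induction n using Nat.strong_induction_on with
    | _ n ih =>
      intro u hu hn
      have hinv : demElt hf u f ∈ ρ.inv J := by
        rw [mem_inv_iff hf]
        intro s hs
        rw [dem_demElt hf hb]
        split_ifs with hl
        · have hmem := mul_mem (simple_mem_parabolic cs hs) hu
          have := length_le_parLength hJ hmem
          exact ih _ (by omega) _ hmem rfl
        · rfl
      have := h u hu
      rwa [mul_comm, demElt_mul_left hf hb (longest_mem hJ) hinv, hP, mul_one] at this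
  have := key _ 1 (one_mem _) rfl
  rwa [demElt_one hf hb] at this

end Realization

/-! ### Traces between rings of invariants and existence of homogeneous dual bases -/

namespace Realization

variable {B : Type uB} {W : Type uW} [Group W] {M : CoxeterMatrix B} {cs : CoxeterSystem M W}
  {k : Type uk} [Field k] {V : Type uV} [AddCommGroup V] [Module k V]
  {ρ : Realization cs k V}

open CoxeterSystem

/-- The inclusion `R^J ⊆ R^I` for `I ⊆ J`. -/
def inclInv (ρ : Realization cs k V) {I J : Set B} (h : I ⊆ J) : ρ.inv J →+* ρ.inv I :=
  (Subalgebra.inclusion (ρ.inv_anti h)).toRingHom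

theorem coe_inclInv {I J : Set B} (h : I ⊆ J) (f : ρ.inv J) : (inclInv ρ h f : ρ.Poly) = f := rfl

/-- The trace as an additive map `R^I → R^J`. -/
def traceInv (hρ : ρ.IsAdmissible) {I J : Set B} (hJ : Finitary cs J) (h : I ⊆ J) :
    ρ.inv I →+ ρ.inv J where
  toFun f := ⟨ρ.trace I J f, trace_mem hρ.faithful hρ.balanced hρ.demazureSurjective hJ h f.2⟩
  map_zero' := by
    ext
    simp only [ZeroMemClass.coe_zero]
    rw [trace_eq hρ.faithful, map_zero]
  map_add' f g := by
    ext
    simp only [AddMemClass.coe_add]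
    rw [trace_eq hρ.faithful, trace_eq hρ.faithful, trace_eq hρ.faithful, map_add]

variable (hρ : ρ.IsAdmissible)

theorem coe_traceInv {I J : Set B} (hJ : Finitary cs J) (h : I ⊆ J) (f : ρ.inv I) :
    (traceInv hρ hJ h f : ρ.Poly) = ρ.trace I J f := rfl

theorem traceInv_mul {I J : Set B} (hJ : Finitary cs J) (h : I ⊆ J) (a : ρ.inv J) (f : ρ.inv I) :
    traceInv hρ hJ h (inclInv ρ h a * f) = a * traceInv hρ hJ h f :=
  Subtype.ext (trace_mul_left hρ.faithful hρ.balanced hJ h a.2 f)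

theorem traceInv_traceInv {I J K : Set B} (hK : Finitary cs K) (h : I ⊆ J) (h' : J ⊆ K)
    (f : ρ.inv I) : traceInv hρ hK h' (traceInv hρ (hK.mono h') h f) =
      traceInv hρ hK (h.trans h') f :=
  Subtype.ext (trace_trace hρ.faithful hρ.balanced hK h h' f)

/-- Pairing with `d` reads off coefficients, whence uniqueness; nondegeneracy of the pairing with
`d` gives spanning. -/
theorem isBasisOver_of_dual {I J : Set B} (hJ : Finitary cs J) (h : I ⊆ J) {n : ℕ}
    {c d : Fin n → ρ.inv I}
    (hcd : ∀ i j, traceInv hρ hJ h (c i * d j) = if i = j then 1 else 0)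
    (hd : ∀ g, (∀ j, traceInv hρ hJ h (g * d j) = 0) → g = 0) : ρ.IsBasisOver I J c := by
  intro f
  have coef : ∀ (a : Fin n → ρ.inv J) j,
      traceInv hρ hJ h ((∑ i, inclInv ρ h (a i) * c i) * d j) = a j := by
    intro a j
    rw [Finset.sum_mul, map_sum]
    simp only [mul_assoc, traceInv_mul, hcd]
    simp
  have coe : ∀ (a : Fin n → ρ.inv J), ((∑ i, inclInv ρ h (a i) * c i : ρ.inv I) : ρ.Poly) =
      ∑ i, (a i : ρ.Poly) * (c i : ρ.Poly) := by
    intro a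
    simp [coe_inclInv]
  refine ⟨fun j => traceInv hρ hJ h (f * d j), ?_, ?_⟩
  · beta_reduce
    rw [← coe]
    refine congrArg Subtype.val (sub_eq_zero.1 (hd _ fun j => ?_))
    rw [sub_mul, map_sub, coef, sub_self]
  · intro a ha
    rw [← coe] at ha
    have := Subtype.ext ha
    funext j
    rw [this, coef]

include hρ in
/-- `R^I` has homogeneous dual bases over `R^J`. -/
theorem exists_isDualBases {I J : Set B} (hJ : Finitary cs J) (h : I ⊆ J) :
    ∃ (n : ℕ) (c d : Fin n → ρ.inv I) (a b : Fin n → ℕ), ρ.IsDualBases I J c d ∧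
      (∀ i, IsHomog ρ (a i) (c i : ρ.Poly)) ∧ (∀ i, IsHomog ρ (b i) (d i : ρ.Poly)) ∧
      ∀ i, a i + b i = parLength cs J - parLength cs I := by
  have hf := hρ.faithful
  have hb := hρ.balanced
  obtain ⟨P, hPh, hP⟩ := exists_isHomog_demElt_longest hf hb hρ.demazureSurjective hJ
  have hI := hJ.mono h
  have hfin : Finite (parabolic cs J) := hJ
  -- The basis is indexed by the minimal representatives `v` of `W_J / W_I`. Its members are `∂_{v⁻¹
  -- w_J} P`, of degree `ℓ(v)`.
  have : Finite {v // v ∈ parabolic cs J ∧ IsMinRep cs I v} :=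
    Finite.of_injective (fun x => (⟨x.1, x.2.1⟩ : parabolic cs J)) fun x y hxy => by
      simpa [Subtype.ext_iff] using hxy
  obtain ⟨n, ⟨e⟩⟩ := Finite.exists_equiv_fin {v // v ∈ parabolic cs J ∧ IsMinRep cs I v}
  let v : Fin n → W := fun i => (e.symm i).1
  have hvJ : ∀ i, v i ∈ parabolic cs J := fun i => (e.symm i).2.1
  have hvm : ∀ i, IsMinRep cs I (v i) := fun i => (e.symm i).2.2
  have hvinj : ∀ i j, v i = v j → i = j := fun i j hij =>
    e.symm.injective (Subtype.ext hij)
  have hvsurj : ∀ x ∈ parabolic cs J, IsMinRep cs I x → ∃ i, v i = x := fun x hx hm =>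
    ⟨e ⟨x, hx, hm⟩, by simp [v]⟩
  have hlI : ∀ i, cs.length (v i) + parLength cs I ≤ parLength cs J := by
    intro i
    rw [parLength, ← (hvm i).length_mul (longest_mem hI)]
    exact length_le_parLength hJ (mul_mem (hvJ i) (parabolic_mono cs h (longest_mem hI)))
  have hlw : ∀ i, cs.length ((v i)⁻¹ * longest cs J) + cs.length (v i) = parLength cs J := by
    intro i
    have := length_mul_longest hJ (inv_mem (hvJ i))
    rwa [cs.length_inv] at this
  -- the basis
  let c : Fin n → ρ.inv I := fun i => ⟨demElt hf ((v i)⁻¹ * longest cs J) P, by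
    rw [mem_inv_iff hf]
    intro s hs
    -- Since `v s` is longer than `v`, the element `s v⁻¹ w_J` is shorter than `v⁻¹ w_J`.
    rw [dem_demElt hf hb, if_neg]
    rw [← mul_assoc, ← inv_simple, ← mul_inv_rev]
    have h1 := length_mul_longest hJ (inv_mem (mul_mem (hvJ i)
      (parabolic_mono cs h (simple_mem_parabolic cs hs))))
    have h2 := (hvm i).length_mul (simple_mem_parabolic cs hs)
    rw [cs.length_inv, h2, length_simple] at h1
    have h3 := hlw i
    omega⟩
  have hc : ∀ i, IsHomog ρ (cs.length (v i)) (c i : ρ.Poly) := by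
    intro i
    apply isHomog_demElt hf hb
    rw [add_comm, hlw]
    exact hPh
  -- By adjointness, pairing with this element under the trace is the functional `g ↦ ∂_{w_J}(P ∂_v
  -- g)`.
  let p : Fin n → ρ.inv I := fun i => ⟨demElt hf (longest cs I) (demElt hf (v i)⁻¹ P),
    demElt_longest_mem hf hb hI _⟩
  have hp : ∀ i (g : ρ.inv I), (traceInv hρ hJ h (p i * g) : ρ.Poly) =
      demElt hf (longest cs J) (P * demElt hf (v i) g) := by
    intro i g
    rw [coe_traceInv, MulMemClass.coe_mul, mul_comm, ← demElt_mul_left hf hb (longest_mem hI) g.2,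
      trace_demElt_longest hf hb hJ h, mul_comm, ← demElt_longest_adjoint hf hb hJ (hvJ i)]
  -- Minimal representatives suffice to detect `g ∈ R^I`: if `u = x y` with `y ≠ 1` in `W_I`, then
  -- `∂_u g = 0`.
  have hpnd : ∀ g, (∀ i, traceInv hρ hJ h (p i * g) = 0) → g = 0 := by
    intro g hg
    apply Subtype.ext
    refine eq_zero_of_demElt_pairing hf hb hJ hP fun u hu => ?_
    obtain ⟨x, hx, y, hy, rfl⟩ := exists_isMinRep cs I u
    by_cases hy1 : y = 1
    · subst hy1
      rw [mul_one] at hu ⊢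
      obtain ⟨i, rfl⟩ := hvsurj x hu hx
      rw [← hp, hg]; rfl
    · rw [demElt_mul_of_inv hf hb hy hy1 (hx.length_mul hy) g.2, mul_zero, map_zero]
  -- the matrix of pairings is unitriangular
  let E : Matrix (Fin n) (Fin n) (ρ.inv J) := fun i j => traceInv hρ hJ h (p i * c j)
  have hE1 : ∀ i, E i i = 1 := by
    intro i
    apply Subtype.ext
    change (traceInv hρ hJ h (p i * c i) : ρ.Poly) = 1
    rw [hp]
    change demElt hf (longest cs J) (P * demElt hf (v i) (demElt hf ((v i)⁻¹ * longest cs J) P)) = 1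
    rw [demElt_mul_of_length hf hb, mul_inv_cancel_left, hP, mul_one, hP]
    rw [mul_inv_cancel_left]
    have := hlw i
    rw [parLength] at this
    omega
  -- The entry contains `∂_{v_i} ∂_{v_j⁻¹ w_J}`. Additive lengths would give `v_i v_j⁻¹ w_J` length
  -- at least `ℓ(J)`, whereas its length is `ℓ(J) - ℓ(v_i v_j⁻¹) < ℓ(J)`.
  have hE0 : ∀ i j, i ≠ j → cs.length (v j) ≤ cs.length (v i) → E i j = 0 := by
    intro i j hij hle
    apply Subtype.ext
    change (traceInv hρ hJ h (p i * c j) : ρ.Poly) = 0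
    rw [hp]
    change demElt hf (longest cs J) (P * demElt hf (v i) (demElt hf ((v j)⁻¹ * longest cs J) P)) = 0
    rw [demElt_demElt hf hb, if_neg, mul_zero, map_zero]
    have h1 := length_mul_longest hJ (mul_mem (hvJ i) (inv_mem (hvJ j)))
    rw [mul_assoc] at h1
    have h2 := hlw j
    have h3 : cs.length (v i * (v j)⁻¹) ≠ 0 := by
      rw [Ne, length_eq_zero_iff, mul_inv_eq_one]
      exact fun h => hij (hvinj i j h)
    omega
  have hdet : E.det = 1 := by
    have htri : E.BlockTriangular (fun i => cs.length (v i)) := by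
      intro i j hij
      exact hE0 i j (by rintro rfl; exact lt_irrefl _ hij) hij.le
    rw [htri.det]
    refine Finset.prod_eq_one fun l _ => ?_
    have : E.toSquareBlock (fun i => cs.length (v i)) l = 1 := by
      ext1 i j
      rw [Matrix.toSquareBlock_def, Matrix.of_apply, Matrix.one_apply]
      split_ifs with hij
      · rw [hij, hE1]
      · exact hE0 _ _ (fun h' => hij (Subtype.ext h')) (j.2.trans i.2.symm).le
    rw [this, Matrix.det_one]
  have hEinv : E⁻¹ * E = 1 := Matrix.nonsing_inv_mul E (by rw [hdet]; exact isUnit_one)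
  have hEinv' : E * E⁻¹ = 1 := Matrix.mul_nonsing_inv E (by rw [hdet]; exact isUnit_one)
  -- Applying the inverse of the pairing matrix to `p` gives a family dual to `c`.
  let d₀ : Fin n → ρ.inv I := fun i => ∑ j, inclInv ρ h (E⁻¹ i j) * p j
  have hd₀ : ∀ i g, traceInv hρ hJ h (d₀ i * g) = ∑ j, E⁻¹ i j * traceInv hρ hJ h (p j * g) := by
    intro i g
    simp only [d₀, Finset.sum_mul, map_sum, mul_assoc, traceInv_mul]
  have hd₀c : ∀ i j, traceInv hρ hJ h (d₀ i * c j) = if i = j then 1 else 0 := by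
    intro i j
    rw [hd₀, ← Matrix.one_apply, ← hEinv, Matrix.mul_apply]
  have hd₀nd : ∀ g, (∀ i, traceInv hρ hJ h (g * d₀ i) = 0) → g = 0 := by
    intro g hg
    refine hpnd g fun i => ?_
    have : traceInv hρ hJ h (p i * g) = ∑ j, E i j * traceInv hρ hJ h (d₀ j * g) := by
      simp only [hd₀, Finset.mul_sum, ← mul_assoc]
      rw [Finset.sum_comm]
      simp only [← Finset.sum_mul, ← Matrix.mul_apply, hEinv', Matrix.one_apply]
      simp
    rw [this]
    exact Finset.sum_eq_zero fun j _ => by rw [mul_comm (d₀ j), hg, mul_zero]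
  have hcb : ρ.IsBasisOver I J c := isBasisOver_of_dual hρ hJ h (d := d₀) (fun i j => by
    rw [mul_comm, hd₀c]; simp only [eq_comm]) hd₀nd
  have hcnd : ∀ g, (∀ i, traceInv hρ hJ h (g * c i) = 0) → g = 0 := by
    intro g hg
    refine hpnd g fun i => ?_
    obtain ⟨a, ha, -⟩ := hcb (p i)
    have : p i = ∑ j, inclInv ρ h (a j) * c j := by
      apply Subtype.ext
      rw [ha]
      simp [coe_inclInv]
    rw [this, Finset.sum_mul, map_sum]
    refine Finset.sum_eq_zero fun j _ => ?_
    rw [mul_assoc, traceInv_mul, mul_comm (c j), hg, mul_zero]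
  -- the dual basis is made homogeneous
  let N := parLength cs J - parLength cs I
  have hN : cs.length (longest cs J * (longest cs I)⁻¹) = N := by
    have := length_longest_mul_longest_inv hJ h
    omega
  let b : Fin n → ℕ := fun i => N - cs.length (v i)
  let d : Fin n → ρ.inv I := fun i => ⟨hcomp ρ (b i) (d₀ i), hcomp_mem_inv _ (d₀ i).2⟩
  -- The trace lowers degree by `N`, so pairing the component of degree `b i` of `d₀ i` with `c j`
  -- gives the component of degree `b i + ℓ(v_j) - N` of the constant `δ_ij`. For `i = j` this
  -- degree is 0, and for negative degrees the pairing vanishes.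
  have hdc : ∀ i j, traceInv hρ hJ h (d i * c j) = if i = j then 1 else 0 := by
    intro i j
    apply Subtype.ext
    have e0 := congrArg Subtype.val (hd₀c i j)
    rw [coe_traceInv, MulMemClass.coe_mul, trace_eq hf] at e0 ⊢
    change demElt hf _ (hcomp ρ (b i) (d₀ i) * (c j : ρ.Poly)) = _
    rw [← hcomp_mul_of_isHomog (hc j)]
    have hle : cs.length (v i) ≤ N := by have := hlI i; omega
    by_cases hlt : b i + cs.length (v j) < N
    · rw [demElt_eq_zero_of_isHomog hf hb (isHomog_hcomp _ _) (by rw [hN]; exact hlt), if_neg]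
      · rfl
      · rintro rfl
        simp only [b] at hlt
        omega
    · obtain ⟨m, hm⟩ := Nat.exists_eq_add_of_le (not_lt.1 hlt)
      rw [hm, add_comm N m, ← hN, ← hcomp_demElt hf hb, e0]
      split_ifs with hij
      · subst hij
        have : m = 0 := by simp only [b] at hm; omega
        rw [this]
        exact hcomp_one
      · exact hcomp_zero _
  refine ⟨n, c, d, fun i => cs.length (v i), b, ⟨hcb, ?_, ?_⟩, hc, fun i => isHomog_hcomp _ _, fun i => ?_⟩
  · exact isBasisOver_of_dual hρ hJ h hdc hcnd
  · intro i j
    have := congrArg Subtype.val (hdc j i)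
    rw [coe_traceInv, mul_comm, MulMemClass.coe_mul] at this
    rw [this]
    simp only [eq_comm (a := i)]
    split_ifs <;> rfl
  · have := hlI i
    simp only [b]
    omega

end Realization

/-! ### The element and the lengths attached to the long side of a switchback relation -/

section SwitchbackElements

variable {B : Type uB} {W : Type uW} [Group W] {M : CoxeterMatrix B} {cs : CoxeterSystem M W}

open Letter

theorem wordElt_append (I : Set B) (a b : Word B) :
    wordElt cs I (a ++ b) = wordElt cs I a * wordElt cs (region I a) b := by
  induction a generalizing I with
  | nil => simp [wordElt, region]
  | cons l a ih =>
    cases l with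
    | up s => simp only [List.cons_append, wordElt, ih, region_cons, stepRegion, mul_assoc]
    | dn s => rw [List.cons_append, wordElt, ih, wordElt, region_cons, stepRegion]

theorem wordLength_append (I : Set B) (a b : Word B) :
    wordLength cs I (a ++ b) = wordLength cs I a + wordLength cs (region I a) b := by
  induction a generalizing I with
  | nil => simp [wordLength, region]
  | cons l a ih =>
    cases l with
    | up s => rw [List.cons_append, wordLength, ih, wordLength, region_cons, stepRegion, add_assoc]
    | dn s => rw [List.cons_append, wordLength, ih, wordLength, region_cons, stepRegion]

namespace IsAdmissibleSeq

variable {L : Set B} {d : ℕ} {u : ℕ → B}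

/-- The product of the `w_{L \ u_i} w_{L \ u_i u_{i+1}}⁻¹` for `i < n`. -/
def traceElt (cs : CoxeterSystem M W) (L : Set B) (u : ℕ → B) : ℕ → W
  | 0 => 1
  | n + 1 => traceElt cs L u n *
      (longest cs (L \ {u n}) * (longest cs ((L \ {u n}) \ {u (n + 1)}))⁻¹)

/-- The sum of the `ℓ(L \ u_i) - ℓ(L \ u_i u_{i+1})` for `i < n`. -/
def traceLength (cs : CoxeterSystem M W) (L : Set B) (u : ℕ → B) : ℕ → ℕ
  | 0 => 0
  | n + 1 => traceLength cs L u n +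
      (parLength cs (L \ {u n}) - parLength cs ((L \ {u n}) \ {u (n + 1)}))

theorem diff_diff_subset (L : Set B) (u : ℕ → B) (i : ℕ) :
    (L \ {u i}) \ {u (i + 1)} ⊆ L \ {u (i + 1)} :=
  fun _ hx => ⟨hx.1.1, hx.2⟩

variable (h : IsAdmissibleSeq cs L d u)
include h

theorem finitary_diff (i : ℕ) : Finitary cs (L \ {u i}) := h.finitary.mono Set.sdiff_subset

theorem finitary_diff_diff (i j : ℕ) : Finitary cs ((L \ {u i}) \ {u j}) :=
  (h.finitary_diff i).mono Set.sdiff_subset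

theorem wordElt_longWord_succ {n : ℕ} (hn : n < d) :
    wordElt cs (L \ {u 0}) (longWord u (n + 1)) = wordElt cs (L \ {u 0}) (longWord u n) *
      ((longest cs ((L \ {u n}) \ {u (n + 1)}))⁻¹ * longest cs (L \ {u (n + 1)})) := by
  rw [longWord, wordElt_append, h.region_longWord hn.le]
  simp [wordElt, h.insert_pair_left hn]

theorem wordLength_longWord_succ {n : ℕ} (hn : n < d) :
    wordLength cs (L \ {u 0}) (longWord u (n + 1)) = wordLength cs (L \ {u 0}) (longWord u n) +
      (parLength cs (L \ {u (n + 1)}) - parLength cs ((L \ {u n}) \ {u (n + 1)})) := by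
  rw [longWord, wordLength_append, h.region_longWord hn.le]
  simp [wordLength, h.insert_pair_left hn]

/-- One alternating product of longest elements, bracketed in two ways: by upward steps for the
expression, by downward steps for the traces. -/
theorem traceElt_mul_longest {n : ℕ} (hn : n ≤ d) : traceElt cs L u n * longest cs (L \ {u n}) =
    longest cs (L \ {u 0}) * wordElt cs (L \ {u 0}) (longWord u n) := by
  induction n with
  | zero => simp [traceElt, longWord, wordElt]
  | succ n ih =>
    rw [h.wordElt_longWord_succ hn, ← mul_assoc (longest cs (L \ {u 0})), ← ih (by omega), traceElt]
    group

theorem parLength_diff_diff_le (n : ℕ) :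
    parLength cs ((L \ {u n}) \ {u (n + 1)}) ≤ parLength cs (L \ {u n}) := by
  have := length_longest_mul_longest_inv (h.finitary_diff n)
    (Set.sdiff_subset : (L \ {u n}) \ {u (n + 1)} ⊆ _)
  omega

theorem traceLength_add {n : ℕ} (hn : n ≤ d) :
    (traceLength cs L u n : ℤ) + parLength cs (L \ {u n}) =
      parLength cs (L \ {u 0}) + wordLength cs (L \ {u 0}) (longWord u n) := by
  induction n with
  | zero => simp [traceLength, longWord, wordLength]
  | succ n ih =>
    have := ih (by omega)
    have := h.parLength_diff_diff_le n
    rw [h.wordLength_longWord_succ hn, traceLength]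
    omega

theorem length_traceElt_succ_le (n : ℕ) : cs.length (traceElt cs L u (n + 1)) ≤
    cs.length (traceElt cs L u n) +
      (parLength cs (L \ {u n}) - parLength cs ((L \ {u n}) \ {u (n + 1)})) := by
  have h1 := length_longest_mul_longest_inv (h.finitary_diff n)
    (Set.sdiff_subset : (L \ {u n}) \ {u (n + 1)} ⊆ _)
  have h2 := cs.length_mul_le (traceElt cs L u n)
    (longest cs (L \ {u n}) * (longest cs ((L \ {u n}) \ {u (n + 1)}))⁻¹)
  rw [traceElt]
  omega

theorem length_traceElt_le (n : ℕ) : cs.length (traceElt cs L u n) ≤ traceLength cs L u n := by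
  induction n with
  | zero => simp [traceElt]
  | succ n ih =>
    have := h.length_traceElt_succ_le n
    rw [traceLength]
    omega

theorem length_wordElt_le {n : ℕ} (hn : n ≤ d) :
    (cs.length (wordElt cs (L \ {u 0}) (longWord u n)) : ℤ) ≤
      wordLength cs (L \ {u 0}) (longWord u n) := by
  induction n with
  | zero => simp [longWord, wordElt, wordLength]
  | succ n ih =>
    have h0 := ih (by omega)
    have h1 := length_longest_inv_mul_longest (h.finitary_diff (n + 1)) (diff_diff_subset L u n)
    have h2 := cs.length_mul_le (wordElt cs (L \ {u 0}) (longWord u n))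
      ((longest cs ((L \ {u n}) \ {u (n + 1)}))⁻¹ * longest cs (L \ {u (n + 1)}))
    rw [h.wordElt_longWord_succ hn, h.wordLength_longWord_succ hn]
    omega

theorem traceElt_mem (n : ℕ) : traceElt cs L u n ∈ parabolic cs L := by
  induction n with
  | zero => exact one_mem _
  | succ n ih =>
    exact mul_mem ih (mul_mem
      (parabolic_mono cs Set.sdiff_subset (longest_mem (h.finitary_diff n)))
      (inv_mem (parabolic_mono cs (Set.sdiff_subset.trans Set.sdiff_subset)
        (longest_mem (h.finitary_diff_diff n (n + 1))))))

end IsAdmissibleSeq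

namespace IsSwitchback

variable {L : Set B} {d : ℕ} {u : ℕ → B} (h : IsSwitchback cs L d u)
include h

open IsAdmissibleSeq

theorem length_longExpr : cs.length (traceElt cs L u d * longest cs (L \ {u d})) =
    traceLength cs L u d + parLength cs (L \ {u d}) := by
  have h1 := h.braidRelated.2.1
  have h2 := h.seq.traceLength_add le_rfl
  have h3 : h.seq.longExpr.elt = traceElt cs L u d * longest cs (L \ {u d}) :=
    (h.seq.traceElt_mul_longest le_rfl).symm
  rw [Expr.IsReduced, h3] at h1
  change _ = (parLength cs (L \ {u 0}) : ℤ) + wordLength cs (L \ {u 0}) (longWord u d) at h1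
  omega

/-- The long expression expresses the longest element `w_L`. -/
theorem traceElt_mul_longest : traceElt cs L u d * longest cs (L \ {u d}) = longest cs L := by
  have hl := h.length_longExpr
  set x := traceElt cs L u d * longest cs (L \ {u d}) with hx
  have hL := h.seq.finitary
  have hxz := h.seq.traceElt_mul_longest le_rfl
  rw [← hx] at hxz
  have hz1 := h.seq.length_wordElt_le le_rfl
  set z := wordElt cs (L \ {u 0}) (longWord u d) with hz
  have hz2 := h.seq.traceLength_add le_rfl
  have hy := h.seq.length_traceElt_le d
  have hxL : x ∈ parabolic cs L := mul_mem (h.seq.traceElt_mem d)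
    (parabolic_mono cs Set.sdiff_subset (longest_mem (h.seq.finitary_diff d)))
  have hmem : longest cs L ∈ DoubleCoset.doubleCoset x (parabolic cs (L \ {u 0}) : Set W)
      (parabolic cs (L \ {u d}) : Set W) := by
    have h1 := h.braidRelated.2.2
    have h3 : h.seq.longExpr.elt = x := hxz.symm
    have h4 : h.seq.shortExpr.elt = longest cs L := by
      simp [Expr.elt, shortExpr, wordElt, h.seq.insert_diff (Nat.zero_le d)]
    rw [Expr.coset, Expr.coset, h3, h4] at h1
    rw [← h1]
    exact DoubleCoset.mem_doubleCoset_self _ _ _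
  -- The hypothesis only gives `w_L = a x b`. On one side `ℓ(x b) = ℓ(L) - ℓ(a)` and `ℓ(a x) = ℓ(L)
  -- - ℓ(b)`. On the other side `x` ends in `w_{L \ u_d}` and begins with `w_{L \ u_0}` with
  -- additive lengths, so these equal `ℓ(x) - ℓ(b)` and `ℓ(x) - ℓ(a)`. Adding up, `ℓ(x) = ℓ(L)`, and
  -- `w_L` is the only element of `W_L` of this length.
  obtain ⟨a, ha, b, hb, e⟩ := DoubleCoset.mem_doubleCoset.1 hmem
  have haL : a ∈ parabolic cs L := parabolic_mono cs Set.sdiff_subset ha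
  have hbL : b ∈ parabolic cs L := parabolic_mono cs Set.sdiff_subset hb
  have e1 : x * b = a⁻¹ * longest cs L := by rw [e]; group
  have e2 : a * x = longest cs L * b⁻¹ := by rw [e]; group
  have l1 := length_mul_longest hL (inv_mem haL)
  have l2 := length_longest_mul hL (inv_mem hbL)
  rw [← e1, cs.length_inv] at l1
  rw [← e2, cs.length_inv] at l2
  have m1 : cs.length (x * b) + cs.length b ≤ cs.length x := by
    have := length_longest_mul (h.seq.finitary_diff d) hb
    have := cs.length_mul_le (traceElt cs L u d) (longest cs (L \ {u d}) * b)
    rw [← mul_assoc, ← hx] at this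
    omega
  have m2 : cs.length (a * x) + cs.length a ≤ cs.length x := by
    have := length_mul_longest (h.seq.finitary_diff 0) ha
    have := cs.length_mul_le (a * longest cs (L \ {u 0})) z
    rw [mul_assoc, ← hxz] at this
    omega
  have m3 := cs.length_le_length_mul_add_right x b
  have m4 := cs.length_le_length_mul_add_left a x
  exact eq_longest hL hxL (by omega)

theorem traceElt_eq : traceElt cs L u d = longest cs L * (longest cs (L \ {u d}))⁻¹ :=
  eq_mul_inv_of_mul_eq h.traceElt_mul_longest

theorem traceLength_add_parLength :
    traceLength cs L u d + parLength cs (L \ {u d}) = parLength cs L := by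
  rw [← h.length_longExpr, h.traceElt_mul_longest, parLength]

/-- Length is subadditive at each step and the bound is attained at the end by reducedness, so it is
attained for every prefix. -/
theorem length_traceElt {n : ℕ} (hn : n ≤ d) :
    cs.length (traceElt cs L u n) = traceLength cs L u n := by
  induction hn using Nat.decreasingInduction with
  | self =>
    have h1 := h.length_longExpr
    have h2 := cs.length_mul_le (traceElt cs L u d) (longest cs (L \ {u d}))
    have h3 := h.seq.length_traceElt_le d
    rw [← parLength] at h2
    omega
  | of_succ n hn ih =>
    have h1 := h.seq.length_traceElt_succ_le n
    have h2 := h.seq.length_traceElt_le n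
    rw [traceLength] at ih
    omega

end IsSwitchback

end SwitchbackElements

/-! ### Iterated traces -/

section IteratedTrace

variable {B : Type uB} {W : Type uW} [Group W] {M : CoxeterMatrix B} {cs : CoxeterSystem M W}
  {k : Type uk} [Field k] {V : Type uV} [AddCommGroup V] [Module k V]
  {ρ : Realization cs k V} {L : Set B} {d : ℕ} {u : ℕ → B}

open Realization

namespace IsAdmissibleSeq

/-- The trace `R^{L \ u_{n+1}} ⊆ R^{L \ u_n u_{n+1}} → R^{L \ u_n}`. -/
def stepTrace (h : IsAdmissibleSeq cs L d u) (hρ : ρ.IsAdmissible) (n : ℕ) :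
    ρ.inv (L \ {u (n + 1)}) →+ ρ.inv (L \ {u n}) :=
  (traceInv hρ (h.finitary_diff n) Set.sdiff_subset).comp
    (inclInv ρ (diff_diff_subset L u n)).toAddMonoidHom

/-- The composition of the traces `R^{L \ u_n} → ⋯ → R^{L \ u_0}`. -/
def iterTrace (h : IsAdmissibleSeq cs L d u) (hρ : ρ.IsAdmissible) :
    (n : ℕ) → ρ.inv (L \ {u n}) →+ ρ.inv (L \ {u 0})
  | 0 => AddMonoidHom.id _
  | n + 1 => (iterTrace h hρ n).comp (h.stepTrace hρ n)

theorem iterTrace_succ (h : IsAdmissibleSeq cs L d u) (hρ : ρ.IsAdmissible) (n : ℕ)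
    (f : ρ.inv (L \ {u (n + 1)})) :
    h.iterTrace hρ (n + 1) f = h.iterTrace hρ n (h.stepTrace hρ n f) := rfl

theorem stepTrace_mul (h : IsAdmissibleSeq cs L d u) (hρ : ρ.IsAdmissible) (n : ℕ) (a : ρ.inv L)
    (f : ρ.inv (L \ {u (n + 1)})) :
    h.stepTrace hρ n (inclInv ρ Set.sdiff_subset a * f) =
      inclInv ρ Set.sdiff_subset a * h.stepTrace hρ n f :=
  traceInv_mul hρ (h.finitary_diff n) Set.sdiff_subset (inclInv ρ Set.sdiff_subset a)
    (inclInv ρ (diff_diff_subset L u n) f)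

theorem iterTrace_mul (h : IsAdmissibleSeq cs L d u) (hρ : ρ.IsAdmissible) (n : ℕ) (a : ρ.inv L)
    (f : ρ.inv (L \ {u n})) :
    h.iterTrace hρ n (inclInv ρ Set.sdiff_subset a * f) =
      inclInv ρ Set.sdiff_subset a * h.iterTrace hρ n f := by
  induction n with
  | zero => rfl
  | succ n ih => rw [iterTrace_succ, stepTrace_mul, ih, iterTrace_succ]

end IsAdmissibleSeq

-- The point where reducedness is used: since the lengths add up, the composite of traces is a
-- single Demazure operator rather than zero, and its index `w_L w_{L \ u_d}⁻¹` is that of the trace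
-- to `R^L`.
open IsAdmissibleSeq in
theorem IsSwitchback.iterTrace_eq (h : IsSwitchback cs L d u) (hρ : ρ.IsAdmissible)
    (f : ρ.inv (L \ {u d})) : h.seq.iterTrace hρ d f =
      inclInv ρ Set.sdiff_subset (traceInv hρ h.seq.finitary Set.sdiff_subset f) := by
  have key : ∀ n, n ≤ d → ∀ f : ρ.inv (L \ {u n}),
      (h.seq.iterTrace hρ n f : ρ.Poly) = demElt hρ.faithful (traceElt cs L u n) f := by
    intro n hn
    induction n with
    | zero =>
      intro f
      rw [traceElt, demElt_one hρ.faithful hρ.balanced]; rfl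
    | succ n ih =>
      intro f
      rw [iterTrace_succ, ih (by omega), traceElt]
      change demElt hρ.faithful _ (ρ.trace _ _ (f : ρ.Poly)) = _
      rw [trace_eq hρ.faithful, demElt_mul_of_length hρ.faithful hρ.balanced]
      rw [← traceElt, h.length_traceElt hn, h.length_traceElt (by omega), traceLength]
      have := length_longest_mul_longest_inv (h.seq.finitary_diff n)
        (Set.sdiff_subset : (L \ {u n}) \ {u (n + 1)} ⊆ _)
      omega
  apply Subtype.ext
  rw [key d le_rfl, coe_inclInv, coe_traceInv, trace_eq hρ.faithful, h.traceElt_eq]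

end IteratedTrace

/-! ### Linear structure of 2-morphisms and the movement of polynomials -/

section DiagramCalculus

variable {B : Type uB} {W : Type uW} [Group W] {M : CoxeterMatrix B} {cs : CoxeterSystem M W}
  {k : Type uk} [Field k] {V : Type uV} [AddCommGroup V] [Module k V]

open Letter

namespace TwoHom

variable {ρ : Realization cs k V} {I₀ : Set B}

theorem comp_assoc {w₁ w₂ w₃ w₄ : Word B} (φ : TwoHom ρ I₀ w₁ w₂) (ψ : TwoHom ρ I₀ w₂ w₃)
    (χ : TwoHom ρ I₀ w₃ w₄) : (φ.comp ψ).comp χ = φ.comp (ψ.comp χ) := by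
  obtain ⟨φ⟩ := φ; obtain ⟨ψ⟩ := ψ; obtain ⟨χ⟩ := χ
  exact sound (Rel.comp_assoc φ ψ χ)

theorem id_comp {w w' : Word B} (φ : TwoHom ρ I₀ w w') : (mk (.id w)).comp φ = φ := by
  obtain ⟨φ⟩ := φ; exact sound (Rel.id_comp φ)

theorem comp_id {w w' : Word B} (φ : TwoHom ρ I₀ w w') : φ.comp (mk (.id w')) = φ := by
  obtain ⟨φ⟩ := φ; exact sound (Rel.comp_id φ)

/-- Composition below with a fixed 2-morphism, as an additive map. -/
def compLeft {w w' w'' : Word B} (φ : TwoHom ρ I₀ w w') :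
    TwoHom ρ I₀ w' w'' →+ TwoHom ρ I₀ w w'' :=
  AddMonoidHom.mk' φ.comp (by
    rintro ⟨ψ⟩ ⟨ψ'⟩; obtain ⟨φ⟩ := φ; exact sound (Rel.comp_add φ ψ ψ'))

/-- Composition above with a fixed 2-morphism, as an additive map. -/
def compRight {w w' w'' : Word B} (ψ : TwoHom ρ I₀ w' w'') :
    TwoHom ρ I₀ w w' →+ TwoHom ρ I₀ w w'' :=
  AddMonoidHom.mk' (fun φ => φ.comp ψ) (by
    rintro ⟨φ⟩ ⟨φ'⟩; obtain ⟨ψ⟩ := ψ; exact sound (Rel.add_comp φ φ' ψ))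

theorem comp_sum {w w' w'' : Word B} {ι : Type*} (s : Finset ι) (φ : TwoHom ρ I₀ w w')
    (ψ : ι → TwoHom ρ I₀ w' w'') : φ.comp (∑ i ∈ s, ψ i) = ∑ i ∈ s, φ.comp (ψ i) :=
  map_sum (compLeft φ) ψ s

theorem sum_comp {w w' w'' : Word B} {ι : Type*} (s : Finset ι) (φ : ι → TwoHom ρ I₀ w w')
    (ψ : TwoHom ρ I₀ w' w'') : (∑ i ∈ s, φ i).comp ψ = ∑ i ∈ s, (φ i).comp ψ :=
  map_sum (compRight ψ) φ s

theorem mk_sum {w w' : Word B} {n : ℕ} (φ : Fin n → Term ρ I₀ w w') :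
    mk (Term.sum φ) = ∑ i, mk (φ i) := by
  have : ∀ l : List (Term ρ I₀ w w'), mk (l.foldr .add (.zero w w')) = (l.map mk).sum := by
    intro l
    induction l with
    | nil => rfl
    | cons φ l ih => rw [List.map_cons, List.sum_cons, ← ih]; rfl
  rw [Term.sum, this, List.map_ofFn, List.sum_ofFn]; rfl

/-- The 2-morphism given by the polynomial `f` in the region between `a` and `b`. -/
def box (a b : Word B) {w : Word B} {I : Set B} (hI : Finitary cs I) (f : ρ.inv I)
    (ha : region I₀ a = I) (hw : w = a ++ b) : TwoHom ρ I₀ w w := mk (.box a b hI f ha hw)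

/-- The 2-morphism given by a generator between vertical strands. -/
def layer {w w' : Word B} (a b : Word B) {J : Set B} {x y : Word B} (g : Gen ρ J x y)
    (hJ : region I₀ a = J) (hw : w = a ++ x ++ b) (hw' : w' = a ++ y ++ b) : TwoHom ρ I₀ w w' :=
  mk (.layer a b g hJ hw hw')

theorem box_congr {a b a' b' : Word B} {w : Word B} {I I' : Set B} {hI : Finitary cs I}
    {hI' : Finitary cs I'} {f : ρ.inv I} {f' : ρ.inv I'} {ha : region I₀ a = I} {hw : w = a ++ b}
    (ha' : region I₀ a' = I') (hw' : w = a' ++ b') (haa : a = a')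
    (hff : (f : ρ.Poly) = f') : box a b hI f ha hw = box a' b' hI' f' ha' hw' := by
  subst haa
  have hb : b = b' := List.append_cancel_left (hw.symm.trans hw')
  subst hb
  have hI : I = I' := ha.symm.trans ha'
  subst hI
  have : f = f' := Subtype.ext hff
  subst this
  rfl

section

variable {a b : Word B} {w : Word B} {I : Set B} {hI : Finitary cs I} {ha : region I₀ a = I}
  {hw : w = a ++ b}

theorem box_add (f g : ρ.inv I) : box a b hI (f + g) ha hw = box a b hI f ha hw + box a b hI g ha hw :=
  sound (Rel.poly_add a b hI f g)

theorem box_mul (f g : ρ.inv I) :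
    box a b hI (f * g) ha hw = (box a b hI f ha hw).comp (box a b hI g ha hw) :=
  sound (Rel.poly_mul a b hI f g)

theorem box_one : box a b hI (1 : ρ.inv I) ha hw = mk (.id w) := by
  rw [← map_one (algebraMap k (ρ.inv I))]
  exact sound ((Rel.poly_scalar a b hI 1).trans (Rel.one_smul _))

theorem box_sum {ι : Type*} (s : Finset ι) (f : ι → ρ.inv I) :
    box a b hI (∑ i ∈ s, f i) ha hw = ∑ i ∈ s, box a b hI (f i) ha hw :=
  map_sum (AddMonoidHom.mk' (fun f => box a b hI f ha hw) box_add) f s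

end

/-- A polynomial is a generator with empty boundary, so the interchange law carries it past any
generator to its right. The surrounding words are variables subject to equations, so that
differently bracketed concatenations can be matched. -/
theorem box_comp_layer_left (a m b : Word B) {a' b' b'' : Word B} {w w' : Word B} {I J : Set B}
    {y y' : Word B} {hI : Finitary cs I} {f : ρ.inv I} {ha : region I₀ a = I} {hw : w = a ++ b'}
    (g : Gen ρ J y y') {hJ : region I₀ a' = J} {hy : w = a' ++ y ++ b} {hy' : w' = a' ++ y' ++ b}
    (ha' : a' = a ++ m) (hw' : w' = a ++ b'') :
    (box a b' hI f ha hw).comp (layer a' b g hJ hy hy') =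
      (layer a' b g hJ hy hy').comp (box a b'' hI f ha hw') := by
  subst ha'
  obtain rfl : b' = m ++ y ++ b :=
    List.append_cancel_left (as := a) (hw.symm.trans (hy.trans (by simp)))
  obtain rfl : b'' = m ++ y' ++ b :=
    List.append_cancel_left (as := a) (hw'.symm.trans (hy'.trans (by simp)))
  have := Rel.interchange (ρ := ρ) (I₀ := I₀) a m b (.poly hI f) g (w := w) (w₁ := w) (w₂ := w')
    (w' := w') (h₁ := ha) (h₂ := by simpa using hw) (h₃ := by simpa using hw)
    (h₄ := by simpa using hJ) (h₅ := by simpa using hy) (h₆ := by simpa using hy')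
    (h₇ := by simpa using hJ) (h₈ := by simpa using hy) (h₉ := by simpa using hy')
    (h₁₀ := ha) (h₁₁ := by simpa using hw') (h₁₂ := by simpa using hw')
  simp only [List.append_nil] at this
  exact sound this

theorem box_comp_layer_right (a m b : Word B) {a₁ a₂ b' : Word B} {w w' : Word B} {I J : Set B}
    {x x' : Word B} {hI : Finitary cs I} {f : ρ.inv I} {ha₁ : region I₀ a₁ = I} {hw : w = a₁ ++ b}
    (g : Gen ρ J x x') {hJ : region I₀ a = J} {hx : w = a ++ x ++ b'} {hx' : w' = a ++ x' ++ b'}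
    (e₁ : a₁ = a ++ x ++ m) (e₂ : a₂ = a ++ x' ++ m) (ha₂ : region I₀ a₂ = I)
    (hw' : w' = a₂ ++ b) :
    (box a₁ b hI f ha₁ hw).comp (layer a b' g hJ hx hx') =
      (layer a b' g hJ hx hx').comp (box a₂ b hI f ha₂ hw') := by
  subst e₁
  subst e₂
  obtain rfl : b' = m ++ b :=
    List.append_cancel_left (as := a ++ x) (hx.symm.trans (hw.trans (by simp)))
  have := Rel.interchange (ρ := ρ) (I₀ := I₀) a m b g (.poly hI f) (w := w) (w₁ := w') (w₂ := w)
    (w' := w') (h₁ := hJ) (h₂ := by simpa using hx) (h₃ := by simpa using hx')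
    (h₄ := ha₂) (h₅ := by simpa using hx') (h₆ := by simpa using hx')
    (h₇ := ha₁) (h₈ := by simpa using hx) (h₉ := by simpa using hx)
    (h₁₀ := hJ) (h₁₁ := by simpa using hx) (h₁₂ := by simpa using hx')
  simp only [List.append_nil] at this
  exact (sound this).symm

theorem box_slide_up (a b : Word B) {w : Word B} {I J : Set B} {s : B} {hI : Finitary cs I}
    {hJ : Finitary cs J} (f : ρ.inv I) (f' : ρ.inv J) (hs : s ∉ I)
    (hff' : (f : ρ.Poly) = f') {ha : region I₀ a = I} {ha' : region I₀ (a ++ [up s]) = J}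
    {hw : w = a ++ ([up s] ++ b)} {hw' : w = a ++ [up s] ++ b} :
    box a ([up s] ++ b) hI f ha hw = box (a ++ [up s]) b hJ f' ha' hw' := by
  obtain rfl : J = insert s I := by
    rw [← ha', region_append, ha]; rfl
  exact sound (Rel.poly_slide a b hs hI hJ f f' hff')

/-- Sliding is imposed only across upward strands. Bend the downward strand into a zigzag, let the
polynomial cross its upward segment, and straighten it again. -/
theorem box_slide_dn (a b : Word B) {w : Word B} {I J : Set B} {s : B} {hI : Finitary cs I}
    {hJ : Finitary cs J} (f : ρ.inv J) (f' : ρ.inv I) (hs : s ∈ I)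
    (hff' : (f : ρ.Poly) = f') {ha : region I₀ a = I} {ha' : region I₀ (a ++ [dn s]) = J}
    {hw : w = a ++ ([dn s] ++ b)} {hw' : w = a ++ [dn s] ++ b} :
    box a ([dn s] ++ b) hI f' ha hw = box (a ++ [dn s]) b hJ f ha' hw' := by
  have hsJ : s ∉ J := by
    rw [← ha', region_append, ha]; simp [region, stepRegion]
  obtain rfl : I = insert s J := by
    rw [← ha', region_append, ha]; simp [region, stepRegion, Set.insert_eq_of_mem hs]
  have hr : region I₀ (a ++ [dn s] ++ [up s]) = insert s J := by
    rw [region_append, ha']; rfl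
  set cup := layer (w := w) (w' := a ++ [dn s, up s, dn s] ++ b) a ([dn s] ++ b)
    (Gen.ccwCup (ρ := ρ) hsJ hI) ha (by simp [hw]) (by simp) with hcup
  set cap := layer (w := a ++ [dn s, up s, dn s] ++ b) (w' := w) (a ++ [dn s]) b
    (Gen.cwCap (ρ := ρ) hsJ hI) ha' (by simp) (by simp [hw]) with hcap
  have hz : cup.comp cap = mk (.id w) := sound (Rel.zigzag_dn_right a b hsJ hI)
  calc box a ([dn s] ++ b) hI f' ha hw
      = (box a ([dn s] ++ b) hI f' ha hw).comp (cup.comp cap) := by rw [hz, comp_id]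
    _ = (cup.comp (box (a ++ [dn s] ++ [up s]) ([dn s] ++ b) hI f' hr (by simp))).comp cap := by
        rw [← comp_assoc, hcup, box_comp_layer_right a [] ([dn s] ++ b)]
        all_goals simp
    _ = (cup.comp (box (a ++ [dn s]) ([up s] ++ ([dn s] ++ b)) hJ f ha' (by simp))).comp cap := by
        rw [box_slide_up (a ++ [dn s]) ([dn s] ++ b) f f' hsJ hff']
    _ = (cup.comp cap).comp (box (a ++ [dn s]) b hJ f ha' hw') := by
        rw [comp_assoc, hcap, box_comp_layer_left (a ++ [dn s]) [] b, comp_assoc]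
        simp
    _ = box (a ++ [dn s]) b hJ f ha' hw' := by rw [hz, id_comp]

end TwoHom

end DiagramCalculus

/-! ### Identities for dual bases and traces -/

section DualBases

variable {B : Type uB} {W : Type uW} [Group W] {M : CoxeterMatrix B} {cs : CoxeterSystem M W}
  {k : Type uk} [Field k] {V : Type uV} [AddCommGroup V] [Module k V]
  {ρ : Realization cs k V}

namespace Realization

variable (hρ : ρ.IsAdmissible) {I J : Set B} (hJ : Finitary cs J) (h : I ⊆ J) {n : ℕ}
  {c d : Fin n → ρ.inv I}

theorem IsDualBases.traceInv_mul (hcd : ρ.IsDualBases I J c d) (i j : Fin n) :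
    traceInv hρ hJ h (c i * d j) = if i = j then 1 else 0 := by
  refine Subtype.ext ((hcd.2.2 i j).trans ?_)
  split_ifs <;> rfl

theorem IsDualBases.symm (hcd : ρ.IsDualBases I J c d) : ρ.IsDualBases I J d c :=
  ⟨hcd.2.1, hcd.1, fun i j => by rw [mul_comm, hcd.2.2 j i]; simp [eq_comm]⟩

/-- Expansion of an element in terms of dual bases. -/
theorem IsDualBases.sum_traceInv (hcd : ρ.IsDualBases I J c d) (f : ρ.inv I) :
    ∑ i, inclInv ρ h (traceInv hρ hJ h (f * d i)) * c i = f := by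
  obtain ⟨a, ha, -⟩ := hcd.1 f
  have hf : f = ∑ i, inclInv ρ h (a i) * c i := Subtype.ext (ha.trans (by simp [coe_inclInv]))
  conv_rhs => rw [hf]
  refine Finset.sum_congr rfl fun j _ => ?_
  congr 2
  rw [hf, Finset.sum_mul, map_sum]
  simp only [mul_assoc, Realization.traceInv_mul, hcd.traceInv_mul hρ hJ h]
  simp

/-- Recovering the trace on `R^{I'} ⊆ R^I`, where `I' ⊆ I`, from two traces passing through `I''`. -/
theorem IsDualBases.sum_mul_traceInv (hcd : ρ.IsDualBases I J c d) {I' I'' : Set B} (h₁ : I' ⊆ I)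
    (h₂ : I' ⊆ I'') (h₃ : I'' ⊆ J) (g : ρ.inv I') :
    ∑ i, c i * inclInv ρ h (traceInv hρ hJ h₃
      (traceInv hρ (hJ.mono h₃) h₂ (g * inclInv ρ h₁ (d i)))) =
      traceInv hρ (hJ.mono h) h₁ g := by
  -- Expand the right side in the basis `c`; by transitivity both coefficients of `c_i` are the
  -- trace of `g d_i` from `R^{I'}` to `R^J`, computed through `I` or through `I''`.
  rw [← hcd.sum_traceInv hρ hJ h (traceInv hρ (hJ.mono h) h₁ g)]
  refine Finset.sum_congr rfl fun i _ => ?_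
  rw [traceInv_traceInv hρ hJ h₂ h₃, ← traceInv_traceInv hρ hJ h₁ h, mul_comm g,
    Realization.traceInv_mul, mul_comm (c i), mul_comm (d i)]

end Realization

end DualBases

/-! ### Evaluation of a single bubble -/

section StepDiagrams

variable {B : Type uB} {W : Type uW} [Group W] {M : CoxeterMatrix B} {cs : CoxeterSystem M W}
  {k : Type uk} [Field k] {V : Type uV} [AddCommGroup V] [Module k V]

open Letter Realization

namespace TwoHom

variable {ρ : Realization cs k V} {I₀ : Set B}

/-- The hard Reidemeister II relation with its regions named by variables: regions such as `L \
{u_n}` agree with `insert s I` only up to a proved equality. -/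
theorem rightCross_box_leftCross (a b : Word B) {I Is It L : Set B} {s t : B} {hs : s ∉ I}
    {ht : t ∉ I} {hst : s ≠ t} {hf : Finitary cs (insert s (insert t I))} (hI : Finitary cs I)
    (hIs : Finitary cs Is) (hIt : Finitary cs It) (eIs : insert s I = Is) (eIt : insert t I = It)
    (eL : insert s It = L) (g : ρ.inv I) {n : ℕ} {c d : Fin n → ρ.inv Is}
    (hcd : ρ.IsDualBases Is L c d) (e : Fin n → ρ.inv It)
    (he : ∀ i, (e i : ρ.Poly) = ρ.trace I It ((g : ρ.Poly) * (d i : ρ.Poly)))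
    {w w₁ : Word B} {h₁ h₂ h₃ h₄ h₅ h₆ h₇ h₈ h₉ h₁₀ h₁₁ h₁₂} :
    (mk (.rightCross (w := w) (w' := w₁) a b hs ht hst hf h₁ h₂ h₃)).comp
      ((box (ρ := ρ) (I₀ := I₀) (a ++ [dn s]) ([up t] ++ b) hI g h₄ h₅).comp
        (mk (.leftCross a b hs ht hst hf h₆ h₇ h₈))) =
      ∑ i, (box a ([up t, dn s] ++ b) hIs (c i) h₉ h₁₀).comp
        (box (a ++ [up t, dn s]) b hIt (e i) h₁₁ h₁₂) := by
  subst eIs eIt eL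
  exact (sound (Rel.R2_hard_coproduct a b hs ht hst hI hIs hIt hf g c d hcd e he)).trans
    (mk_sum _)

theorem ccwCup_box_ccwCap (a b : Word B) {I L : Set B} {s : B} {hs : s ∉ I} (hI : Finitary cs I)
    (hL : Finitary cs L) {hf : Finitary cs (insert s I)} (eL : insert s I = L) (f : ρ.inv I)
    (f' : ρ.inv L) (hff' : (f' : ρ.Poly) = ρ.trace I L f)
    {w w₁ : Word B} {h₁ h₂ h₃ h₄ h₅ h₆ h₇ h₈ h₉ h₁₀} :
    (layer (w := w) (w' := w₁) a b (.ccwCup hs hf) h₁ h₂ h₃).comp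
      ((box (ρ := ρ) (I₀ := I₀) (a ++ [dn s]) ([up s] ++ b) hI f h₄ h₅).comp
        (layer a b (.ccwCap hs hf) h₆ h₇ h₈)) = box a b hL f' h₉ h₁₀ := by
  subst eL
  exact sound (Rel.ccw_circle a b hs hI hf f f' hff')

/-- A bubble formed by a counterclockwise cup and cap and two crossings, with `g` inside it. -/
theorem cup_cross_box_cross_cap (hρ : ρ.IsAdmissible) (a b : Word B) {I Is It L : Set B} {s t : B}
    {hs : s ∉ I} {ht : t ∉ I} {hst : s ≠ t} {hf : Finitary cs (insert s (insert t I))}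
    {hsIt : s ∉ It} {hf' : Finitary cs (insert s It)}
    (hI : Finitary cs I) (hIs : Finitary cs Is) (hL : Finitary cs L)
    (eIs : insert s I = Is) (eIt : insert t I = It) (eL : insert s It = L) (hsub : I ⊆ Is)
    (g : ρ.inv I) {w w₁ w₂ : Word B} {h₁ h₂ h₃ h₄ h₅ h₆ h₇ h₈ h₉ h₁₀ h₁₁ h₁₂ h₁₃ h₁₄ h₁₅ h₁₆} :
    (layer (w := w) (w' := w₁) (a ++ [up t]) b (.ccwCup (I := It) hsIt hf') h₁ h₂ h₃).comp
      ((mk (.rightCross (w' := w₂) a ([up s] ++ b) hs ht hst hf h₄ h₅ h₆)).comp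
        ((box (ρ := ρ) (I₀ := I₀) (a ++ [dn s]) ([up t] ++ ([up s] ++ b)) hI g h₇ h₈).comp
          ((mk (.leftCross (w' := w₁) a ([up s] ++ b) hs ht hst hf h₉ h₁₀ h₁₁)).comp
            (layer (a ++ [up t]) b (.ccwCap (I := It) hsIt hf') h₁₂ h₁₃ h₁₄)))) =
      box a ([up t] ++ b) hIs (traceInv hρ hIs hsub g) h₁₅ h₁₆ := by
  have hItI : I ⊆ It := eIt ▸ Set.subset_insert t I
  have hItL : It ⊆ L := eL ▸ Set.subset_insert s It
  have hIsL : Is ⊆ L := by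
    rw [← eIs, ← eL]; exact Set.insert_subset_insert hItI
  have hIt := hL.mono hItL
  obtain ⟨n, c, d, -, -, hcd, -⟩ := exists_isDualBases hρ hL hIsL
  have ha : region I₀ (a ++ [up t]) = L := h₁.trans eL
  have htIs : t ∉ Is := by
    rw [← eIs]; simp [ht, Ne.symm hst]
  have key := rightCross_box_leftCross (ρ := ρ) (I₀ := I₀) a ([up s] ++ b) (hs := hs) (ht := ht)
    (hst := hst) (hf := hf) hI hIs hIt eIs eIt eL g hcd (fun i => traceInv hρ hIt hItI (g * inclInv ρ hsub (d i))) (fun i => rfl)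
    (w := w₁) (w₁ := w₂) (h₁ := h₄) (h₂ := h₅) (h₃ := h₆) (h₄ := h₇) (h₅ := h₈) (h₆ := h₉)
    (h₇ := h₁₀) (h₈ := h₁₁) (h₉ := h₁₅) (h₁₀ := by simp [h₅])
    (h₁₁ := by
      rw [← List.singleton_append (x := up t), ← List.append_assoc, region_append, ha]
      change L \ {s} = It
      rw [← eL, insert_diff_self_eq hsIt])
    (h₁₂ := by simp [h₅])
  -- The crossings open into `∑ c_i ⊗ ∂(g d_i)`. The circle left over takes the trace of the second
  -- factor to `R^L`, and the result slides left across the strand `t` to meet `c_i`;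
  -- `IsDualBases.sum_mul_traceInv` sums the products.
  rw [← comp_assoc (box _ _ _ _ _ _), ← comp_assoc (mk (.rightCross _ _ _ _ _ _ _ _ _)), key,
    sum_comp, comp_sum, ← hcd.sum_mul_traceInv hρ hL hIsL hsub hItI hItL g, box_sum]
  refine Finset.sum_congr rfl fun i _ => ?_
  rw [box_mul, comp_assoc, ← comp_assoc,
    ← box_comp_layer_left a [up t] b (b' := [up t] ++ b) (.ccwCup hsIt hf') rfl, comp_assoc]
  · congr 1
    set e := traceInv hρ hL hItL (traceInv hρ hIt hItI (g * inclInv ρ hsub (d i)))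
    rw [box_slide_up a b (inclInv ρ hIsL e) e htIs rfl (ha' := ha) (hJ := hL)
      (hw' := h₂.trans (by simp))]
    rw [← ccwCup_box_ccwCap (a ++ [up t]) b hIt hL eL
      (traceInv hρ hIt hItI (g * inclInv ρ hsub (d i))) _ rfl (hs := hsIt) (hf := hf')
      (h₁ := h₁) (h₂ := h₂) (h₃ := h₃) (h₆ := h₁₂) (h₇ := h₁₃) (h₈ := h₁₄)]
    · congr 2
      refine box_congr _ _ (by simp) rfl
    · rw [region_append, ha]
      change L \ {s} = It
      rw [← eL, insert_diff_self_eq hsIt]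
    · simp [h₃]
  · exact h₁₆

end TwoHom

end StepDiagrams

/-! ### Peeling the bubbles off the composite of the two rex moves -/

section RexMoves

variable {B : Type uB} {W : Type uW} [Group W] {M : CoxeterMatrix B} {cs : CoxeterSystem M W}
  {k : Type uk} [Field k] {V : Type uV} [AddCommGroup V] [Module k V]

open Letter Realization TwoHom

theorem TwoHom.box_comp_leftCross {ρ : Realization cs k V} {I₀ : Set B} (a m b : Word B)
    {a₁ a₂ b' : Word B} {I K : Set B} {s t : B} {hs : s ∉ I} {ht : t ∉ I} {hst : s ≠ t}
    {hf : Finitary cs (insert s (insert t I))} {hK : Finitary cs K} (f : ρ.inv K)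
    (e₁ : a₁ = a ++ [dn s, up t] ++ m) (e₂ : a₂ = a ++ [up t, dn s] ++ m) (e : b' = m ++ b)
    {w w' : Word B} {h₁ h₂ h₃ h₄ h₅} (h₆ : region I₀ a₂ = K) (h₇ : w' = a₂ ++ b) :
    (box (w := w) a₁ b hK f h₁ h₂).comp
        (mk (.leftCross (w' := w') a b' hs ht hst hf h₃ h₄ h₅)) =
      (mk (.leftCross a b' hs ht hst hf h₃ h₄ h₅)).comp (box (I₀ := I₀) a₂ b hK f h₆ h₇) := by
  subst e
  have hr : region (insert t I) m = K := by
    rw [← h₁, e₁, region_append, region_append, h₃]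
    simp [region_cons, region_nil, stepRegion, insert_diff_self_eq hs]
  have hts : insert s (insert t I) \ {s} = insert t I :=
    insert_diff_self_eq (by simp [hs, hst])
  change (box _ _ _ _ _ _).comp ((layer _ _ _ _ _ _).comp ((layer _ _ _ _ _ _).comp
    (layer _ _ _ _ _ _))) = ((layer _ _ _ _ _ _).comp ((layer _ _ _ _ _ _).comp
    (layer _ _ _ _ _ _))).comp _
  rw [← comp_assoc, box_comp_layer_right (a ++ [dn s, up t]) m b _
    (a₂ := a ++ [dn s, up t] ++ [up s, dn s] ++ m) (by simp [e₁]) rfl, comp_assoc,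
    ← comp_assoc (box _ _ _ _ _ _), box_comp_layer_right (a ++ [dn s]) ([dn s] ++ m) b _
    (a₂ := a ++ [dn s] ++ [up s, up t] ++ ([dn s] ++ m)) (by simp) rfl, comp_assoc,
    box_comp_layer_right a ([up t, dn s] ++ m) b _ (a₂ := a₂) (by simp) (by simp [e₂]),
    comp_assoc, comp_assoc]
  · rw [← hr]
    simp [region_append, h₃, region_cons, stepRegion, insert_diff_self_eq hs,
      Set.insert_comm t s, hts]
  · simp
  · rw [← hr]
    simp [region_append, h₃, region_cons, stepRegion, insert_diff_self_eq hs, hts]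
  · simp

namespace IsAdmissibleSeq

variable {L : Set B} {d : ℕ} {u : ℕ → B} {ρ : Realization cs k V}

theorem region_longWord_up (h : IsAdmissibleSeq cs L d u) {n : ℕ} (hn : n ≤ d) :
    region (L \ {u 0}) (longWord u n ++ [up (u n)]) = L := by
  rw [region_append, h.region_longWord hn]
  exact h.insert_diff hn

/-- The polynomial lies to the right of every crossing and cap of the diagram, so only the
interchange law is needed. -/
theorem box_comp_contract (h : IsAdmissibleSeq cs L d u) (m b : Word B) {b' a₁ a₂ : Word B}
    {K : Set B} {hK : Finitary cs K} (hm : region L m = K) (f : ρ.inv K) {n : ℕ} (hn : n ≤ d)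
    (e : b' = m ++ b) (e₁ : a₁ = longWord u n ++ [up (u n)] ++ m) (e₂ : a₂ = [up (u 0)] ++ m)
    {h₁ h₂ h₃ h₄} :
    (box a₁ b hK f h₁ h₂).comp (TwoHom.mk (h.contract ρ b' n hn)) =
      (TwoHom.mk (h.contract ρ b' n hn)).comp (box a₂ b hK f h₃ h₄) := by
  subst e e₁ e₂
  induction n with
  | zero =>
    change (box _ _ _ _ _ _).comp (TwoHom.mk (.id _)) = (TwoHom.mk (.id _)).comp _
    exact (comp_id _).trans (id_comp _).symm
  | succ n ih =>
    have hr := h.region_longWord_up (Nat.le_of_succ_le hn)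
    change (box _ _ _ _ _ _).comp (((TwoHom.mk (.leftCross _ _ _ _ _ _ _ _ _)).comp
      (layer _ _ _ _ _ _)).comp (TwoHom.mk (h.contract ρ _ n _))) =
      (((TwoHom.mk (.leftCross _ _ _ _ _ _ _ _ _)).comp
      (layer _ _ _ _ _ _)).comp (TwoHom.mk (h.contract ρ _ n _))).comp _
    rw [comp_assoc, ← comp_assoc, box_comp_leftCross (longWord u n) ([up (u (n + 1))] ++ m) b f
      (a₂ := longWord u n ++ [up (u n), dn (u (n + 1))] ++ ([up (u (n + 1))] ++ m))
      (by simp [longWord]) rfl (by simp), comp_assoc, ← comp_assoc (box _ _ _ _ _ _),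
      box_comp_layer_right (longWord u n ++ [up (u n)]) m b _
      (a₂ := longWord u n ++ [up (u n)] ++ m) (by simp) (by simp), comp_assoc, ih,
      comp_assoc, comp_assoc]
    · rw [region_append, hr, hm]
    · simp
    · have : longWord u n ++ [up (u n), dn (u (n + 1))] ++ ([up (u (n + 1))] ++ m) =
          longWord u n ++ [up (u n)] ++ ([dn (u (n + 1)), up (u (n + 1))] ++ m) := by simp
      rw [this, region_append, hr, ← hm]
      simp [region_cons, stepRegion, Set.insert_eq_of_mem (h.mem (n + 1) hn)]
    · simp

/-- Closing up the strands of the rex move around a polynomial evaluates to an iterated trace. -/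
theorem expand_box_contract (h : IsAdmissibleSeq cs L d u) (hρ : ρ.IsAdmissible) (b : Word B)
    {n : ℕ} (hn : n ≤ d) (f : ρ.inv (L \ {u n})) {h₁ h₂ h₃ h₄} :
    (TwoHom.mk (h.expand ρ b n hn)).comp
      ((box (longWord u n) ([up (u n)] ++ b) (h.finitary_diff n) f h₁ h₂).comp
        (TwoHom.mk (h.contract ρ b n hn))) =
      box [] ([up (u 0)] ++ b) (h.finitary_diff 0) (h.iterTrace hρ n f) h₃ h₄ := by
  induction n with
  | zero =>
    change (TwoHom.mk (.id _)).comp ((box _ _ _ _ _ _).comp (TwoHom.mk (.id _))) = _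
    rw [comp_id, id_comp]
    rfl
  | succ n ih =>
    rw [iterTrace_succ, ← ih (Nat.le_of_succ_le hn) (h.stepTrace hρ n f)
      (h₁ := h.region_longWord (Nat.le_of_succ_le hn)) (h₂ := by simp)]
    have hr : region (L \ {u 0}) (longWord u n ++ [dn (u (n + 1))]) =
        (L \ {u n}) \ {u (n + 1)} := by
      rw [region_append, h.region_longWord (Nat.le_of_succ_le hn)]; rfl
    have key := cup_cross_box_cross_cap hρ (longWord u n) b (I₀ := L \ {u 0})
      (I := (L \ {u n}) \ {u (n + 1)}) (Is := L \ {u n}) (It := L \ {u (n + 1)}) (L := L)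
      (s := u (n + 1)) (t := u n) (hs := by simp) (ht := by simp) (hst := (h.ne_succ n hn).symm)
      (hf := by rw [h.insert_pair_left hn, h.insert_diff hn]; exact h.finitary) (hsIt := by simp)
      (hf' := by rw [h.insert_diff hn]; exact h.finitary)
      (h.finitary_diff_diff n (n + 1)) (h.finitary_diff n) h.finitary (h.insert_pair_right hn)
      (h.insert_pair_left hn) (h.insert_diff hn) Set.sdiff_subset
      (inclInv ρ (diff_diff_subset L u n) f) (w := longWord u n ++ [up (u n)] ++ b)
      (w₁ := longWord u n ++ [up (u n), dn (u (n + 1)), up (u (n + 1))] ++ b)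
      (w₂ := longWord u (n + 1) ++ [up (u (n + 1))] ++ b)
      (h₁ := (h.region_longWord_up (Nat.le_of_succ_le hn)).trans (h.insert_diff hn).symm)
      (h₂ := by simp) (h₃ := by simp)
      (h₄ := (h.region_longWord (Nat.le_of_succ_le hn)).trans (h.insert_pair_right hn).symm)
      (h₅ := by simp) (h₆ := by simp [longWord]) (h₇ := hr) (h₈ := by simp [longWord])
      (h₉ := (h.region_longWord (Nat.le_of_succ_le hn)).trans (h.insert_pair_right hn).symm)
      (h₁₀ := by simp [longWord]) (h₁₁ := by simp)
      (h₁₂ := (h.region_longWord_up (Nat.le_of_succ_le hn)).trans (h.insert_diff hn).symm)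
      (h₁₃ := by simp) (h₁₄ := by simp) (h₁₅ := h.region_longWord (Nat.le_of_succ_le hn))
      (h₁₆ := by simp)
    change ((TwoHom.mk (h.expand ρ b n _)).comp ((layer _ _ _ _ _ _).comp
      (TwoHom.mk (.rightCross _ _ _ _ _ _ _ _ _)))).comp ((box _ _ _ _ _ _).comp
      (((TwoHom.mk (.leftCross _ _ _ _ _ _ _ _ _)).comp (layer _ _ _ _ _ _)).comp
        (TwoHom.mk (h.contract ρ _ n _)))) = _
    rw [comp_assoc, comp_assoc, ← comp_assoc (box _ _ _ _ _ _),
      ← comp_assoc (TwoHom.mk (.rightCross _ _ _ _ _ _ _ _ _)), ← comp_assoc (layer _ _ _ _ _ _)]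
    congr 2
    refine Eq.trans ?_ key
    congr 3
    -- The polynomial `f` starts to the right of the strand `+u_n`; being invariant under the larger
    -- group, it slides left across it into the bubble.
    refine (box_congr (I' := L \ {u (n + 1)}) (hI' := h.finitary_diff (n + 1)) (f' := f)
      (a' := longWord u n ++ [dn (u (n + 1))] ++ [up (u n)]) (b' := [up (u (n + 1))] ++ b)
      ?_ (by simp [longWord]) (by simp [longWord]) rfl).trans
      (box_slide_up (longWord u n ++ [dn (u (n + 1))]) ([up (u (n + 1))] ++ b)
        (inclInv ρ (diff_diff_subset L u n) f) f (by simp) rfl).symm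
    rw [region_append, hr]
    exact h.insert_pair_left hn

/-- The two rex moves, with the coproduct of `R^L ⊆ R^{L \ u_n}` inserted in between. -/
theorem rexTerm_comp_rexBackTerm {n : ℕ} (h : IsAdmissibleSeq cs L (n + 1) u)
    (hρ : ρ.IsAdmissible) {N : ℕ} {c c' : Fin N → ρ.inv (L \ {u n})}
    (hc : ρ.IsDualBases (L \ {u n}) L c c') {h₁ h₂ h₃ h₄} :
    (TwoHom.mk (rexTerm ρ h)).comp (TwoHom.mk (rexBackTerm ρ h)) =
      ∑ i, (box [] [up (u 0), dn (u (n + 1))] (h.finitary_diff 0) (h.iterTrace hρ n (c i))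
        h₁ h₂).comp (box [up (u 0), dn (u (n + 1))] [] (h.finitary_diff (n + 1))
          (traceInv hρ (h.finitary_diff (n + 1)) (diff_diff_subset L u n)
            (inclInv ρ Set.sdiff_subset (c' i))) h₃ h₄) := by
  have hrd : region (L \ {u 0}) (longWord u n ++ [up (u n), dn (u (n + 1))]) =
      L \ {u (n + 1)} := by
    rw [← List.singleton_append (x := up (u n)), ← List.append_assoc, region_append,
      h.region_longWord_up n.le_succ]
    rfl
  let e : Fin N → ρ.inv (L \ {u (n + 1)}) := fun i =>
    traceInv hρ (h.finitary_diff (n + 1)) (diff_diff_subset L u n)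
      (inclInv ρ Set.sdiff_subset (c' i))
  let R : TwoHom ρ (L \ {u 0}) (longWord u n ++ [up (u n)] ++ [dn (u (n + 1))])
    (longWord u (n + 1)) :=
    TwoHom.mk (h.crossRight ρ n.lt_succ_self [] (by simp) (by simp [longWord]))
  let R' : TwoHom ρ (L \ {u 0}) (longWord u (n + 1))
    (longWord u n ++ [up (u n)] ++ [dn (u (n + 1))]) :=
    TwoHom.mk (h.crossLeft ρ n.lt_succ_self [] (by simp [longWord]) (by simp))
  let φ := TwoHom.mk (h.expand ρ [dn (u (n + 1))] n n.le_succ)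
  let ψ := TwoHom.mk (h.contract ρ [dn (u (n + 1))] n n.le_succ)
  have hr₁ : region (L \ {u 0}) (longWord u n ++ [dn (u (n + 1))]) =
      (L \ {u n}) \ {u (n + 1)} := by
    rw [region_append, h.region_longWord n.le_succ]; rfl
  have key : R.comp R' = ∑ i,
      (box (longWord u n) ([up (u n)] ++ [dn (u (n + 1))]) (h.finitary_diff n) (c i)
        (h.region_longWord n.le_succ) (by simp)).comp
      (box (longWord u n ++ [up (u n), dn (u (n + 1))]) [] (h.finitary_diff (n + 1)) (e i)
        hrd (by simp)) := by
    -- The polynomial 1 is placed in the innermost region to bring the two crossings to the form of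
    -- the relation, with `g = 1`.
    rw [← id_comp R', ← box_one (a := longWord u n ++ [dn (u (n + 1))]) (b := [up (u n)])
      (hI := h.finitary_diff_diff n (n + 1)) (ha := hr₁) (hw := by simp [longWord])]
    exact rightCross_box_leftCross (longWord u n) [] (h.finitary_diff_diff n (n + 1))
      (h.finitary_diff n) (h.finitary_diff (n + 1)) (h.insert_pair_right n.lt_succ_self)
      (h.insert_pair_left n.lt_succ_self) (h.insert_diff le_rfl) 1 hc e
      (fun i => by rw [OneMemClass.coe_one, one_mul]; rfl)
  have assoc : (TwoHom.mk (rexTerm ρ h)).comp (TwoHom.mk (rexBackTerm ρ h)) =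
      φ.comp ((R.comp R').comp ψ) :=
    ((comp_assoc φ R _).trans (congrArg φ.comp (comp_assoc R R' ψ).symm))
  rw [assoc, key, sum_comp, comp_sum]
  refine Finset.sum_congr rfl fun i _ => ?_
  -- The right factor leaves the diagram; only the left factor stays enclosed by the bubbles.
  have comm : (box (longWord u n ++ [up (u n), dn (u (n + 1))]) [] (h.finitary_diff (n + 1)) (e i)
      hrd (by simp)).comp ψ = ψ.comp
        (box [up (u 0), dn (u (n + 1))] [] (h.finitary_diff (n + 1)) (e i) h₃ h₄) :=
    h.box_comp_contract [dn (u (n + 1))] [] rfl (e i) n.le_succ rfl (by simp) rfl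
  rw [comp_assoc, comm, ← comp_assoc (box _ _ _ _ _ _), ← comp_assoc]
  exact congrArg (fun z => TwoHom.comp z _)
    (h.expand_box_contract hρ [dn (u (n + 1))] n.le_succ (c i))

end IsAdmissibleSeq

end RexMoves

/-! ### The composite of the two rex moves is the identity -/

section RexMoveComposition

variable {B : Type uB} {W : Type uW} [Group W] {M : CoxeterMatrix B} {cs : CoxeterSystem M W}
  {k : Type uk} [Field k] {V : Type uV} [AddCommGroup V] [Module k V]

open Letter Realization TwoHom

/-- A polynomial in the middle region of `[I + s - t]` slides out on both sides. -/
theorem TwoHom.box_slide_up_dn {ρ : Realization cs k V} {I L J : Set B} {s t : B}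
    (hI : Finitary cs I) (hJ : Finitary cs J) (hL : Finitary cs L) (hs : s ∉ I) (ht : t ∈ L)
    (hsub : I ⊆ L) (hsub' : J ⊆ L) (e : insert s I = L) (r : ρ.inv L) {h₁ h₂ h₃ h₄} :
    box (I₀ := I) (w := [up s, dn t]) [] [up s, dn t] hI (inclInv ρ hsub r) h₁ h₂ =
      box [up s, dn t] [] hJ (inclInv ρ hsub' r) h₃ h₄ :=
  (box_slide_up [] [dn t] (inclInv ρ hsub r) r hs rfl (hJ := hL) (ha' := e) (hw' := rfl)).trans
    (box_slide_dn [up s] [] (inclInv ρ hsub' r) r ht rfl)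

-- Contracting the right factor of `∑ iterTrace(c_i) ⊗ ∂(c'_i)` against `f` gives the iterated trace
-- of `f`, one step longer, hence the trace to `R^L`. This is also what `1 ⊗ 1` gives.
open IsAdmissibleSeq in
theorem IsSwitchback.sum_iterTrace_mul {L : Set B} {n : ℕ} {u : ℕ → B} {ρ : Realization cs k V}
    (h : IsSwitchback cs L (n + 1) u) (hρ : ρ.IsAdmissible) {N : ℕ}
    {c c' : Fin N → ρ.inv (L \ {u n})} (hc : ρ.IsDualBases (L \ {u n}) L c c')
    (f : ρ.inv (L \ {u (n + 1)})) :
    ∑ i, h.seq.iterTrace hρ n (c i) * inclInv ρ Set.sdiff_subset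
      (traceInv hρ h.seq.finitary Set.sdiff_subset
        (traceInv hρ (h.seq.finitary_diff (n + 1)) (diff_diff_subset L u n)
          (inclInv ρ Set.sdiff_subset (c' i)) * f)) =
      inclInv ρ Set.sdiff_subset (traceInv hρ h.seq.finitary Set.sdiff_subset f) := by
  rw [← h.iterTrace_eq hρ, iterTrace_succ, stepTrace, AddMonoidHom.comp_apply]
  change _ = h.seq.iterTrace hρ n (traceInv hρ _ _ (inclInv ρ (diff_diff_subset L u n) f))
  rw [← hc.sum_mul_traceInv hρ h.seq.finitary Set.sdiff_subset Set.sdiff_subset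
    (diff_diff_subset L u n) Set.sdiff_subset, map_sum]
  refine Finset.sum_congr rfl fun i _ => ?_
  rw [traceInv_mul, mul_comm f, mul_comm (c i), iterTrace_mul, mul_comm]

open IsAdmissibleSeq in
/-- The composition of the two rex moves, starting from the short expression, is the identity. -/
theorem IsSwitchback.rexTerm_comp_rexBackTerm {L : Set B} {n : ℕ} {u : ℕ → B}
    {ρ : Realization cs k V} (h : IsSwitchback cs L (n + 1) u) (hρ : ρ.IsAdmissible) :
    (TwoHom.mk (rexTerm ρ h.seq)).comp (TwoHom.mk (rexBackTerm ρ h.seq)) =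
      TwoHom.mk (.id [up (u 0), dn (u (n + 1))]) := by
  have hL := h.seq.finitary
  obtain ⟨N, c, c', -, -, hc, -⟩ := exists_isDualBases hρ hL
    (Set.sdiff_subset : L \ {u n} ⊆ L)
  obtain ⟨N', e, e', -, -, he, -⟩ := exists_isDualBases hρ hL
    (Set.sdiff_subset : L \ {u (n + 1)} ⊆ L)
  have hr : region (L \ {u 0}) [up (u 0), dn (u (n + 1))] = L \ {u (n + 1)} :=
    congrArg (· \ {u (n + 1)}) (h.seq.insert_diff (Nat.zero_le _))
  have hn : region (L \ {u 0}) [] = L \ {u 0} := rfl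
  have hw : [up (u 0), dn (u (n + 1))] = [] ++ [up (u 0), dn (u (n + 1))] := rfl
  have hw' : [up (u 0), dn (u (n + 1))] = [up (u 0), dn (u (n + 1))] ++ [] := rfl
  have slide : ∀ r : ρ.inv L, _ := fun r => box_slide_up_dn (h.seq.finitary_diff 0)
    (h.seq.finitary_diff (n + 1)) hL (by simp) (h.seq.mem (n + 1) le_rfl) Set.sdiff_subset
    Set.sdiff_subset (h.seq.insert_diff (Nat.zero_le _)) r (h₁ := hn) (h₂ := hw) (h₃ := hr)
    (h₄ := hw')
  let τ : Fin N → ρ.inv (L \ {u (n + 1)}) := fun i =>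
    traceInv hρ (h.seq.finitary_diff (n + 1)) (diff_diff_subset L u n)
      (inclInv ρ Set.sdiff_subset (c' i))
  let T : ρ.inv (L \ {u (n + 1)}) → ρ.inv L := traceInv hρ hL Set.sdiff_subset
  -- Expanding the right factor over `R^L` leaves coefficients that can slide across both strands to
  -- the left factor.
  have expand : ∀ i, box [up (u 0), dn (u (n + 1))] [] (h.seq.finitary_diff (n + 1)) (τ i)
      hr hw' = ∑ j, (box [] [up (u 0), dn (u (n + 1))] (h.seq.finitary_diff 0)
        (inclInv ρ Set.sdiff_subset (T (τ i * e' j))) hn hw).comp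
      (box [up (u 0), dn (u (n + 1))] [] (h.seq.finitary_diff (n + 1)) (e j) hr hw') := by
    intro i
    conv_lhs => rw [← he.sum_traceInv hρ hL Set.sdiff_subset (τ i)]
    rw [box_sum]
    refine Finset.sum_congr rfl fun j _ => ?_
    rw [box_mul, slide]
  calc _ = ∑ i, (box [] [up (u 0), dn (u (n + 1))] (h.seq.finitary_diff 0)
          (h.seq.iterTrace hρ n (c i)) hn hw).comp
        (box [up (u 0), dn (u (n + 1))] [] (h.seq.finitary_diff (n + 1)) (τ i) hr hw') :=
        h.seq.rexTerm_comp_rexBackTerm hρ hc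
    _ = ∑ j, (box [] [up (u 0), dn (u (n + 1))] (h.seq.finitary_diff 0)
          (∑ i, h.seq.iterTrace hρ n (c i) * inclInv ρ Set.sdiff_subset (T (τ i * e' j)))
          hn hw).comp
        (box [up (u 0), dn (u (n + 1))] [] (h.seq.finitary_diff (n + 1)) (e j) hr hw') := by
      simp_rw [expand, comp_sum, ← comp_assoc, ← box_mul]
      rw [Finset.sum_comm]
      simp_rw [← sum_comp, ← box_sum]
    _ = ∑ j, box [up (u 0), dn (u (n + 1))] [] (h.seq.finitary_diff (n + 1))
          (inclInv ρ Set.sdiff_subset (T (1 * e' j)) * e j) hr hw' := by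
      -- The left coefficient of `e_j` turns out to be the trace of `e'_j`, which is the coefficient
      -- of `e_j` in the expansion of 1. Slid back to the right, these terms sum to the polynomial
      -- 1.
      refine Finset.sum_congr rfl fun j _ => ?_
      rw [h.sum_iterTrace_mul hρ hc, slide, box_mul, one_mul]
    _ = _ := by
      rw [← box_sum, he.sum_traceInv hρ hL Set.sdiff_subset 1]
      exact box_one

theorem IsSwitchback.rexMove_comp_rexMoveBack {L : Set B} {d : ℕ} {u : ℕ → B}
    {ρ : Realization cs k V} (h : IsSwitchback cs L d u) (hρ : ρ.IsAdmissible) :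
    h.seq.rexMove ρ ≫ h.seq.rexMoveBack ρ = 𝟙 (h.seq.shortObj ρ) := by
  cases d with
  | zero => exact absurd h.seq.pos (by simp)
  | succ n => exact h.rexTerm_comp_rexBackTerm hρ

end RexMoveComposition

/-! ### Tensor products of rings as additive groups -/

section TensorRings

open scoped TensorProduct

variable {A X C : Type*} [CommRing A] [CommRing X] [CommRing C] [Algebra A X] [Algebra A C]

/-- The pure tensors as a biadditive map. -/
def tensorMk (A X C : Type*) [CommRing A] [CommRing X] [CommRing C] [Algebra A X] [Algebra A C] :
    X →+ C →+ X ⊗[A] C :=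
  AddMonoidHom.mk' (fun x => AddMonoidHom.mk' (fun c => x ⊗ₜ[A] c) (TensorProduct.tmul_add x))
    (fun x y => by ext c; exact TensorProduct.add_tmul x y c)

/-- Stated for arbitrary algebra structures, because those of `induceRight` are local to its
definition and must be supplied explicitly. -/
theorem tensorMk_mul_algebraMap (x : X) (r : A) (c : C) :
    tensorMk A X C (x * algebraMap A X r) c = tensorMk A X C x (algebraMap A C r * c) := by
  change (x * algebraMap A X r) ⊗ₜ[A] c = x ⊗ₜ[A] (algebraMap A C r * c)
  rw [mul_comm, ← Algebra.smul_def, ← Algebra.smul_def, TensorProduct.smul_tmul]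

theorem tensorMk_mul_tensorMk (x y : X) (c d : C) :
    tensorMk A X C x c * tensorMk A X C y d = tensorMk A X C (x * y) (c * d) :=
  Algebra.TensorProduct.tmul_mul_tmul x y c d

theorem tensorMk_induction {p : X ⊗[A] C → Prop} (z : X ⊗[A] C)
    (tmul : ∀ x c, p (tensorMk A X C x c)) (add : ∀ z z', p z → p z' → p (z + z')) : p z :=
  TensorProduct.induction_on z (by simpa using tmul 0 0) tmul (fun z z' => add z z')

theorem exists_tensorLift {G : Type*} [AddCommGroup G] (F : X →+ C →+ G)
    (hF : ∀ x r c, F (x * algebraMap A X r) c = F x (algebraMap A C r * c)) :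
    ∃ τ : X ⊗[A] C →+ G, ∀ x c, τ (tensorMk A X C x c) = F x c :=
  ⟨TensorProduct.liftAddHom F fun r x c => by
    rw [Algebra.smul_def, Algebra.smul_def, mul_comm, hF], fun _ _ => rfl⟩

end TensorRings

/-! ### Degrees, and left-linear traces on graded bimodules -/

section BimoduleTraces

variable {B : Type uB} {W : Type uW} [Group W] {M : CoxeterMatrix B} {cs : CoxeterSystem M W}
  {k : Type uk} [Field k] {V : Type uV} [AddCommGroup V] [Module k V]
  {ρ : Realization cs k V}

open scoped TensorProduct

open Realization

namespace Realization

/-- In odd and in negative degrees the supremum is empty and only zero remains. -/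
theorem mem_degreePart_iff {m : ℤ} {f : ρ.Poly} :
    f ∈ ρ.degreePart m ↔ f = 0 ∨ ∃ n : ℕ, 2 * (n : ℤ) = m ∧ IsHomog ρ n f := by
  constructor
  · intro hf
    by_cases hm : ∃ n : ℕ, 2 * (n : ℤ) = m
    · obtain ⟨n, hn⟩ := hm
      refine Or.inr ⟨n, hn, ?_⟩
      have : ρ.degreePart m ≤ (LinearMap.range (SymmetricAlgebra.ι k V)) ^ n := by
        refine iSup_le fun p => ?_
        have : (p : ℕ) = n := by have := p.2; omega
        rw [this]
      exact this hf
    · have : IsEmpty {n : ℕ // 2 * (n : ℤ) = m} := ⟨fun p => hm ⟨p.1, p.2⟩⟩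
      rw [degreePart, iSup_of_empty] at hf
      exact Or.inl hf
  · rintro (rfl | ⟨n, hn, hf⟩)
    · exact zero_mem _
    · exact le_iSup (fun p : {n : ℕ // 2 * (n : ℤ) = m} =>
        (LinearMap.range (SymmetricAlgebra.ι k V)) ^ (p : ℕ)) ⟨n, hn⟩ hf

theorem IsHomog.mem_degreePart {n : ℕ} {f : ρ.Poly} (hf : IsHomog ρ n f) {m : ℤ}
    (hm : 2 * (n : ℤ) = m) : f ∈ ρ.degreePart m := mem_degreePart_iff.2 (Or.inr ⟨n, hm, hf⟩)

theorem one_mem_degreePart : (1 : ρ.Poly) ∈ ρ.degreePart 0 :=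
  IsHomog.mem_degreePart (n := 0) (by
    rw [IsHomog, pow_zero]; exact Submodule.one_le.1 le_rfl) (by simp)

theorem mul_mem_degreePart {a b : ℤ} {f g : ρ.Poly} (hf : f ∈ ρ.degreePart a)
    (hg : g ∈ ρ.degreePart b) : f * g ∈ ρ.degreePart (a + b) := by
  rcases mem_degreePart_iff.1 hf with rfl | ⟨n, rfl, hf'⟩
  · rw [zero_mul]; exact zero_mem _
  rcases mem_degreePart_iff.1 hg with rfl | ⟨n', rfl, hg'⟩
  · rw [mul_zero]; exact zero_mem _
  refine IsHomog.mem_degreePart (n := n + n') ?_ (by push_cast; ring)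
  rw [IsHomog, pow_add]
  exact Submodule.mul_mem_mul hf' hg'

/-- The trace lowers degrees by `2 (ℓ(J) - ℓ(I))`. -/
theorem trace_mem_degreePart (hρ : ρ.IsAdmissible) {I J : Set B} (hJ : Finitary cs J) (h : I ⊆ J)
    {m : ℤ} {f : ρ.Poly} (hf : f ∈ ρ.degreePart m) :
    ρ.trace I J f ∈ ρ.degreePart (m - 2 * ((parLength cs J : ℤ) - parLength cs I)) := by
  have hl := length_longest_mul_longest_inv hJ h
  rw [trace_eq hρ.faithful]
  rcases mem_degreePart_iff.1 hf with rfl | ⟨n, rfl, hf'⟩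
  · rw [map_zero]; exact zero_mem _
  rcases lt_or_ge n (cs.length (longest cs J * (longest cs I)⁻¹)) with hn | hn
  · rw [demElt_eq_zero_of_isHomog hρ.faithful hρ.balanced hf' hn]; exact zero_mem _
  · obtain ⟨n', rfl⟩ := Nat.exists_eq_add_of_le' hn
    exact (isHomog_demElt hρ.faithful hρ.balanced hf').mem_degreePart (by omega)

end Realization

namespace GradedBimodule

variable {I J : Set B}

section InduceRight

variable (P : GradedBimodule ρ I J) {K : Set B} (h : K ⊆ J) (σ : ℤ)

/-- The pure tensors in `P ⊗_{R^J} R^K`. -/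
def tmul : P.carrier →+ ρ.inv K →+ (P.induceRight h σ).carrier :=
  @tensorMk (ρ.inv J) P.carrier (ρ.inv K) _ _ _ P.right.toAlgebra (inclInv ρ h).toAlgebra

theorem tmul_mul_right (x : P.carrier) (r : ρ.inv J) (f : ρ.inv K) :
    tmul P h σ (x * P.right r) f = tmul P h σ x (inclInv ρ h r * f) :=
  @tensorMk_mul_algebraMap (ρ.inv J) P.carrier (ρ.inv K) _ _ _ P.right.toAlgebra
    (inclInv ρ h).toAlgebra x r f

theorem tmul_mul_tmul (x y : P.carrier) (f g : ρ.inv K) :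
    tmul P h σ x f * tmul P h σ y g = tmul P h σ (x * y) (f * g) :=
  @tensorMk_mul_tensorMk (ρ.inv J) P.carrier (ρ.inv K) _ _ _ P.right.toAlgebra
    (inclInv ρ h).toAlgebra x y f g

theorem induceRight_left (f : ρ.inv I) :
    (P.induceRight h σ).left f = tmul P h σ (P.left f) 1 := rfl

theorem induceRight_right (g : ρ.inv K) : (P.induceRight h σ).right g = tmul P h σ 1 g := rfl

theorem tmul_induction {p : (P.induceRight h σ).carrier → Prop} (z : (P.induceRight h σ).carrier)
    (mk : ∀ x f, p (tmul P h σ x f)) (add : ∀ z z', p z → p z' → p (z + z')) : p z :=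
  @tensorMk_induction (ρ.inv J) P.carrier (ρ.inv K) _ _ _ P.right.toAlgebra
    (inclInv ρ h).toAlgebra p z mk add

theorem exists_lift {G : Type*} [AddCommGroup G] (F : P.carrier →+ ρ.inv K →+ G)
    (hF : ∀ x r f, F (x * P.right r) f = F x (inclInv ρ h r * f)) :
    ∃ τ : (P.induceRight h σ).carrier →+ G, ∀ x f, τ (tmul P h σ x f) = F x f :=
  @exists_tensorLift (ρ.inv J) P.carrier (ρ.inv K) _ _ _ P.right.toAlgebra
    (inclInv ρ h).toAlgebra G _ F hF

theorem tmul_mem_degreePart {a b n : ℤ} {x : P.carrier} {f : ρ.inv K} (hx : x ∈ P.degreePart a)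
    (hf : (f : ρ.Poly) ∈ ρ.degreePart b) (hn : a + b = n + σ) :
    tmul P h σ x f ∈ (P.induceRight h σ).degreePart n :=
  AddSubgroup.subset_closure ⟨a, b, x, f, hn, hx, hf, rfl⟩

/-- An additive map out of `P ⊗_{R^J} R^K` may be shown to respect degrees on pure tensors. -/
theorem map_mem_of_mem_degreePart {G : Type*} [AddCommGroup G]
    (τ : (P.induceRight h σ).carrier →+ G) (S : AddSubgroup G) {n : ℤ}
    (hS : ∀ a b x (f : ρ.inv K), a + b = n + σ → x ∈ P.degreePart a →
      (f : ρ.Poly) ∈ ρ.degreePart b → τ (tmul P h σ x f) ∈ S)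
    {z : (P.induceRight h σ).carrier} (hz : z ∈ (P.induceRight h σ).degreePart n) : τ z ∈ S := by
  have : (P.induceRight h σ).degreePart n ≤ S.comap τ := by
    refine (AddSubgroup.closure_le _).2 ?_
    rintro z ⟨a, b, x, f, hab, hx, hf, rfl⟩
    exact hS a b x f hab hx hf
  exact this hz

end InduceRight

/-- `P` is an `(R^I, R^J)`-bimodule on which both actions of `R^L` agree, with a generator in degree
`-σ` and a left `R^I`-linear trace of degree `-σ` which is given by `D` on the image of `R^J`. -/
structure HasTrace (L : Set B) (P : GradedBimodule ρ I J) (σ : ℤ) (D : ρ.Poly → ρ.Poly) :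
    Prop where
  subset_left : I ⊆ L
  subset_right : J ⊆ L
  balanced : ∀ r : ρ.inv L, P.left (inclInv ρ subset_left r) = P.right (inclInv ρ subset_right r)
  mul_right_mem : ∀ (n m : ℤ) (x : P.carrier) (g : ρ.inv J), x ∈ P.degreePart n →
    (g : ρ.Poly) ∈ ρ.degreePart m → x * P.right g ∈ P.degreePart (n + m)
  left_mem : ∀ (n : ℤ) (f : ρ.inv I), (f : ρ.Poly) ∈ ρ.degreePart n → P.left f ∈ P.degreePart (n - σ)
  exists_trace : ∃ τ : P.carrier →+ ρ.inv I, (∀ f x, τ (P.left f * x) = f * τ x) ∧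
    (∀ g : ρ.inv J, (τ (P.right g) : ρ.Poly) = D g) ∧
    ∀ n, ∀ x ∈ P.degreePart n, (τ x : ρ.Poly) ∈ ρ.degreePart (n - σ)

theorem hasTrace_unit {L : Set B} (h : I ⊆ L) : (unit ρ I).HasTrace L 0 id where
  subset_left := h
  subset_right := h
  balanced _ := rfl
  mul_right_mem _ _ _ _ hx hg := mul_mem_degreePart hx hg
  left_mem n f hf := by rw [sub_zero]; exact hf
  exists_trace := ⟨AddMonoidHom.id _, fun _ _ => rfl, fun _ => rfl, fun n x hx => by
    rw [sub_zero]; exact hx⟩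

variable {L : Set B} {P : GradedBimodule ρ I J} {σ : ℤ} {D : ρ.Poly → ρ.Poly}

theorem HasTrace.restrictRight (hP : P.HasTrace L σ D) {K : Set B} (h : J ⊆ K) (hK : K ⊆ L) :
    (P.restrictRight h).HasTrace L σ D where
  subset_left := hP.subset_left
  subset_right := hK
  balanced r := hP.balanced r
  mul_right_mem n m x g hx hg := hP.mul_right_mem n m x (inclInv ρ h g) hx hg
  left_mem n f hf := hP.left_mem n f hf
  exists_trace := by
    obtain ⟨τ, h₁, h₂, h₃⟩ := hP.exists_trace
    exact ⟨τ, h₁, fun g => h₂ (inclInv ρ h g), h₃⟩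

/-- The new trace is `x ⊗ f ↦ τ(x · ∂(f))`, with `∂` the trace from `R^K` to `R^J`; it is balanced
because `∂` is `R^J`-linear. Since `∂` lowers degree by twice the difference of lengths and the
grading shift restores it once, `σ` grows by this difference. -/
theorem HasTrace.induceRight (hP : P.HasTrace L σ D) (hρ : ρ.IsAdmissible) (hJ : Finitary cs J)
    {K : Set B} (h : K ⊆ J) :
    (P.induceRight h ((parLength cs J : ℤ) - parLength cs K)).HasTrace L
      (σ + (parLength cs J - parLength cs K)) (D ∘ ρ.trace K J) := by
  set σ' : ℤ := parLength cs J - parLength cs K with hσ'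
  refine ⟨hP.subset_left, h.trans hP.subset_right, ?_, ?_, ?_, ?_⟩
  · intro r
    rw [induceRight_left, induceRight_right, hP.balanced, ← one_mul (P.right _), tmul_mul_right,
      mul_one]
    rfl
  · intro n m z g hz hg
    refine map_mem_of_mem_degreePart P h σ' (AddMonoidHom.mulRight ((P.induceRight h σ').right g))
      _ (fun a b x f hab hx hf => ?_) hz
    rw [AddMonoidHom.mulRight_apply, induceRight_right, tmul_mul_tmul, mul_one]
    exact tmul_mem_degreePart P h σ' hx (mul_mem_degreePart hf hg) (by omega)
  · intro n f hf
    exact tmul_mem_degreePart P h σ' (hP.left_mem n f hf) one_mem_degreePart (by omega)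
  · obtain ⟨τ, h₁, h₂, h₃⟩ := hP.exists_trace
    obtain ⟨τ', hτ'⟩ := exists_lift P h σ'
      (AddMonoidHom.mk' (fun x => τ.comp ((AddMonoidHom.mulLeft x).comp
        (P.right.toAddMonoidHom.comp (traceInv hρ hJ h)))) fun x y => by
          ext f; simp [add_mul])
      (fun x r f => by
        change τ (x * P.right r * P.right (traceInv hρ hJ h f)) =
          τ (x * P.right (traceInv hρ hJ h (inclInv ρ h r * f)))
        rw [traceInv_mul, map_mul P.right, mul_assoc])
    replace hτ' : ∀ (x : P.carrier) (f : ρ.inv K), τ' (tmul P h σ' x f) =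
      τ (x * P.right (traceInv hρ hJ h f)) := hτ'
    refine ⟨τ', fun f z => ?_, fun g => ?_, fun n z hz => ?_⟩
    · rw [induceRight_left]
      induction z using tmul_induction with
      | mk x g => rw [tmul_mul_tmul, hτ', hτ', one_mul, mul_assoc, h₁]
      | add z z' hz hz' => rw [mul_add, map_add, map_add, mul_add, hz, hz']
    · rw [induceRight_right, hτ', one_mul, h₂]
      rfl
    · refine map_mem_of_mem_degreePart P h σ' τ' ((ρ.degreePart (n - (σ + σ'))).toAddSubgroup.comap
        (ρ.inv I).val.toRingHom.toAddMonoidHom) (fun a b x f hab hx hf => ?_) hz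
      change (τ' (tmul P h σ' x f) : ρ.Poly) ∈ ρ.degreePart _
      rw [hτ']
      have := h₃ _ _ (hP.mul_right_mem a _ x (traceInv hρ hJ h f) hx
        (trace_mem_degreePart hρ hJ h hf))
      convert this using 2
      omega

end GradedBimodule

end BimoduleTraces

/-! ### Splitting off the bimodule of the short expression -/

section DirectSummands

variable {B : Type uB} {W : Type uW} [Group W] {M : CoxeterMatrix B} {cs : CoxeterSystem M W}
  {k : Type uk} [Field k] {V : Type uV} [AddCommGroup V] [Module k V]
  {ρ : Realization cs k V}

open Letter Realization

/-- The sum of the grading shifts of the steps down. -/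
def wordShift (cs : CoxeterSystem M W) (I : Set B) : Word B → ℤ
  | [] => 0
  | .up s :: w => wordShift cs (insert s I) w
  | .dn s :: w => (parLength cs I - parLength cs (I \ {s})) + wordShift cs (I \ {s}) w

/-- The composition of the traces of the steps down. -/
def wordTrace (ρ : Realization cs k V) (I : Set B) : Word B → ρ.Poly → ρ.Poly
  | [] => id
  | .up s :: w => wordTrace ρ (insert s I) w
  | .dn s :: w => ρ.trace (I \ {s}) I ∘ wordTrace ρ (I \ {s}) w

theorem wordShift_append (I : Set B) (a b : Word B) :
    wordShift cs I (a ++ b) = wordShift cs I a + wordShift cs (region I a) b := by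
  induction a generalizing I with
  | nil => simp [wordShift, region]
  | cons l a ih =>
    cases l with
    | up s => rw [List.cons_append, wordShift, ih, wordShift, region_cons, stepRegion]
    | dn s => rw [List.cons_append, wordShift, ih, wordShift, region_cons, stepRegion, add_assoc]

theorem wordTrace_append (I : Set B) (a b : Word B) :
    wordTrace ρ I (a ++ b) = wordTrace ρ I a ∘ wordTrace ρ (region I a) b := by
  induction a generalizing I with
  | nil => rfl
  | cons l a ih =>
    cases l with
    | up s => rw [List.cons_append, wordTrace, ih, wordTrace, region_cons, stepRegion]
    | dn s => rw [List.cons_append, wordTrace, ih, wordTrace, region_cons, stepRegion]; rfl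

namespace IsAdmissibleSeq

variable {L : Set B} {d : ℕ} {u : ℕ → B}

theorem wordShift_longWord (h : IsAdmissibleSeq cs L d u) {n : ℕ} (hn : n ≤ d) :
    wordShift cs (L \ {u 0}) (longWord u n) = traceLength cs L u n := by
  induction n with
  | zero => rfl
  | succ n ih =>
    have := h.parLength_diff_diff_le n
    rw [longWord, wordShift_append, ih (by omega), h.region_longWord (by omega), traceLength]
    simp only [wordShift]
    omega

theorem wordTrace_longWord (h : IsAdmissibleSeq cs L d u) (hρ : ρ.IsAdmissible) {n : ℕ}
    (hn : n ≤ d) (f : ρ.inv (L \ {u n})) :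
    wordTrace ρ (L \ {u 0}) (longWord u n) f = h.iterTrace hρ n f := by
  induction n with
  | zero => rfl
  | succ n ih =>
    rw [longWord, wordTrace_append, h.region_longWord (by omega), iterTrace_succ, ← ih (by omega)]
    rfl

end IsAdmissibleSeq

namespace GradedBimodule

variable {I J L : Set B}

/-- Upward steps only restrict the right action; each downward step contributes a trace and a shift.
The condition on the letters keeps all regions inside `L`, so that both actions of `R^L` continue to
agree. -/
theorem HasTrace.extend {P : GradedBimodule ρ I J} {σ : ℤ} {D : ρ.Poly → ρ.Poly}
    (hP : P.HasTrace L σ D) (hρ : ρ.IsAdmissible) (hL : Finitary cs L) (w : Word B)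
    (hw : ∀ s, up s ∈ w → s ∈ L) :
    (P.extend w).HasTrace L (σ + wordShift cs J w) (D ∘ wordTrace ρ J w) := by
  induction w generalizing J σ D with
  | nil =>
    rw [wordShift, add_zero]
    exact hP
  | cons l w ih =>
    cases l with
    | up s =>
      exact ih (hP.restrictRight (Set.subset_insert s J)
        (Set.insert_subset (hw s (by simp)) hP.subset_right)) fun t ht => hw t (by simp [ht])
    | dn s =>
      rw [wordShift, ← add_assoc]
      exact ih (hP.induceRight hρ (hL.mono hP.subset_right) Set.sdiff_subset)
        fun t ht => hw t (by simp [ht])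

/-- A bimodule with a trace that restricts to the trace of `R^L ⊆ R^J` on `R^J` contains
`R^I ⊗_{R^L} R^J` as a direct summand. -/
theorem HasTrace.isDirectSummand {J' : Set B} {Q : GradedBimodule ρ I J'} {D : ρ.Poly → ρ.Poly}
    (hρ : ρ.IsAdmissible) (hL : Finitary cs L) (hIL : I ⊆ L) (hJL : J ⊆ L) (e : J = J')
    (hQ : Q.HasTrace L (parLength cs L - parLength cs J) D)
    (hD : ∀ f ∈ ρ.inv J, D f = ρ.trace J L f) :
    ((((unit ρ I).restrictRight hIL).induceRight hJL
      (parLength cs L - parLength cs J)).restrictRight e.subset).IsDirectSummand Q := by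
  subst e
  set σ : ℤ := parLength cs L - parLength cs J with hσ
  set U := (unit ρ I).restrictRight hIL with hU
  have hle : parLength cs J ≤ parLength cs L := by
    have := length_longest_mul_longest_inv hL hJL
    omega
  obtain ⟨N, c, c', a, b, hc, ha, hb, hab⟩ := exists_isDualBases hρ hL hJL
  obtain ⟨τ, h₁, h₂, h₃⟩ := hQ.exists_trace
  have h₁' : ∀ (r : ρ.inv L) x, τ (x * Q.right (inclInv ρ hJL r)) = inclInv ρ hIL r * τ x := by
    intro r x
    rw [← hQ.balanced, mul_comm, h₁]
  have h₂' : ∀ g : ρ.inv J, τ (Q.right g) = inclInv ρ hIL (traceInv hρ hL hJL g) := fun g =>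
    Subtype.ext ((h₂ g).trans (hD g g.2))
  let t : ρ.inv I →+ ρ.inv J →+ (U.induceRight hJL σ).carrier := tmul U hJL σ
  have ht : ∀ (x : ρ.inv I) (r : ρ.inv L) f,
    t (inclInv ρ hIL r * x) f = t x (inclInv ρ hJL r * f) := fun x r f => by
      rw [mul_comm]; exact tmul_mul_right U hJL σ x r f
  have tt : ∀ (x y : ρ.inv I) f g, t x f * t y g = t (x * y) (f * g) :=
    tmul_mul_tmul U hJL σ
  let F : ρ.inv I →+ ρ.inv J →+ Q.carrier := AddMonoidHom.mk' (fun x =>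
    (AddMonoidHom.mulLeft (Q.left x)).comp Q.right.toAddMonoidHom)
    fun x y => by ext f; simp [add_mul]
  obtain ⟨i, hi⟩ : ∃ i : (U.induceRight hJL σ).carrier →+ Q.carrier, ∀ (x : ρ.inv I) (f : ρ.inv J),
      i (t x f) = Q.left x * Q.right f :=
    exists_lift U hJL σ F fun (x : ρ.inv I) r f => by
      change Q.left (x * inclInv ρ hIL r) * Q.right f = Q.left x * Q.right (inclInv ρ hJL r * f)
      rw [map_mul, map_mul, hQ.balanced, mul_assoc]
  -- The projection multiplies by the coproduct element of `R^L ⊆ R^J` and applies `τ` to the first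
  -- factor.
  let p : Q.carrier →+ (U.induceRight hJL σ).carrier :=
    ∑ j, (t.flip (c' j)).comp (τ.comp (AddMonoidHom.mulRight (Q.right (c j))))
  have hp : ∀ z, p z = ∑ j, t (τ (z * Q.right (c j))) (c' j) := fun z => by
    simp [p, AddMonoidHom.finsetSum_apply]
  refine ⟨⟨i, ?_, ?_, ?_⟩, ⟨p, ?_, ?_, ?_⟩, ?_⟩
  · intro f (z : (U.induceRight hJL σ).carrier)
    change i (t f 1 * z) = Q.left f * i z
    have e₁ : ∀ (x : ρ.inv I) g, i (t f 1 * t x g) = Q.left f * i (t x g) := fun x g => by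
      rw [tt, one_mul, hi, hi, map_mul, mul_assoc]
    induction z using tmul_induction with
    | mk x g => exact e₁ x g
    | add z z' hz hz' => rw [mul_add, map_add, map_add, mul_add, hz, hz']
  · intro (z : (U.induceRight hJL σ).carrier) f
    change i (z * t 1 f) = i z * Q.right f
    have e₁ : ∀ (x : ρ.inv I) g, i (t x g * t 1 f) = i (t x g) * Q.right f := fun x g => by
      rw [tt, mul_one, hi, hi, map_mul, mul_assoc]
    induction z using tmul_induction with
    | mk x g => exact e₁ x g
    | add z z' hz hz' => rw [add_mul, map_add, map_add, add_mul, hz, hz']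
  · intro n z hz
    refine map_mem_of_mem_degreePart U hJL σ i _ (fun a b x f hab hx hf => ?_) hz
    refine (hi x f).symm ▸ ?_
    have := hQ.mul_right_mem _ b _ f (hQ.left_mem a x hx) hf
    convert this using 2
    omega
  · intro f z
    change p _ = t f 1 * p z
    rw [hp, hp, Finset.mul_sum]
    refine Finset.sum_congr rfl fun j _ => ?_
    rw [mul_assoc, h₁, tt, one_mul]
  · intro z f
    change p _ = p z * t 1 f
    rw [hp, hp, Finset.sum_mul]
    -- Right linearity is the identity `∑ f c_j ⊗ c'_j = ∑ c_l ⊗ c'_l f`: expand `f c_j` in the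
    -- basis `c`, move the coefficients in `R^L` across the tensor sign, and collect `c'_l f` in the
    -- basis `c'`.
    have e₁ : ∀ j, t (τ (z * Q.right f * Q.right (c j))) (c' j) =
        ∑ l, t (τ (z * Q.right (c l)))
          (inclInv ρ hJL (traceInv hρ hL hJL (f * c j * c' l)) * c' j) := by
      intro j
      conv_lhs => rw [mul_assoc, ← map_mul Q.right, ← hc.sum_traceInv hρ hL hJL (f * c j)]
      rw [map_sum, Finset.mul_sum, map_sum, map_sum, AddMonoidHom.finsetSum_apply]
      refine Finset.sum_congr rfl fun l _ => ?_
      rw [mul_comm (inclInv ρ hJL _) (c l), map_mul Q.right, ← mul_assoc, h₁', ht]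
    simp_rw [e₁]
    rw [Finset.sum_comm]
    refine Finset.sum_congr rfl fun l _ => ?_
    rw [← map_sum, tt, mul_one, ← hc.symm.sum_traceInv hρ hL hJL (c' l * f)]
    refine congrArg (t (τ (z * Q.right (c l)))) (Finset.sum_congr rfl fun j _ => ?_)
    congr 3
    ring
  · intro n z hz
    change p z ∈ (U.induceRight hJL σ).degreePart n
    rw [hp]
    refine sum_mem fun j _ => ?_
    -- The degrees of `c_j` and `c'_j` add up to `2σ`: one `σ` cancels the degree of `τ`, the other
    -- the shift of the target.
    have hcj := hQ.mul_right_mem n _ z (c j) hz ((ha j).mem_degreePart rfl)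
    refine tmul_mem_degreePart U hJL σ (h₃ _ _ hcj) ((hb j).mem_degreePart rfl) ?_
    have := hab j
    omega
  · intro (z : (U.induceRight hJL σ).carrier)
    change p (i z) = z
    have e₁ : ∀ (x : ρ.inv I) f, p (i (t x f)) = t x f := by
      intro x f
      -- On the image of `R^J` the map `τ` is the trace to `R^L`, so the sum is the dual basis
      -- expansion of `f`.
      have e₂ : ∀ j, t (τ (Q.left x * Q.right f * Q.right (c j))) (c' j) =
          t x (inclInv ρ hJL (traceInv hρ hL hJL (f * c j)) * c' j) := by
        intro j
        rw [mul_assoc, ← map_mul, h₁, h₂', mul_comm x, ht]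
      rw [hi, hp]
      simp_rw [e₂]
      rw [← map_sum, hc.symm.sum_traceInv hρ hL hJL f]
    induction z using tmul_induction with
    | mk x f => exact e₁ x f
    | add z z' hz hz' => rw [map_add, map_add, hz, hz']

end GradedBimodule

theorem up_mem_longWord {u : ℕ → B} {s : B} {n : ℕ} (hs : up s ∈ longWord u n) :
    ∃ i < n, s = u i := by
  induction n with
  | zero => simp [longWord] at hs
  | succ n ih =>
    rw [longWord, List.mem_append] at hs
    rcases hs with hs | hs
    · obtain ⟨i, hi, rfl⟩ := ih hs
      exact ⟨i, by omega, rfl⟩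
    · exact ⟨n, by omega, by simpa using hs⟩

theorem IsSwitchback.isDirectSummand {L : Set B} {d : ℕ} {u : ℕ → B} (h : IsSwitchback cs L d u)
    (hρ : ρ.IsAdmissible) :
    (GradedBimodule.bottSamelson ρ h.seq.shortExpr).IsDirectSummand
      (GradedBimodule.bottSamelson ρ h.seq.longExpr) := by
  -- The bimodule of the short expression unfolds with `insert (u 0) (L \ {u 0})` in place of `L`,
  -- so the larger set is kept in this form.
  have eL : insert (u 0) (L \ {u 0}) = L := h.seq.insert_diff (Nat.zero_le d)
  have hL : Finitary cs (insert (u 0) (L \ {u 0})) := by rw [eL]; exact h.seq.finitary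
  have hQ := ((GradedBimodule.hasTrace_unit (ρ := ρ) (Set.subset_insert (u 0) (L \ {u 0}))).extend
    hρ hL (longWord u d) fun s hs => by
      obtain ⟨i, hi, rfl⟩ := up_mem_longWord hs
      rw [eL]
      exact h.seq.mem i hi.le).restrictRight h.seq.longExpr.region_eq.subset
        (by rw [eL]; exact Set.sdiff_subset)
  refine GradedBimodule.HasTrace.isDirectSummand (L := insert (u 0) (L \ {u 0}))
    (J := insert (u 0) (L \ {u 0}) \ {u d}) (D := wordTrace ρ (L \ {u 0}) (longWord u d)) hρ hL
    (Set.subset_insert _ _) Set.sdiff_subset h.seq.shortExpr.region_eq ?_ ?_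
  -- The shifts along the long expression sum to `ℓ(L) - ℓ(J)` because that expression is reduced.
  · have hσ : (parLength cs (insert (u 0) (L \ {u 0})) : ℤ) -
        parLength cs (insert (u 0) (L \ {u 0}) \ {u d}) =
        0 + wordShift cs (L \ {u 0}) (longWord u d) := by
      have := h.traceLength_add_parLength
      rw [h.seq.wordShift_longWord le_rfl, eL]
      omega
    rw [hσ]
    exact hQ
  · rw [eL]
    intro f hf
    exact (h.seq.wordTrace_longWord hρ le_rfl ⟨f, hf⟩).trans
      (congrArg Subtype.val (h.iterTrace_eq hρ ⟨f, hf⟩))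

end DirectSummands

end SingularSoergel
end

theorem mainTheorem8 {B W : Type*} [Group W] {M : CoxeterMatrix B} (cs : CoxeterSystem M W)
    {k V : Type*} [Field k] [AddCommGroup V] [Module k V] [FiniteDimensional k V]
    (ρ : SingularSoergel.Realization cs k V) (hρ : ρ.IsAdmissible)
    (L : Set B) (d : ℕ) (u : ℕ → B) (h : SingularSoergel.IsSwitchback cs L d u) :
    h.seq.rexMove ρ ≫ h.seq.rexMoveBack ρ = 𝟙 (h.seq.shortObj ρ) ∧
    (SingularSoergel.GradedBimodule.bottSamelson ρ h.seq.shortExpr).IsDirectSummand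
      (SingularSoergel.GradedBimodule.bottSamelson ρ h.seq.longExpr) :=
  ⟨h.rexMove_comp_rexMoveBack hρ, h.isDirectSummand hρ⟩
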